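/- **Setting.** Let $\mathcal I$ be a Steiner forest instance: a finite undirected graph $G=(V,E)$ with costs $c_e\ge 0$ and demand pairs $\{a_i,b_i\}\subseteq V$, such that each demand pair is connected in $G$. A *solution* is a set $F\subseteq E$ such that every demand pair is connected in $(V,F)$; its cost is $c(F)=\sum_{e\in F}c_e$. Let $\varepsilon\ge 0$. **The $\varepsilon$-extended moat-growing algorithm.** At time $t\ge 0$ there are dual values $y_S(t)\ge 0$ $(S\subseteq V)$, with $y(0)=0$. Let $\mathcal C^t$ be the set of connected components of the graph formed by the tight edges, i.e. those $e$ with $\sum_{S:\,e\in\delta(S)}y_S(t)=c_e$. Each component $S\in\mathcal C^t$ has a budget $b_S(t)\ge 0$, initially $0$. A component is *demand-active* if it separates some demand pair, *budget-active* if it is not demand-active but $b_S(t)>0$, and *active* if it is one or the other; $\mathcal A^t\subseteq\mathcal C^t$ is the set of active components. The values $y_S(t)$ of active components grow at rate $1$ and all others stay constant; budgets of demand-active components grow at rate $\varepsilon$ and budgets of budget-active components decrease at rate $1$. When components merge, their budgets are added. Let $y$ be the final dual vector, $\mathcal U$ its support, and $y(\mathcal U)=\sum_{U\in\mathcal U}y_U$.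 **Actively connected sets.** The deactivation time $\mathrm{deac}_v$ of $v\in V$ is the largest $t$ such that $v$ belongs to a member of $\mathcal A^s$ for all $0\le s<t$. Vertices $u,v$ are *actively connected* if for some $t\ge 0$ they lie in the same member of $\mathcal C^t$ and $t\le\min(\mathrm{deac}_u,\mathrm{deac}_v)$; this is an equivalence relation. A set $A\subseteq V$ is *actively connected* if it is contained in one equivalence class. For a collection $\mathcal S$ of actively connected sets, $$\mathrm{gain}(\mathcal S)=2\int_0^\infty\big(|\mathcal A^t|-|\mathcal A^t/\mathcal S|\big)\,dt,$$ where $\mathcal A^t/\mathcal S$ arises from $\mathcal A^t$ by merging (transitively) members that are intersected by the same $S\in\mathcal S$. Let $\mathcal I/\mathcal S$ be the instance obtained from $\mathcal I$ by contracting each set $S\in\mathcal S$. **Statement.** There is an algorithm which, given such an $\mathcal I$, a number $\varepsilon\ge 0$, and a collection $\mathcal S$ of vertex sets each of which is actively connected, computes a solution $F$ of $\mathcal I/\mathcal S$ of cost $$c(F)\ \le\ 2\,y(\mathcal U)-\mathrm{gain}(\mathcal S)$$ in a number of steps that is polynomial in the number of vertices, edges, demand pairs and members of $\mathcal S$. Here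 a step is an elementary operation of a random access machine whose arithmetic on the real-valued data consists of addition, subtraction, comparison, halving and multiplication by $\varepsilon$ only (so that for rational data the running time on a Turing machine is polynomial as well). -/

import Mathlib

open MeasureTheory

/-! ### Steiner forest instances -/

/-- A Steiner forest instance: an undirected (multi)graph with vertex set `V` and edge set `E`
(`ends e` lists the two endpoints of `e`, in an arbitrary order), non-negative edge costs, and
demand pairs indexed by `D`. -/
structure SteinerForest (V E D : Type*) where
  ends : E → V × V
  cost : E → ℝ
  cost_nonneg : ∀ e, 0 ≤ cost e
  demand : D → V × V

namespace SteinerForest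

/-- Being in the same connected component of the graph `(V, F)`. -/
def connectivity {V E D : Type*} (I : SteinerForest V E D) (F : Set E) : Setoid V :=
  Relation.EqvGen.setoid (fun u v => ∃ e ∈ F, I.ends e = (u, v))

/-- `F` is a solution: the vertices of each demand pair are connected in `(V, F)`. -/
def IsSolution {V E D : Type*} (I : SteinerForest V E D) (F : Finset E) : Prop :=
  ∀ d, (I.connectivity (F : Set E)).r (I.demand d).1 (I.demand d).2

/-- `c(F)`, the total cost of an edge set. -/
def totalCost {V E D : Type*} (I : SteinerForest V E D) (F : Finset E) : ℝ :=
  ∑ e ∈ F, I.cost e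

/-- The identification of vertices caused by contracting every set of the collection `𝒮`. -/
def contractSetoid {V : Type*} (𝒮 : Set (Finset V)) : Setoid V :=
  Relation.EqvGen.setoid (fun u v => ∃ S ∈ 𝒮, u ∈ S ∧ v ∈ S)

/-- The contracted instance `I / 𝒮`: same edges, costs and demands, with each `S ∈ 𝒮` shrunk to a
single vertex (edges that become loops are kept; they play no role). -/
def contract {V E D : Type*} (I : SteinerForest V E D) (𝒮 : Set (Finset V)) :
    SteinerForest (Quotient (contractSetoid 𝒮)) E D where
  ends e := (Quotient.mk _ (I.ends e).1, Quotient.mk _ (I.ends e).2)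
  cost := I.cost
  cost_nonneg := I.cost_nonneg
  demand d := (Quotient.mk _ (I.demand d).1, Quotient.mk _ (I.demand d).2)

/-! ### The `ε`-extended moat-growing algorithm

The run is piecewise linear in time, so it is given by its sequence of events: between two
consecutive events the set of active components does not change. -/

/-- `e ∈ δ(U)`: exactly one endpoint of `e` lies in `U`. -/
def Cuts {V E D : Type*} (I : SteinerForest V E D) (U : Finset V) (e : E) : Prop :=
  Xor ((I.ends e).1 ∈ U) ((I.ends e).2 ∈ U)

/-- `U` separates the demand pair `d`. -/
def Separates {V E D : Type*} (I : SteinerForest V E D) (U : Finset V) (d : D) : Prop :=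
  Xor ((I.demand d).1 ∈ U) ((I.demand d).2 ∈ U)

open Classical in
/-- `∑_{S : e ∈ δ(S)} y_S`. -/
noncomputable def load {V E D : Type*} [Fintype V] (I : SteinerForest V E D)
    (y : Finset V → ℝ) (e : E) : ℝ :=
  ∑ S ∈ Finset.univ.filter (fun S : Finset V => I.Cuts S e), y S

/-- The set of tight edges for the dual vector `y`. -/
def tight {V E D : Type*} [Fintype V] (I : SteinerForest V E D) (y : Finset V → ℝ) : Set E :=
  {e | I.load y e = I.cost e}

open Classical in
/-- The vertex set of the connected component of `v` in `(V, F)`. -/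
noncomputable def component {V E D : Type*} [Fintype V] (I : SteinerForest V E D)
    (F : Set E) (v : V) : Finset V :=
  Finset.univ.filter (fun u => (I.connectivity F).r v u)

open Classical in
/-- The vertex sets of the connected components of `(V, F)`. -/
noncomputable def components {V E D : Type*} [Fintype V] (I : SteinerForest V E D)
    (F : Set E) : Finset (Finset V) :=
  Finset.univ.image (I.component F)

/-- The state of the algorithm: current time `t`, duals `y_S(t)`, and budgets `b_S(t)`. Only the
budgets of the current components are meaningful. -/
structure State (V : Type*) where
  time : ℝ
  dual : Finset V → ℝ
  budget : Finset V → ℝ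

/-- The current components, `𝒞ᵗ`: the components of the graph formed by the tight edges. -/
noncomputable def currentComponents {V E D : Type*} [Fintype V] (I : SteinerForest V E D)
    (s : State V) : Finset (Finset V) :=
  I.components (I.tight s.dual)

/-- A component is demand-active if it contains a terminal with a partner to which it is not yet
connected, i.e. with a partner outside the component. -/
def DemandActive {V E D : Type*} (I : SteinerForest V E D) (S : Finset V) : Prop :=
  ∃ d, I.Separates S d

/-- A component is budget-active if it is not demand-active but has positive budget. -/
def BudgetActive {V E D : Type*} (I : SteinerForest V E D) (s : State V) (S : Finset V) : Prop :=
  ¬ I.DemandActive S ∧ 0 < s.budget S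

open Classical in
/-- The active components `𝒜ᵗ`. -/
noncomputable def active {V E D : Type*} [Fintype V] (I : SteinerForest V E D)
    (s : State V) : Finset (Finset V) :=
  (I.currentComponents s).filter (fun S => I.DemandActive S ∨ I.BudgetActive s S)

open Classical in
/-- Rate at which the load of `e` currently grows: number of active components cut by `e`. -/
noncomputable def rate {V E D : Type*} [Fintype V] (I : SteinerForest V E D)
    (s : State V) (e : E) : ℕ :=
  ((I.active s).filter (fun S => I.Cuts S e)).card

open Classical in
/-- The delays after which, at the current growth rates, an edge becomes tight or the budget of a
budget-active component is used up. -/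
noncomputable def eventDelays {V E D : Type*} [Fintype V] [Fintype E] (I : SteinerForest V E D)
    (s : State V) : Finset ℝ :=
  (Finset.univ.filter (fun e => I.rate s e ≠ 0)).image
      (fun e => (I.cost e - I.load s.dual e) / (I.rate s e : ℝ)) ∪
    ((I.active s).filter (fun S => I.BudgetActive s S)).image s.budget

open Classical in
/-- Let time advance by `δ` with the current active components: their duals grow at unit rate,
budgets of demand-active components grow at rate `ε`, budgets of budget-active components shrink
at unit rate. -/
noncomputable def grow {V E D : Type*} [Fintype V] (I : SteinerForest V E D) (ε : ℝ)
    (s : State V) (δ : ℝ) : State V where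
  time := s.time + δ
  dual S := if S ∈ I.active s then s.dual S + δ else s.dual S
  budget S :=
    if S ∈ I.active s then
      if I.DemandActive S then s.budget S + ε * δ else s.budget S - δ
    else s.budget S

open Classical in
/-- Run until the next event. Newly tight edges enter the edge set and the budget of a merged
component is the sum of the budgets of the components it arises from. If no event is to come, the
state is left as it is. -/
noncomputable def step {V E D : Type*} [Fintype V] [Fintype E] (I : SteinerForest V E D) (ε : ℝ)
    (s : State V) : State V :=
  if h : (I.eventDelays s).Nonempty then
    let s' := I.grow ε s ((I.eventDelays s).min' h)
    { time := s'.time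
      dual := s'.dual
      budget := fun S =>
        ∑ S' ∈ (I.currentComponents s).filter (fun S' => S' ⊆ S), s'.budget S' }
  else s

/-- The state at time `0`: all duals and budgets vanish. -/
def initial (V : Type*) : State V where
  time := 0
  dual := fun _ => 0
  budget := fun _ => 0

/-- The state right after the `k`-th event. -/
noncomputable def run {V E D : Type*} [Fintype V] [Fintype E] (I : SteinerForest V E D) (ε : ℝ)
    (k : ℕ) : State V :=
  (I.step ε)^[k] (initial V)

/-- No further event takes place. -/
def Halted {V E D : Type*} [Fintype V] [Fintype E] (I : SteinerForest V E D) (s : State V) :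
    Prop :=
  I.eventDelays s = ∅

/-- The number of events that took place up to (and including) time `t`, for `t ≥ 0`. -/
noncomputable def eventIndex {V E D : Type*} [Fintype V] [Fintype E] (I : SteinerForest V E D)
    (ε t : ℝ) : ℕ :=
  sInf {k | t < (I.run ε (k + 1)).time ∨ I.Halted (I.run ε k)}

/-- `𝒞ᵗ`. -/
noncomputable def componentsAt {V E D : Type*} [Fintype V] [Fintype E] (I : SteinerForest V E D)
    (ε t : ℝ) : Finset (Finset V) :=
  I.currentComponents (I.run ε (I.eventIndex ε t))

/-- `𝒜ᵗ`. -/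
noncomputable def activeAt {V E D : Type*} [Fintype V] [Fintype E] (I : SteinerForest V E D)
    (ε t : ℝ) : Finset (Finset V) :=
  I.active (I.run ε (I.eventIndex ε t))

/-- The dual solution `y` generated by the extended algorithm when it terminates. -/
noncomputable def dualSolution {V E D : Type*} [Fintype V] [Fintype E] (I : SteinerForest V E D)
    (ε : ℝ) : Finset V → ℝ :=
  (I.run ε (sInf {k | I.Halted (I.run ε k)})).dual

open Classical in
/-- `y(𝒰)`, where `𝒰` is the support of the dual solution `y`. -/
noncomputable def dualTotal {V E D : Type*} [Fintype V] [Fintype E] (I : SteinerForest V E D)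
    (ε : ℝ) : ℝ :=
  ∑ U ∈ Finset.univ.filter (fun U : Finset V => I.dualSolution ε U ≠ 0), I.dualSolution ε U

/-! ### Actively connected sets and gain -/

/-- The deactivation time of `v`: the largest `t` such that `v` belongs to an active component at
all times `s < t`. -/
noncomputable def deactivationTime {V E D : Type*} [Fintype V] [Fintype E]
    (I : SteinerForest V E D) (ε : ℝ) (v : V) : ℝ :=
  sSup {t | 0 ≤ t ∧ ∀ s, 0 ≤ s → s < t → ∃ S ∈ I.activeAt ε s, v ∈ S}

/-- `u` and `v` are actively connected vertices. -/
def ActivelyConnected {V E D : Type*} [Fintype V] [Fintype E]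
    (I : SteinerForest V E D) (ε : ℝ) (u v : V) : Prop :=
  ∃ t, 0 ≤ t ∧ (∃ S ∈ I.componentsAt ε t, u ∈ S ∧ v ∈ S) ∧
    t ≤ I.deactivationTime ε u ∧ t ≤ I.deactivationTime ε v

/-- `A` is an actively connected set: it is contained in a class of the relation above. -/
def ActivelyConnectedSet {V E D : Type*} [Fintype V] [Fintype E]
    (I : SteinerForest V E D) (ε : ℝ) (A : Finset V) : Prop :=
  ∃ w, ∀ v ∈ A, I.ActivelyConnected ε w v

open Classical in
/-- `𝒜 / 𝒮`: merge members of `𝒜` into a single set whenever they are intersected by the same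
set `S ∈ 𝒮` (transitively). -/
noncomputable def mergeFamily {V : Type*} (𝒜 : Finset (Finset V)) (𝒮 : Set (Finset V)) :
    Finset (Finset V) :=
  𝒜.image (fun X =>
    (𝒜.filter (fun Y =>
      Relation.EqvGen (fun A B => A ∈ 𝒜 ∧ B ∈ 𝒜 ∧
        ∃ S ∈ 𝒮, (S ∩ A).Nonempty ∧ (S ∩ B).Nonempty) X Y)).biUnion id)

/-- `gain(𝒮) = 2 ∫₀^∞ (|𝒜ᵗ| - |𝒜ᵗ / 𝒮|) dt`. -/
noncomputable def gain {V E D : Type*} [Fintype V] [Fintype E]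
    (I : SteinerForest V E D) (ε : ℝ) (𝒮 : Set (Finset V)) : ℝ :=
  2 * ∫ t in Set.Ioi (0 : ℝ),
    (((I.activeAt ε t).card : ℝ) - ((mergeFamily (I.activeAt ε t) 𝒮).card : ℝ))

end SteinerForest

/-! ### A random access machine

Programs work on two-dimensional arrays of natural numbers and of real numbers. Arithmetic is
restricted to addition, subtraction, halving, and scaling by a fixed input parameter `ε`. There is
no unrestricted multiplication, so on rational data `T` steps only produce numbers whose encoding
length is polynomial in `T` and the input length; a polynomial number of steps of this machine is
therefore also polynomial time on a Turing machine. -/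

namespace RAM

/-- Expressions over the natural numbers; `get a i j` is the entry `a[i, j]` of the array with
(constant) name `a`, and `sub` is truncated subtraction. -/
inductive NatExpr where
  | const (k : ℕ)
  | get (a : ℕ) (i j : NatExpr)
  | add (x y : NatExpr)
  | sub (x y : NatExpr)

/-- Expressions over the reals; `scale x` is `ε * x`. -/
inductive RealExpr where
  | zero
  | get (a : ℕ) (i j : NatExpr)
  | add (x y : RealExpr)
  | sub (x y : RealExpr)
  | half (x : RealExpr)
  | scale (x : RealExpr)

/-- Boolean tests. -/
inductive Test where
  | natLE (x y : NatExpr)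
  | realLE (x y : RealExpr)
  | neg (b : Test)
  | conj (b c : Test)

/-- Programs. -/
inductive Program where
  | skip
  | setNat (a : ℕ) (i j x : NatExpr)
  | setReal (a : ℕ) (i j : NatExpr) (x : RealExpr)
  | seq (p q : Program)
  | cond (b : Test) (p q : Program)
  | loop (b : Test) (p : Program)

/-- The memory: entry `[i, j]` of the array named `a`. -/
structure Memory where
  nat : ℕ → ℕ → ℕ → ℕ
  real : ℕ → ℕ → ℕ → ℝ

def NatExpr.eval (σ : Memory) : NatExpr → ℕ
  | .const k => k
  | .get a i j => σ.nat a (i.eval σ) (j.eval σ)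
  | .add x y => x.eval σ + y.eval σ
  | .sub x y => x.eval σ - y.eval σ

noncomputable def RealExpr.eval (ε : ℝ) (σ : Memory) : RealExpr → ℝ
  | .zero => 0
  | .get a i j => σ.real a (i.eval σ) (j.eval σ)
  | .add x y => x.eval ε σ + y.eval ε σ
  | .sub x y => x.eval ε σ - y.eval ε σ
  | .half x => x.eval ε σ / 2
  | .scale x => ε * x.eval ε σ

def Test.Holds (ε : ℝ) (σ : Memory) : Test → Prop
  | .natLE x y => x.eval σ ≤ y.eval σ
  | .realLE x y => x.eval ε σ ≤ y.eval ε σ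
  | .neg b => ¬ b.Holds ε σ
  | .conj b c => b.Holds ε σ ∧ c.Holds ε σ

def Memory.setNat (σ : Memory) (a i j x : ℕ) : Memory where
  nat a' i' j' := if a' = a ∧ i' = i ∧ j' = j then x else σ.nat a' i' j'
  real := σ.real

def Memory.setReal (σ : Memory) (a i j : ℕ) (x : ℝ) : Memory where
  nat := σ.nat
  real a' i' j' := if a' = a ∧ i' = i ∧ j' = j then x else σ.real a' i' j'

/-- `Exec ε p σ T σ'`: started in memory `σ`, the program `p` stops in memory `σ'` after exactly
`T` steps; every assignment, every test of a branch or a loop, and `skip` is one step (the size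
of the expressions in a given program is a constant). -/
inductive Exec (ε : ℝ) : Program → Memory → ℕ → Memory → Prop where
  | skip (σ : Memory) : Exec ε .skip σ 1 σ
  | setNat (a : ℕ) (i j x : NatExpr) (σ : Memory) :
      Exec ε (.setNat a i j x) σ 1 (σ.setNat a (i.eval σ) (j.eval σ) (x.eval σ))
  | setReal (a : ℕ) (i j : NatExpr) (x : RealExpr) (σ : Memory) :
      Exec ε (.setReal a i j x) σ 1 (σ.setReal a (i.eval σ) (j.eval σ) (x.eval ε σ))
  | seq {p q : Program} {σ₁ σ₂ σ₃ : Memory} {T₁ T₂ : ℕ} :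
      Exec ε p σ₁ T₁ σ₂ → Exec ε q σ₂ T₂ σ₃ → Exec ε (.seq p q) σ₁ (T₁ + T₂) σ₃
  | cond_true {b : Test} {p q : Program} {σ σ' : Memory} {T : ℕ} :
      b.Holds ε σ → Exec ε p σ T σ' → Exec ε (.cond b p q) σ (T + 1) σ'
  | cond_false {b : Test} {p q : Program} {σ σ' : Memory} {T : ℕ} :
      ¬ b.Holds ε σ → Exec ε q σ T σ' → Exec ε (.cond b p q) σ (T + 1) σ'
  | loop_true {b : Test} {p : Program} {σ₁ σ₂ σ₃ : Memory} {T₁ T₂ : ℕ} :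
      b.Holds ε σ₁ → Exec ε p σ₁ T₁ σ₂ → Exec ε (.loop b p) σ₂ T₂ σ₃ →
        Exec ε (.loop b p) σ₁ (T₁ + T₂ + 1) σ₃
  | loop_false {b : Test} {p : Program} {σ : Memory} :
      ¬ b.Holds ε σ → Exec ε (.loop b p) σ 1 σ

open Classical in
/-- The input memory for an instance with `n` vertices, `m` edges and `h` demand pairs and a
collection of `k` vertex sets. Natural arrays: `0` holds `n, m, h, k`; `1` the endpoints of the
edges; `2` the demand pairs; `3` the incidence matrix of the collection. Real array `0` holds the
edge costs. All other entries are `0`. -/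
noncomputable def encode {n m h k : ℕ} (I : SteinerForest (Fin n) (Fin m) (Fin h))
    (𝒮 : Fin k → Finset (Fin n)) : Memory where
  nat a i j :=
    match a with
    | 0 => if j = 0 then
        (if i = 0 then n else if i = 1 then m else if i = 2 then h else if i = 3 then k else 0)
        else 0
    | 1 => if hi : i < m then
        (if j = 0 then ((I.ends ⟨i, hi⟩).1 : ℕ) else if j = 1 then ((I.ends ⟨i, hi⟩).2 : ℕ) else 0)
        else 0
    | 2 => if hi : i < h then
        (if j = 0 then ((I.demand ⟨i, hi⟩).1 : ℕ)
          else if j = 1 then ((I.demand ⟨i, hi⟩).2 : ℕ) else 0)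
        else 0
    | 3 => if ∃ (hi : i < k) (hj : j < n), (⟨j, hj⟩ : Fin n) ∈ 𝒮 ⟨i, hi⟩ then 1 else 0
    | _ => 0
  real a i j := if hi : i < m then (if a = 0 ∧ j = 0 then I.cost ⟨i, hi⟩ else 0) else 0

/-- The edge set read off from the output array (natural array `4`). -/
def decode (m : ℕ) (σ : Memory) : Finset (Fin m) :=
  Finset.univ.filter (fun e => σ.nat 4 (e : ℕ) 0 = 1)

end RAM

set_option linter.unusedSectionVars false

namespace SteinerForest

/-! ### Components of edge sets, before and after contraction. -/

section Connectivity

variable {V E D : Type*} (I : SteinerForest V E D)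

/-! The term `|𝒜ᵗ|` occurs both in the dual total and in the gain and cancels: the right-hand side
equals `2 ∫ |𝒜ᵗ/𝒮| dt`, a finite sum over the events of the extended algorithm
(`dualTotal_sub_gain`). It is therefore enough to find a solution of the contracted instance that
costs at most twice this integral.

To this end a second moat-growing process runs on the contracted graph, on the same clock, with
activity borrowed from the first one: a class of the second process grows exactly when it contains a
vertex that currently lies in an active component of the first process. The second process is always
ahead. Its partition is coarser than the partition into components, and every edge between two of
its classes carries at least the load that it has in the first process. Indeed an end of such an
edge that is active in the first process is also active in the second (`edgeRate_mono`), so the load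
grows at least as fast; and an edge that becomes tight in the first process has by then been paid
for in the second, so its ends already share a class there. Because the partition is coarser than
both the components and the contracted sets, distinct active classes meet distinct members of
`𝒜ᵗ/𝒮`, so at most `|𝒜ᵗ/𝒮|` moats grow at time `t` (`classCount_le_mergeFamily`).

The standard primal-dual argument applies to the second process. A demand pair not yet joined in it
is not joined in the first process either, so both its ends lie in demand-active components and
hence in active classes. Consider an inclusion-minimal solution inside the selected tight edges. Its
edges not yet selected form a forest on the current classes, and an inactive class cannot be a leaf:
the only edge leaving it would serve no demand. Hence the active classes have average degree at most
2 (`sum_growth_le`), and integration bounds the cost of the solution by twice the integral of the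
number of active moats (`cost_le_of_transitions`). When the first process halts all demands are
joined in it, hence in the coarser partition, so the selected edges contain a solution.

For the running time, the number of components plus the number of active components drops at every
event, so `2|V|` events suffice (`halted_run`). Between two of them each step of the second process
uses up the remaining time or selects a further edge, so `m + 1` steps suffice. Loads only ever grow
at rates 0, 1 or 2, so halving replaces division. Budgets are stored as vertex weights whose sum
over a component is its budget, so that merging needs no work. The program is written with bounded
loops only, from which correct execution and a polynomial time bound follow by structural induction
(`exec_compile`). -/

theorem connectivity_le {F : Set E} {R : Setoid V} :
    I.connectivity F ≤ R ↔ ∀ e ∈ F, R (I.ends e).1 (I.ends e).2 := by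
  constructor
  · intro h e he
    exact h (Relation.EqvGen.rel _ _ ⟨e, he, rfl⟩)
  · intro h
    refine Setoid.eqvGen_le ?_
    rintro x y ⟨e, he, hxy⟩
    have := h e he
    rwa [hxy] at this

theorem connectivity_ends {F : Set E} {e : E} (he : e ∈ F) :
    I.connectivity F (I.ends e).1 (I.ends e).2 :=
  (I.connectivity_le).1 le_rfl e he

theorem connectivity_mono {F F' : Set E} (h : F ⊆ F') : I.connectivity F ≤ I.connectivity F' :=
  (I.connectivity_le).2 fun _ he => I.connectivity_ends (h he)

theorem contractSetoid_le {𝒮 : Set (Finset V)} {R : Setoid V} :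
    contractSetoid 𝒮 ≤ R ↔ ∀ S ∈ 𝒮, ∀ u ∈ S, ∀ v ∈ S, R u v := by
  constructor
  · intro h S hS u hu v hv
    exact h (Relation.EqvGen.rel _ _ ⟨S, hS, hu, hv⟩)
  · intro h
    refine Setoid.eqvGen_le ?_
    rintro x y ⟨S, hS, hx, hy⟩
    exact h S hS x hx y hy

/-- The computation works throughout with partitions of the original vertex set; this inclusion
carries the resulting connections over to the quotient graph at the very end. -/
theorem contract_connectivity {𝒮 : Set (Finset V)} {F : Set E} :
    contractSetoid 𝒮 ⊔ I.connectivity F ≤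
      ((I.contract 𝒮).connectivity F).comap (Quotient.mk (contractSetoid 𝒮)) := by
  refine sup_le ?_ ((I.connectivity_le).2 fun e he => ?_)
  · intro u v h
    have : (Quotient.mk (contractSetoid 𝒮) u) = Quotient.mk _ v := Quotient.sound h
    change ((I.contract 𝒮).connectivity F) _ _
    rw [this]
  · exact (I.contract 𝒮).connectivity_ends he

variable [Fintype V]

theorem mem_component {F : Set E} {u v : V} : u ∈ I.component F v ↔ I.connectivity F v u := by
  simp only [component, Finset.mem_filter, Finset.mem_univ, true_and]

theorem self_mem_component {F : Set E} {v : V} : v ∈ I.component F v :=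
  I.mem_component.2 (Setoid.refl' _ _)

theorem component_eq {F : Set E} {u v : V} :
    I.component F u = I.component F v ↔ I.connectivity F u v := by
  constructor
  · intro h
    rw [← I.mem_component, h]
    exact I.self_mem_component
  · intro h
    ext w
    rw [mem_component, mem_component]
    exact ⟨fun h' => Setoid.trans' _ (Setoid.symm' _ h) h', fun h' => Setoid.trans' _ h h'⟩

theorem mem_components {F : Set E} {S : Finset V} :
    S ∈ I.components F ↔ ∃ v, I.component F v = S := by
  simp [components]

theorem component_mem {F : Set E} {v : V} : I.component F v ∈ I.components F :=
  I.mem_components.2 ⟨v, rfl⟩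

theorem component_of_mem {F : Set E} {S : Finset V} {v : V} (hS : S ∈ I.components F)
    (hv : v ∈ S) : I.component F v = S := by
  obtain ⟨w, rfl⟩ := I.mem_components.1 hS
  rw [component_eq]
  exact Setoid.symm' _ (I.mem_component.1 hv)

end Connectivity

/-! ### Growth rates in terms of active vertices. -/

section Rates

variable {V E D : Type*} [Fintype V] (I : SteinerForest V E D)

/-- The connectivity relation of the current tight edges. -/
def joined (s : State V) : Setoid V := I.connectivity (I.tight s.dual)

/-- The vertex lies in an active component. -/
def Awake (s : State V) (v : V) : Prop := I.component (I.tight s.dual) v ∈ I.active s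

open Classical in
/-- The number of classes of `R` that contain a vertex with property `a` and are cut by `e`. -/
noncomputable def edgeRate (R : Setoid V) (a : V → Prop) (e : E) : ℕ :=
  if R (I.ends e).1 (I.ends e).2 then 0 else
    (if ∃ w, a w ∧ R w (I.ends e).1 then 1 else 0) + (if ∃ w, a w ∧ R w (I.ends e).2 then 1 else 0)

theorem awake_congr {s : State V} {u v : V} (h : I.joined s u v) : I.Awake s u ↔ I.Awake s v := by
  rw [Awake, Awake, (I.component_eq).2 h]

theorem exists_awake_iff {s : State V} {v : V} :
    (∃ w, I.Awake s w ∧ I.joined s w v) ↔ I.Awake s v :=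
  ⟨fun ⟨_, hw, h⟩ => (I.awake_congr h).1 hw, fun h => ⟨v, h, Setoid.refl' _ _⟩⟩

/-- The components cut by an edge with unjoined ends are those of its two ends, and these are
distinct. The right-hand side makes sense for any coarser partition with the same active vertices,
which allows the two processes to be compared. -/
theorem rate_eq (s : State V) (e : E) : I.rate s e = I.edgeRate (I.joined s) (I.Awake s) e := by
  classical
  set F := I.tight s.dual with hF
  have hact : ∀ S ∈ I.active s, S ∈ I.components F := fun S hS => (Finset.mem_filter.1 hS).1
  rw [edgeRate]
  simp only [exists_awake_iff]
  split_ifs with h h1 h2 h2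
  · rw [rate, Finset.card_eq_zero, Finset.filter_eq_empty_iff]
    intro S hS hc
    have := hact S hS
    rcases hc with ⟨h1, h2⟩ | ⟨h1, h2⟩
    · rw [← I.component_of_mem this h1] at h2
      exact h2 (I.mem_component.2 h)
    · rw [← I.component_of_mem this h1] at h2
      exact h2 (I.mem_component.2 (Setoid.symm' _ h))
  all_goals
    have hcut : ∀ S ∈ I.active s, (I.Cuts S e ↔
        S = I.component F (I.ends e).1 ∨ S = I.component F (I.ends e).2) := by
      intro S hS
      constructor
      · rintro (h | h)
        · exact Or.inl (I.component_of_mem (hact S hS) h.1).symm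
        · exact Or.inr (I.component_of_mem (hact S hS) h.1).symm
      · rintro (rfl | rfl)
        · exact Or.inl ⟨I.self_mem_component, fun h' => h (I.mem_component.1 h')⟩
        · exact Or.inr ⟨I.self_mem_component,
            fun h' => h (Setoid.symm' _ (I.mem_component.1 h'))⟩
    have hne : I.component F (I.ends e).1 ≠ I.component F (I.ends e).2 :=
      fun h' => h ((I.component_eq).1 h')
    rw [rate, Finset.filter_congr hcut, Finset.filter_or, Finset.card_union_of_disjoint]
    · rw [Finset.filter_eq', Finset.filter_eq']
      simp only [Awake, ← hF] at h1 h2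
      simp [h1, h2]
    · rw [Finset.disjoint_filter]
      rintro S - rfl
      exact hne

theorem load_grow (ε : ℝ) (s : State V) (δ : ℝ) (e : E) :
    I.load (I.grow ε s δ).dual e = I.load s.dual e + δ * I.rate s e := by
  classical
  have : ∀ S, (I.grow ε s δ).dual S = s.dual S + if S ∈ I.active s then δ else 0 := by
    intro S
    simp only [grow]
    split_ifs <;> simp
  simp only [load, this, Finset.sum_add_distrib]
  congr 1
  rw [← Finset.sum_filter, Finset.sum_const, nsmul_eq_mul, mul_comm, rate]
  congr 3
  ext S
  simp only [Finset.mem_filter, Finset.mem_univ, true_and]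
  tauto

theorem rate_eq_zero_of_joined {s : State V} {e : E}
    (h : I.joined s (I.ends e).1 (I.ends e).2) : I.rate s e = 0 := by
  rw [rate_eq, edgeRate, if_pos h]

theorem sum_dual_grow (ε : ℝ) (s : State V) (δ : ℝ) :
    ∑ S, (I.grow ε s δ).dual S = ∑ S, s.dual S + δ * (I.active s).card := by
  classical
  have : ∀ S, (I.grow ε s δ).dual S = s.dual S + if S ∈ I.active s then δ else 0 := by
    intro S
    simp only [grow]
    split_ifs <;> simp
  simp only [this, Finset.sum_add_distrib]
  congr 1
  rw [← Finset.sum_filter, Finset.sum_const, nsmul_eq_mul, mul_comm]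
  simp

theorem not_demandActive_iff {S : Finset V} :
    ¬ I.DemandActive S ↔ ∀ d, ((I.demand d).1 ∈ S ↔ (I.demand d).2 ∈ S) := by
  simp only [DemandActive, Separates, Xor, not_exists]
  refine forall_congr' fun d => ?_
  tauto

theorem mem_active {s : State V} {S : Finset V} :
    S ∈ I.active s ↔ S ∈ I.components (I.tight s.dual) ∧ (I.DemandActive S ∨ 0 < s.budget S) := by
  classical
  rw [active, Finset.mem_filter, currentComponents, BudgetActive]
  tauto

end Rates

/-! ### A single event of the extended algorithm. -/

section Run

variable {V E D : Type*} [Fintype V] [Fintype E] (I : SteinerForest V E D) (ε : ℝ)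

theorem step_of_halted {s : State V} (h : I.Halted s) : I.step ε s = s := by
  rw [step, dif_neg]
  rw [Finset.not_nonempty_iff_eq_empty]
  exact h

theorem eventDelays_nonempty {s : State V} (h : ¬ I.Halted s) : (I.eventDelays s).Nonempty :=
  Finset.nonempty_iff_ne_empty.2 h

theorem mem_eventDelays {s : State V} {x : ℝ} : x ∈ I.eventDelays s ↔
    (∃ e, I.rate s e ≠ 0 ∧ (I.cost e - I.load s.dual e) / (I.rate s e : ℝ) = x) ∨
    (∃ S ∈ I.active s, ¬ I.DemandActive S ∧ s.budget S = x) := by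
  rw [eventDelays, Finset.mem_union, Finset.mem_image, Finset.mem_image]
  simp only [Finset.mem_filter, Finset.mem_univ, true_and]
  simp only [BudgetActive, mem_active]
  constructor
  · rintro (h | ⟨S, ⟨h1, h2⟩, h3⟩)
    · exact Or.inl h
    · exact Or.inr ⟨S, h1, h2.1, h3⟩
  · rintro (h | ⟨S, h1, h2, h3⟩)
    · exact Or.inl h
    · exact Or.inr ⟨S, ⟨h1, h2, h1.2.resolve_left h2⟩, h3⟩

/-- No edge is overloaded. -/
def Feasible (s : State V) : Prop := ∀ e, I.load s.dual e ≤ I.cost e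

variable {I}

theorem Feasible.lt_cost {s : State V} (hs : I.Feasible s) {e : E}
    (h : ¬ I.joined s (I.ends e).1 (I.ends e).2) : I.load s.dual e < I.cost e := by
  refine lt_of_le_of_ne (hs e) fun h' => h ?_
  exact I.connectivity_ends h'

/-- An edge whose load grows has unjoined ends, so it is not tight and has positive slack; a budget
counted among the delays is positive by activity. -/
theorem Feasible.delay_pos {s : State V} (hs : I.Feasible s) {x : ℝ} (hx : x ∈ I.eventDelays s) :
    0 < x := by
  rcases I.mem_eventDelays.1 hx with ⟨e, he, rfl⟩ | ⟨S, hS, hd, rfl⟩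
  · have h1 : I.load s.dual e < I.cost e :=
      hs.lt_cost fun h => he (I.rate_eq_zero_of_joined h)
    have h2 : (0 : ℝ) < I.rate s e := by exact_mod_cast Nat.pos_of_ne_zero he
    exact div_pos (by linarith) h2
  · exact (I.mem_active.1 hS).2.resolve_left hd

theorem initial_feasible : I.Feasible (initial V) := by
  intro e
  simp [load, initial, I.cost_nonneg e]

variable (I)

/-- The duration between the event that leads to `s` and the next event, `0` if there is none. -/
noncomputable def delay (s : State V) : ℝ :=
  if h : (I.eventDelays s).Nonempty then (I.eventDelays s).min' h else 0

variable {I} {ε}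

theorem step_time (s : State V) : (I.step ε s).time = s.time + I.delay s := by
  rw [step, delay]
  split_ifs with h
  · rfl
  · simp

theorem step_sum_dual (s : State V) :
    ∑ S, (I.step ε s).dual S = ∑ S, s.dual S + I.delay s * (I.active s).card := by
  rw [step, delay]
  split_ifs with h
  · exact I.sum_dual_grow ε s _
  · simp

theorem step_load (s : State V) (e : E) :
    I.load (I.step ε s).dual e = I.load s.dual e + I.delay s * I.rate s e := by
  rw [step, delay]
  split_ifs with h
  · exact I.load_grow ε s _ e
  · simp

open Classical in
theorem step_budget {s : State V} (h : ¬ I.Halted s) (S : Finset V) :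
    (I.step ε s).budget S = ∑ S' ∈ (I.currentComponents s).filter (fun S' => S' ⊆ S),
      (I.grow ε s (I.delay s)).budget S' := by
  have hn := I.eventDelays_nonempty h
  simp only [step, dif_pos hn, delay]

theorem delay_nonneg {s : State V} (hs : I.Feasible s) : 0 ≤ I.delay s := by
  rw [delay]
  split_ifs with h
  · exact (hs.delay_pos (Finset.min'_mem _ h)).le
  · exact le_rfl

theorem delay_mem {s : State V} (h : ¬ I.Halted s) : I.delay s ∈ I.eventDelays s := by
  rw [delay, dif_pos (I.eventDelays_nonempty h)]
  exact Finset.min'_mem _ _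

theorem delay_le {s : State V} {x : ℝ} (hx : x ∈ I.eventDelays s) : I.delay s ≤ x := by
  rw [delay, dif_pos ⟨x, hx⟩]
  exact Finset.min'_le _ _ hx

/-- The delay is the minimum of all times to tightness, so no edge overshoots its cost. -/
theorem Feasible.step {s : State V} (hs : I.Feasible s) : I.Feasible (I.step ε s) := by
  intro e
  rw [step_load]
  by_cases he : I.rate s e = 0
  · simpa [he] using hs e
  · have := delay_le (I.mem_eventDelays.2 (Or.inl ⟨e, he, rfl⟩))
    have h2 : (0 : ℝ) < I.rate s e := by exact_mod_cast Nat.pos_of_ne_zero he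
    rw [le_div_iff₀ h2] at this
    linarith

/-- Both ends of a tight edge lie in one component, so its load is frozen and it stays tight. -/
theorem joined_step (s : State V) : I.joined s ≤ I.joined (I.step ε s) := by
  refine I.connectivity_mono fun e he => ?_
  have : I.rate s e = 0 := I.rate_eq_zero_of_joined (I.connectivity_ends he)
  change I.load _ e = _
  rw [step_load, this]
  simpa using show I.load s.dual e = I.cost e from he

end Run

end SteinerForest

namespace SteinerForest

/-! ### The run halts after at most `2|V|` events. -/

section Halting

variable {V E D : Type*} [Fintype V] [Fintype E] {I : SteinerForest V E D} {ε : ℝ}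

theorem component_subset_step {s : State V} {v : V} :
    I.component (I.tight s.dual) v ⊆ I.component (I.tight (I.step ε s).dual) v := by
  intro w hw
  exact I.mem_component.2 (I.joined_step s (I.mem_component.1 hw))

theorem component_subset_of_mem {s : State V} {S : Finset V}
    (hS : S ∈ I.components (I.tight (I.step ε s).dual)) {v : V} (hv : v ∈ S) :
    I.component (I.tight s.dual) v ⊆ S := by
  rw [← I.component_of_mem hS hv]
  exact component_subset_step

theorem demandActive_component {s : State V} {S : Finset V} {d : D}
    (hS : S ∈ I.components (I.tight (I.step ε s).dual)) (h : I.Separates S d) :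
    ∃ v ∈ S, I.DemandActive (I.component (I.tight s.dual) v) := by
  rcases h with ⟨h1, h2⟩ | ⟨h1, h2⟩
  · exact ⟨_, h1, d, Or.inl ⟨I.self_mem_component, fun h => h2 (component_subset_of_mem hS h1 h)⟩⟩
  · exact ⟨_, h1, d, Or.inr ⟨I.self_mem_component, fun h => h2 (component_subset_of_mem hS h1 h)⟩⟩

/-- An active component after an event contains a component that was active before. -/
theorem exists_awake_of_active_step {s : State V} {S : Finset V} (h : S ∈ I.active (I.step ε s)) :
    ∃ v ∈ S, I.Awake s v := by
  classical
  by_cases hh : I.Halted s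
  · rw [I.step_of_halted ε hh] at h
    obtain ⟨v, rfl⟩ := I.mem_components.1 (I.mem_active.1 h).1
    exact ⟨v, I.self_mem_component, h⟩
  obtain ⟨hS, ⟨d, hd⟩ | hb⟩ := I.mem_active.1 h
  · obtain ⟨v, hv, hv'⟩ := demandActive_component hS hd
    exact ⟨v, hv, I.mem_active.2 ⟨I.component_mem, Or.inl hv'⟩⟩
  · rw [step_budget hh] at hb
    -- If no component inside `S` was active, the merged budget is a sum of unchanged nonpositive
    -- budgets and could not be positive.
    by_contra! hc
    refine hb.not_ge (Finset.sum_nonpos fun S' hS' => ?_)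
    rw [Finset.mem_filter] at hS'
    obtain ⟨v, rfl⟩ := I.mem_components.1 hS'.1
    have := hc v (hS'.2 I.self_mem_component)
    rw [Awake] at this
    simp only [grow, if_neg this]
    rw [mem_active] at this
    push Not at this
    exact (this I.component_mem).2

/-- Number of components plus number of active components; it drops with every event. -/
noncomputable def potential (I : SteinerForest V E D) (s : State V) : ℕ :=
  (I.currentComponents s).card + (I.active s).card

/-- Every new active component meets an old active one. An old component lies inside a single new
one, so this choice is injective. -/
theorem card_active_step (s : State V) : (I.active (I.step ε s)).card ≤ (I.active s).card := by
  classical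
  have key : ∀ S ∈ I.active (I.step ε s), ∃ T ∈ I.active s, ∃ v ∈ T, v ∈ S := by
    intro S hS
    obtain ⟨v, hv, hv'⟩ := exists_awake_of_active_step hS
    exact ⟨_, hv', v, I.self_mem_component, hv⟩
  choose! f hf hf' using key
  refine Finset.card_le_card_of_injOn f hf ?_
  intro S hS T hT hST
  obtain ⟨v, hv, hvS⟩ := hf' S hS
  obtain ⟨w, hw, hwT⟩ := hf' T hT
  rw [← I.component_of_mem (I.mem_active.1 hS).1 hvS,
    ← I.component_of_mem (I.mem_active.1 hT).1 hwT, component_eq]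
  rw [← hST] at hw
  refine I.joined_step s ((I.component_eq).1 ?_)
  rw [I.component_of_mem (I.mem_active.1 (hf S hS)).1 hv,
    I.component_of_mem (I.mem_active.1 (hf S hS)).1 hw]

theorem card_components_step (s : State V) :
    (I.currentComponents (I.step ε s)).card ≤ (I.currentComponents s).card := by
  classical
  refine Finset.card_le_card_of_surjOn
    -- Send an old component to the new one containing it. The chosen vertex does not matter, and
    -- the `else` value is a dummy since components are nonempty.
    (fun S => if h : S.Nonempty then I.component (I.tight (I.step ε s).dual) h.choose else S) ?_
  intro S hS
  obtain ⟨v, rfl⟩ := I.mem_components.1 hS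
  have hn : (I.component (I.tight s.dual) v).Nonempty := ⟨v, I.self_mem_component⟩
  refine ⟨I.component (I.tight s.dual) v, I.component_mem, ?_⟩
  simp only [dif_pos hn]
  rw [component_eq]
  exact Setoid.symm' _ (I.joined_step s (I.mem_component.1 hn.choose_spec))

/-- The map from old components onto the new ones containing them is surjective; if the count does
not drop it is injective, so nothing has merged. -/
theorem joined_step_eq_of_card {s : State V}
    (h : (I.currentComponents s).card ≤ (I.currentComponents (I.step ε s)).card) :
    I.joined (I.step ε s) = I.joined s := by
  classical
  refine le_antisymm (fun u v huv => ?_) (I.joined_step s)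
  set f : Finset V → Finset V :=
    fun S => if h : S.Nonempty then I.component (I.tight (I.step ε s).dual) h.choose else S with hf
  have hval : ∀ w, f (I.component (I.tight s.dual) w) =
      I.component (I.tight (I.step ε s).dual) w := by
    intro w
    have hn : (I.component (I.tight s.dual) w).Nonempty := ⟨w, I.self_mem_component⟩
    simp only [hf, dif_pos hn]
    rw [component_eq]
    exact Setoid.symm' _ (I.joined_step s (I.mem_component.1 hn.choose_spec))
  have hinj := Finset.injOn_of_surjOn_of_card_le (s := I.currentComponents s)
    (t := I.currentComponents (I.step ε s)) f (by
      intro S hS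
      obtain ⟨w, rfl⟩ := I.mem_components.1 hS
      rw [hval]
      exact I.component_mem) (by
      intro S hS
      obtain ⟨w, rfl⟩ := I.mem_components.1 hS
      exact ⟨_, I.component_mem, hval w⟩) h
  rw [← Setoid.comm'] at huv
  have := hinj (I.component_mem (v := u)) (I.component_mem (v := v)) (by
    rw [hval, hval, component_eq]; exact Setoid.symm' _ huv)
  exact (I.component_eq).1 this

/-- Neither summand can increase. If the number of components does not drop, the partition is
unchanged, so the event cannot be an edge between two components becoming tight. It is then the
exhaustion of a budget, and that component ceases to be active. -/
theorem potential_step {s : State V} (h : ¬ I.Halted s) :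
    I.potential (I.step ε s) < I.potential s := by
  classical
  have h1 := card_active_step (I := I) (ε := ε) s
  have h2 := card_components_step (I := I) (ε := ε) s
  by_contra hc
  have h3 : (I.currentComponents s).card ≤ (I.currentComponents (I.step ε s)).card := by
    simp only [potential] at hc; omega
  have h4 : (I.active s).card ≤ (I.active (I.step ε s)).card := by
    simp only [potential] at hc; omega
  have hj := joined_step_eq_of_card h3
  rcases I.mem_eventDelays.1 (delay_mem h) with ⟨e, he, hd⟩ | ⟨S, hS, hd, hb⟩
  · have hn : ¬ I.joined s (I.ends e).1 (I.ends e).2 :=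
      fun h => he (I.rate_eq_zero_of_joined h)
    rw [← hj] at hn
    refine hn (I.connectivity_ends ?_)
    change I.load _ e = _
    rw [step_load, ← hd]
    have : (I.rate s e : ℝ) ≠ 0 := by exact_mod_cast he
    field_simp
    ring
  · have hcomp : ∀ v, I.component (I.tight (I.step ε s).dual) v = I.component (I.tight s.dual) v := by
      intro v
      ext w
      rw [mem_component, mem_component]
      change I.joined _ v w ↔ I.joined _ v w
      rw [hj]
    have hsub : I.active (I.step ε s) ⊆ (I.active s).erase S := by
      intro T hT
      obtain ⟨v, hv, hv'⟩ := exists_awake_of_active_step hT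
      rw [Awake, ← hcomp, I.component_of_mem (I.mem_active.1 hT).1 hv] at hv'
      refine Finset.mem_erase.2 ⟨?_, hv'⟩
      rintro rfl
      have hb' := (I.mem_active.1 hT).2.resolve_left hd
      rw [step_budget h] at hb'
      refine hb'.ne' ?_
      -- Nothing has merged, so the new budget of `T` has the single summand coming from `T`, and
      -- that is the old budget minus itself.
      have : (I.currentComponents s).filter (fun S' => S' ⊆ T) = {T} := by
        ext T'
        simp only [Finset.mem_filter, Finset.mem_singleton]
        constructor
        · rintro ⟨h1, h2⟩
          obtain ⟨w, rfl⟩ := I.mem_components.1 h1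
          exact I.component_of_mem (I.mem_active.1 hv').1 (h2 I.self_mem_component)
        · rintro rfl
          exact ⟨(I.mem_active.1 hv').1, subset_rfl⟩
      rw [this, Finset.sum_singleton]
      simp only [grow, if_pos hv', if_neg hd, hb, sub_self]
    have := Finset.card_le_card hsub
    have hpos : 0 < (I.active s).card := Finset.card_pos.2 ⟨S, hS⟩
    rw [Finset.card_erase_of_mem hS] at this
    omega

theorem run_succ (k : ℕ) : I.run ε (k + 1) = I.step ε (I.run ε k) := by
  rw [run, Function.iterate_succ_apply', ← run]

theorem run_feasible (k : ℕ) : I.Feasible (I.run ε k) := by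
  induction k with
  | zero => exact initial_feasible
  | succ k ih => rw [run_succ]; exact ih.step

theorem run_halted_succ {k : ℕ} (h : I.Halted (I.run ε k)) : I.run ε (k + 1) = I.run ε k := by
  rw [run_succ, I.step_of_halted ε h]

theorem run_of_halted_le {k l : ℕ} (h : I.Halted (I.run ε k)) (hkl : k ≤ l) :
    I.run ε l = I.run ε k := by
  induction l, hkl using Nat.le_induction with
  | base => rfl
  | succ l _ ih => rw [run_halted_succ, ih]; rwa [ih]

theorem card_components_le (F : Set E) : (I.components F).card ≤ Fintype.card V := by
  classical
  exact Finset.card_image_le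

/-- There are at most `|V|` components and at most as many active ones, so the potential starts at
`2|V|` or less and bounds the number of events. -/
theorem halted_run : I.Halted (I.run ε (2 * Fintype.card V)) := by
  classical
  have key : ∀ k, I.Halted (I.run ε k) ∨ I.potential (I.run ε k) + k ≤ 2 * Fintype.card V := by
    intro k
    induction k with
    | zero =>
      right
      have h1 : (I.currentComponents (I.run ε 0)).card ≤ Fintype.card V :=
        card_components_le (I := I) _
      have h2 : (I.active (I.run ε 0)).card ≤ (I.currentComponents (I.run ε 0)).card :=
        Finset.card_filter_le _ _
      simp only [potential]
      omega
    | succ k ih =>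
      by_cases h : I.Halted (I.run ε k)
      · left; rwa [run_halted_succ h]
      · right
        have := ih.resolve_left h
        have h2 := potential_step (ε := ε) h
        rw [run_succ]
        omega
  rcases key (2 * Fintype.card V) with h | h
  · exact h
  · by_contra hc
    have := potential_step (ε := ε) hc
    omega

/-- An active component cut by some edge would cause an event, as would a budget-active one. A
demand-active component that no edge leaves separates a demand pair in the whole graph, which is
impossible if a solution exists. -/
theorem active_of_halted {s : State V} (h : I.Halted s) (hsol : ∃ F, I.IsSolution F) :
    I.active s = ∅ := by
  classical
  rw [Finset.eq_empty_iff_forall_notMem]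
  intro S hS
  by_cases hd : I.DemandActive S
  · obtain ⟨F, hF⟩ := hsol
    have hno : ∀ e, ¬ I.Cuts S e := by
      intro e he
      have : I.rate s e ≠ 0 := by
        rw [rate, Finset.card_ne_zero]
        exact ⟨S, Finset.mem_filter.2 ⟨hS, he⟩⟩
      have := I.mem_eventDelays.2 (Or.inl ⟨e, this, rfl⟩)
      rw [h] at this
      exact Finset.notMem_empty _ this
    obtain ⟨d, hd⟩ := hd
    have hle : I.connectivity (F : Set E) ≤ Setoid.ker (fun v => v ∈ S) := by
      rw [connectivity_le]
      intro e _
      have := hno e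
      rw [Setoid.ker_def, eq_iff_iff]
      simp only [Cuts, Xor] at this
      tauto
    have := hle (hF d)
    rw [Setoid.ker_def, eq_iff_iff] at this
    simp only [Separates, Xor] at hd
    tauto
  · have := I.mem_eventDelays.2 (Or.inr ⟨S, hS, hd, rfl⟩)
    rw [h] at this
    exact Finset.notMem_empty _ this

theorem joined_demand_of_halted {s : State V} (h : I.Halted s) (hsol : ∃ F, I.IsSolution F)
    (d : D) : I.joined s (I.demand d).1 (I.demand d).2 := by
  have h1 : I.component (I.tight s.dual) (I.demand d).1 ∉ I.active s := by
    rw [active_of_halted h hsol]; exact Finset.notMem_empty _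
  rw [mem_active] at h1
  push Not at h1
  have := (I.not_demandActive_iff.1 (h1 I.component_mem).1 d).1 I.self_mem_component
  exact I.mem_component.1 this

end Halting

/-! ### The dual total and the gain as sums over events. -/

section Totals

variable {V E D : Type*} [Fintype V] [Fintype E] {I : SteinerForest V E D} {ε : ℝ}

theorem run_time_mono : Monotone fun k => (I.run ε k).time := by
  refine monotone_nat_of_le_succ fun k => ?_
  rw [run_succ, step_time]
  linarith [delay_nonneg (run_feasible (I := I) (ε := ε) k)]

theorem run_sum_dual (k : ℕ) :
    ∑ S, (I.run ε k).dual S =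
      ∑ j ∈ Finset.range k, I.delay (I.run ε j) * (I.active (I.run ε j)).card := by
  induction k with
  | zero => simp [run, initial]
  | succ k ih => rw [Finset.sum_range_succ, ← ih, run_succ, step_sum_dual]

/-- The state is constant from the first halted index on, so any halted `K` may replace the least
one; total dual growth during an interval is its length times the number of active components. -/
theorem dualTotal_eq {K : ℕ} (hK : I.Halted (I.run ε K)) :
    I.dualTotal ε =
      ∑ j ∈ Finset.range K, I.delay (I.run ε j) * (I.active (I.run ε j)).card := by
  classical
  have h0 : I.Halted (I.run ε (sInf {k | I.Halted (I.run ε k)})) :=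
    Nat.sInf_mem (s := {k | I.Halted (I.run ε k)}) ⟨K, hK⟩
  have h1 : sInf {k | I.Halted (I.run ε k)} ≤ K := Nat.sInf_le hK
  rw [← run_sum_dual, run_of_halted_le h0 h1, dualTotal, Finset.sum_filter_ne_zero]
  rfl

/-- Smaller indices are excluded because times are monotone and because after halting time stands
still, which would contradict that it passes `t` between `j` and `j + 1`. -/
theorem eventIndex_eq {j : ℕ} {t : ℝ} (h1 : (I.run ε j).time ≤ t)
    (h2 : t < (I.run ε (j + 1)).time) : I.eventIndex ε t = j := by
  refine le_antisymm (Nat.sInf_le (Or.inl h2)) ?_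
  refine le_csInf ⟨j, Or.inl h2⟩ ?_
  intro k hk
  by_contra hlt
  push Not at hlt
  rcases hk with hk | hk
  · exact absurd (hk.trans_le ((run_time_mono (I := I) (ε := ε) hlt).trans h1)) (lt_irrefl _)
  · have a := run_of_halted_le hk hlt.le
    have b := run_of_halted_le hk (hlt.le.trans (Nat.le_succ j))
    rw [b] at h2
    rw [a] at h1
    linarith

theorem activeAt_eq_empty {K : ℕ} (hK : I.Halted (I.run ε K)) (hsol : ∃ F, I.IsSolution F)
    {t : ℝ} (ht : (I.run ε K).time ≤ t) : I.activeAt ε t = ∅ := by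
  have hmem : I.eventIndex ε t ∈ {k | t < (I.run ε (k + 1)).time ∨ I.Halted (I.run ε k)} :=
    Nat.sInf_mem ⟨K, Or.inr hK⟩
  refine active_of_halted ?_ hsol
  rcases hmem with h | h
  · exfalso
    rcases le_total (I.eventIndex ε t + 1) K with hle | hle
    · exact absurd (h.trans_le ((run_time_mono (I := I) (ε := ε) hle).trans ht)) (lt_irrefl _)
    · rw [run_of_halted_le hK hle] at h
      linarith
  · exact h

theorem exists_index {K : ℕ} {t : ℝ} (h0 : 0 ≤ t) (ht : t < (I.run ε K).time) :
    ∃ j < K, (I.run ε j).time ≤ t ∧ t < (I.run ε (j + 1)).time := by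
  induction K with
  | zero => exact absurd (h0.trans_lt ht) (by simp [run, initial])
  | succ K ih =>
    rcases lt_or_ge t (I.run ε K).time with h | h
    · obtain ⟨j, hj, hj'⟩ := ih h
      exact ⟨j, by omega, hj'⟩
    · exact ⟨K, by omega, h, ht⟩

/-- The integrand is constant between consecutive events and vanishes after the last one, where no
component is active. Including `0` in the domain fits the half-open intervals and changes only a
null set. -/
theorem gain_eq {K : ℕ} (hK : I.Halted (I.run ε K)) (hsol : ∃ F, I.IsSolution F)
    (𝒮 : Set (Finset V)) :
    I.gain ε 𝒮 = 2 * ∑ j ∈ Finset.range K, I.delay (I.run ε j) *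
      (((I.active (I.run ε j)).card : ℝ) - (mergeFamily (I.active (I.run ε j)) 𝒮).card) := by
  classical
  set g : ℕ → ℝ := fun j =>
    ((I.active (I.run ε j)).card : ℝ) - (mergeFamily (I.active (I.run ε j)) 𝒮).card with hg
  rw [gain, ← integral_Ici_eq_integral_Ioi]
  congr 1
  have key : ∀ t ∈ Set.Ici (0 : ℝ),
      ((I.activeAt ε t).card : ℝ) - ((mergeFamily (I.activeAt ε t) 𝒮).card : ℝ) =
      ∑ j ∈ Finset.range K,
        (Set.Ico (I.run ε j).time (I.run ε (j + 1)).time).indicator (fun _ => g j) t := by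
    intro t ht
    rcases lt_or_ge t (I.run ε K).time with h | h
    · obtain ⟨j, hj, h1, h2⟩ := exists_index ht h
      rw [Finset.sum_eq_single_of_mem j (Finset.mem_range.2 hj),
        Set.indicator_of_mem (show t ∈ Set.Ico _ _ from ⟨h1, h2⟩)]
      · rw [activeAt, eventIndex_eq h1 h2]
      · intro i _ hij
        refine Set.indicator_of_notMem ?_ _
        rintro ⟨h3, h4⟩
        exact hij ((eventIndex_eq h3 h4).symm.trans (eventIndex_eq h1 h2))
    · rw [activeAt_eq_empty hK hsol h, Finset.sum_eq_zero]
      · simp [mergeFamily]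
      · intro i hi
        refine Set.indicator_of_notMem ?_ _
        rintro ⟨_, h4⟩
        have := run_time_mono (I := I) (ε := ε) (Nat.succ_le_of_lt (Finset.mem_range.1 hi))
        exact absurd (h4.trans_le (this.trans h)) (lt_irrefl _)
  rw [setIntegral_congr_fun measurableSet_Ici key, integral_finsetSum]
  · refine Finset.sum_congr rfl fun j _ => ?_
    rw [setIntegral_indicator measurableSet_Ico, Set.inter_eq_right.2, setIntegral_const,
      Measure.real, Real.volume_Ico, ENNReal.toReal_ofReal, run_succ, step_time]
    · simp [hg]
    · rw [run_succ, step_time]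
      linarith [delay_nonneg (run_feasible (I := I) (ε := ε) j)]
    · intro t ht
      have : (0 : ℝ) ≤ (I.run ε j).time := run_time_mono (I := I) (ε := ε) (Nat.zero_le j)
      exact this.trans ht.1
  · intro j _
    refine Integrable.restrict ?_
    rw [integrable_indicator_iff measurableSet_Ico]
    exact integrableOn_const (by simp)

/-- The target cost bound is thereby twice the integral of `|𝒜ᵗ/𝒮|`, the quantity against which the
second process is charged. -/
theorem dualTotal_sub_gain {K : ℕ} (hK : I.Halted (I.run ε K)) (hsol : ∃ F, I.IsSolution F)
    (𝒮 : Set (Finset V)) :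
    2 * I.dualTotal ε - I.gain ε 𝒮 = 2 * ∑ j ∈ Finset.range K,
      I.delay (I.run ε j) * (mergeFamily (I.active (I.run ε j)) 𝒮).card := by
  rw [dualTotal_eq hK, gain_eq hK hsol, ← mul_sub, ← Finset.sum_sub_distrib]
  congr 1
  refine Finset.sum_congr rfl fun j _ => ?_
  ring

/-- Vertex weights that represent the budgets of the grown components also represent the budgets
after the components have merged. -/
theorem step_budget_eq_sum {s : State V} (h : ¬ I.Halted s) {p : V → ℝ}
    (hp : ∀ v, ∑ w ∈ I.component (I.tight s.dual) v, p w =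
      (I.grow ε s (I.delay s)).budget (I.component (I.tight s.dual) v)) (v : V) :
    ∑ w ∈ I.component (I.tight (I.step ε s).dual) v, p w =
      (I.step ε s).budget (I.component (I.tight (I.step ε s).dual) v) := by
  classical
  set T := I.component (I.tight (I.step ε s).dual) v with hT
  have hTm : T ∈ I.components (I.tight (I.step ε s).dual) := I.component_mem
  rw [step_budget h]
  -- A new component is the disjoint union of the old ones it contains, so the sum of weights splits
  -- in the same way as the merged budget.
  have hU : T = ((I.currentComponents s).filter (fun S' => S' ⊆ T)).biUnion id := by
    ext w
    simp only [Finset.mem_biUnion, Finset.mem_filter, id]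
    constructor
    · intro hw
      exact ⟨_, ⟨I.component_mem, component_subset_of_mem hTm hw⟩, I.self_mem_component⟩
    · rintro ⟨S, hS, hw⟩
      exact hS.2 hw
  conv_lhs => rw [hU]
  rw [Finset.sum_biUnion]
  · refine Finset.sum_congr ?_ fun S hS => ?_
    · congr
    · obtain ⟨w, rfl⟩ := I.mem_components.1 (Finset.mem_filter.1 hS).1
      exact hp w
  · intro S hS S' hS' hne
    rw [Function.onFun, Finset.disjoint_left]
    intro w hw hw'
    have a := I.component_of_mem (Finset.mem_filter.1 hS).1 hw
    have b := I.component_of_mem (Finset.mem_filter.1 hS').1 hw'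
    exact hne (a.symm.trans b)

end Totals

end SteinerForest

namespace SteinerForest

/-! ### Counting active classes and degrees in a forest of classes. -/

section Moats

variable {V E D : Type*} [Fintype V] (I : SteinerForest V E D)

open Classical in
/-- The number of classes of `R` that contain a vertex with property `a`. -/
noncomputable def classCount (R : Setoid V) (a : V → Prop) : ℕ :=
  ((Finset.univ.filter a).image (Quotient.mk R)).card

/-- Since `R` identifies both the vertices of one component and those of one contracted set, each
merged active set lies inside a single class. Choosing for every active class a merged set inside it
is therefore injective. -/
theorem classCount_le_mergeFamily {s : State V} {𝒮 : Set (Finset V)} {R : Setoid V}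
    (h1 : I.joined s ≤ R) (h2 : contractSetoid 𝒮 ≤ R) :
    classCount R (I.Awake s) ≤ (mergeFamily (I.active s) 𝒮).card := by
  classical
  rw [contractSetoid_le] at h2
  have key : ∀ q ∈ (Finset.univ.filter (I.Awake s)).image (Quotient.mk R),
      ∃ M ∈ mergeFamily (I.active s) 𝒮, (∃ w ∈ M, Quotient.mk R w = q) ∧
        ∀ w ∈ M, Quotient.mk R w = q := by
    intro q hq
    obtain ⟨w, hw, rfl⟩ := Finset.mem_image.1 hq
    have hw' : I.Awake s w := (Finset.mem_filter.1 hw).2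
    refine ⟨_, Finset.mem_image.2 ⟨_, hw', rfl⟩, ⟨w, ?_, rfl⟩, ?_⟩
    · simp only [Finset.mem_biUnion, Finset.mem_filter, id]
      exact ⟨_, ⟨hw', Relation.EqvGen.refl _⟩, I.self_mem_component⟩
    · intro x hx
      simp only [Finset.mem_biUnion, Finset.mem_filter, id] at hx
      obtain ⟨Y, ⟨hY, hr⟩, hxY⟩ := hx
      -- The `R`-saturation of an active component is one class, and it is the same for two
      -- components that meet a common set; so it is invariant under the generated equivalence.
      set κ : Finset V → Set V := fun X => {v | ∃ x ∈ X, R x v} with hκ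
      have hcl : ∀ X ∈ I.active s, ∀ x ∈ X, κ X = {v | R x v} := by
        intro X hX x hx
        ext v
        constructor
        · rintro ⟨y, hy, hyv⟩
          refine Setoid.trans' _ (h1 ?_) hyv
          rw [← I.component_of_mem (I.mem_active.1 hX).1 hx] at hy
          exact I.mem_component.1 hy
        · intro hv
          exact ⟨x, hx, hv⟩
      have hle := Setoid.eqvGen_le (s := Setoid.ker κ) (r := fun A B => A ∈ I.active s ∧
          B ∈ I.active s ∧ ∃ S ∈ 𝒮, (S ∩ A).Nonempty ∧ (S ∩ B).Nonempty) (by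
        rintro A B ⟨hA, hB, S, hS, ⟨y, hy⟩, ⟨z, hz⟩⟩
        rw [Finset.mem_inter] at hy hz
        have := h2 S hS y hy.1 z hz.1
        rw [Setoid.ker_def, hcl A hA y hy.2, hcl B hB z hz.2]
        ext v
        exact ⟨fun h => Setoid.trans' _ (Setoid.symm' _ this) h, fun h => Setoid.trans' _ this h⟩)
      have hκe : κ _ = κ Y := Setoid.ker_def.1 (hle hr)
      rw [hcl _ hw' w I.self_mem_component] at hκe
      have : x ∈ κ Y := ⟨x, hxY, Setoid.refl' _ _⟩
      rw [← hκe] at this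
      exact Quotient.sound (Setoid.symm' _ this)
  choose! f hf hf' hf'' using key
  refine Finset.card_le_card_of_injOn f hf ?_
  intro q hq q' hq' hqq
  obtain ⟨w, hw, rfl⟩ := hf' q hq
  rw [hqq] at hw
  exact hf'' q' hq' w hw

open Classical in
/-- The classes of `R` that contain endpoints of edges in `X`. -/
noncomputable def nodes (R : Setoid V) (X : Finset E) : Finset (Quotient R) :=
  Finset.univ.filter fun q => ∃ e ∈ X, Quotient.mk R (I.ends e).1 = q ∨ Quotient.mk R (I.ends e).2 = q

theorem mem_nodes {R : Setoid V} {X : Finset E} {q : Quotient R} : q ∈ I.nodes R X ↔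
    ∃ e ∈ X, Quotient.mk R (I.ends e).1 = q ∨ Quotient.mk R (I.ends e).2 = q := by
  classical
  rw [nodes, Finset.mem_filter]
  simp only [Finset.mem_univ, true_and]

theorem card_nodes_mono {R R' : Setoid V} (h : R ≤ R') (X : Finset E) :
    (I.nodes R' X).card ≤ (I.nodes R X).card := by
  classical
  refine Finset.card_le_card_of_surjOn (Quotient.map' id fun _ _ h' => h h') ?_
  intro q hq
  obtain ⟨e, he, rfl | rfl⟩ := I.mem_nodes.1 hq
  · exact ⟨Quotient.mk R (I.ends e).1, I.mem_nodes.2 ⟨e, he, Or.inl rfl⟩, rfl⟩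
  · exact ⟨Quotient.mk R (I.ends e).2, I.mem_nodes.2 ⟨e, he, Or.inr rfl⟩, rfl⟩

open Classical in
-- Contracting `e` identifies its two distinct end classes. The map from old to new nodes therefore
-- stays surjective after the class of the second end is deleted.
theorem card_nodes_insert {R R' : Setoid V} (h : R ≤ R') {e : E}
    (he : ¬ R (I.ends e).1 (I.ends e).2) (he' : R' (I.ends e).1 (I.ends e).2) (X : Finset E) :
    (I.nodes R' X).card + 1 ≤ (I.nodes R (insert e X)).card := by
  set q2 := Quotient.mk R (I.ends e).2 with hq2
  have hmem : q2 ∈ I.nodes R (insert e X) :=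
    I.mem_nodes.2 ⟨e, Finset.mem_insert_self _ _, Or.inr rfl⟩
  have hne : Quotient.mk R (I.ends e).1 ≠ q2 := fun h' => he (Quotient.exact h')
  have : (I.nodes R' X).card ≤ ((I.nodes R (insert e X)).erase q2).card := by
    refine Finset.card_le_card_of_surjOn (Quotient.map' id fun _ _ h' => h h') ?_
    have key : ∀ v, Quotient.mk R v ∈ I.nodes R (insert e X) → Quotient.mk R' v ∈
        (Quotient.map' id fun _ _ h' => h h' : Quotient R → Quotient R') ''
          ((I.nodes R (insert e X)).erase q2 : Finset (Quotient R)) := by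
      intro v hv
      by_cases hv' : Quotient.mk R v = q2
      · refine ⟨Quotient.mk R (I.ends e).1, ?_, ?_⟩
        · rw [Finset.mem_coe, Finset.mem_erase]
          exact ⟨hne, I.mem_nodes.2 ⟨e, Finset.mem_insert_self _ _, Or.inl rfl⟩⟩
        · exact Quotient.sound (Setoid.trans' _ he' (h (Setoid.symm' _ (Quotient.exact hv'))))
      · exact ⟨Quotient.mk R v, by rw [Finset.mem_coe, Finset.mem_erase]; exact ⟨hv', hv⟩, rfl⟩
    intro q hq
    obtain ⟨f, hf, rfl | rfl⟩ := I.mem_nodes.1 hq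
    · exact key _ (I.mem_nodes.2 ⟨f, Finset.mem_insert_of_mem hf, Or.inl rfl⟩)
    · exact key _ (I.mem_nodes.2 ⟨f, Finset.mem_insert_of_mem hf, Or.inr rfl⟩)
  rw [Finset.card_erase_of_mem hmem] at this
  have := Finset.card_pos.2 ⟨q2, hmem⟩
  omega

open Classical in
/-- In a forest on the classes of `R`, in which all leaves are active, the average degree of the
active classes is at most `2`. -/
theorem sum_edgeRate_le {R : Setoid V} {X : Finset E} {a : V → Prop}
    (hcut : ∀ e ∈ X, ¬ R (I.ends e).1 (I.ends e).2) (hcard : X.card ≤ (I.nodes R X).card)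
    (hleaf : ∀ v, (¬ ∃ w, a w ∧ R w v) → Quotient.mk R v ∈ I.nodes R X →
      2 ≤ (X.filter fun e => R (I.ends e).1 v ∨ R (I.ends e).2 v).card) :
    ∑ e ∈ X, I.edgeRate R a e ≤ 2 * classCount R a := by
  -- Activity and incidence are kept opaque, each known only through its characterisation.
  obtain ⟨act, hact⟩ : ∃ act : Quotient R → Prop, ∀ q, act q ↔ ∃ w, a w ∧ Quotient.mk R w = q :=
    ⟨_, fun _ => Iff.rfl⟩
  set N := I.nodes R X with hN
  obtain ⟨inc, hinc⟩ : ∃ inc : E → Quotient R → Prop, ∀ e q, inc e q ↔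
      (Quotient.mk R (I.ends e).1 = q ∨ Quotient.mk R (I.ends e).2 = q) := ⟨_, fun _ _ => Iff.rfl⟩
  have hactv : ∀ v, act (Quotient.mk R v) ↔ ∃ w, a w ∧ R w v := by
    intro v
    simp only [hact, Quotient.eq]
  have hends : ∀ e ∈ X, ∀ (p : Quotient R → Prop) [DecidablePred p],
      ((N.filter p).filter (inc e)).card = (if p (Quotient.mk R (I.ends e).1) then 1 else 0) +
        (if p (Quotient.mk R (I.ends e).2) then 1 else 0) := by
    intro e he p _
    have hset : (N.filter p).filter (inc e) =
        ({Quotient.mk R (I.ends e).1, Quotient.mk R (I.ends e).2} : Finset (Quotient R)).filter p := by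
      ext q
      simp only [Finset.mem_filter, Finset.mem_insert, Finset.mem_singleton, hinc]
      constructor
      · rintro ⟨⟨_, h1⟩, h2 | h2⟩
        · exact ⟨Or.inl h2.symm, h1⟩
        · exact ⟨Or.inr h2.symm, h1⟩
      · rintro ⟨h2 | h2, h1⟩
        · exact ⟨⟨I.mem_nodes.2 ⟨e, he, Or.inl h2.symm⟩, h1⟩, Or.inl h2.symm⟩
        · exact ⟨⟨I.mem_nodes.2 ⟨e, he, Or.inr h2.symm⟩, h1⟩, Or.inr h2.symm⟩
    have hne : Quotient.mk R (I.ends e).1 ≠ Quotient.mk R (I.ends e).2 :=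
      fun h => hcut e he (Quotient.exact h)
    rw [hset, Finset.card_filter, Finset.sum_pair hne]
  have hrate : ∀ e ∈ X, I.edgeRate R a e = ((N.filter act).filter (inc e)).card := by
    intro e he
    rw [hends e he, edgeRate, if_neg (hcut e he)]
    simp only [hactv]
  have hsum : ∀ e ∈ X, I.edgeRate R a e + ((N.filter (fun q => ¬ act q)).filter (inc e)).card = 2 := by
    intro e he
    rw [hrate e he, hends e he, hends e he]
    split_ifs <;> simp_all
  -- Double counting of incidences: inactive nodes are not leaves, so each contributes at least two
  -- edge ends.
  have hin : 2 * (N.filter (fun q => ¬ act q)).card ≤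
      ∑ e ∈ X, ((N.filter (fun q => ¬ act q)).filter (inc e)).card := by
    have := Finset.sum_card_bipartiteAbove_eq_sum_card_bipartiteBelow (s := X)
      (t := N.filter (fun q => ¬ act q)) inc
    simp only [Finset.bipartiteAbove, Finset.bipartiteBelow] at this
    rw [this, mul_comm, ← smul_eq_mul]
    refine Finset.card_nsmul_le_sum _ _ _ ?_
    intro q hq
    rw [Finset.mem_filter] at hq
    induction q using Quotient.inductionOn with
    | _ v =>
      have := hleaf v (fun h => hq.2 ((hactv v).2 h)) hq.1
      simpa only [hinc, Quotient.eq] using this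
  -- Active and inactive edge ends total `2|X|`, which is at most `2|N|`. Removing the inactive
  -- ends, at least two per inactive node, leaves at most two per active node.
  have htot := Finset.sum_congr rfl hsum
  rw [Finset.sum_add_distrib, Finset.sum_const, smul_eq_mul] at htot
  have hsplit := Finset.card_filter_add_card_filter_not (s := N) act
  have hle : (N.filter act).card ≤ classCount R a := by
    refine Finset.card_le_card ?_
    intro q hq
    obtain ⟨w, hw, rfl⟩ := (hact q).1 (Finset.mem_filter.1 hq).2
    exact Finset.mem_image.2 ⟨w, Finset.mem_filter.2 ⟨Finset.mem_univ _, hw⟩, rfl⟩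
  omega

/-- The identification of vertices by the base relation and an edge set. -/
def merged (S₀ : Setoid V) (F : Finset E) : Setoid V := S₀ ⊔ I.connectivity (F : Set E)

theorem merged_le {S₀ : Setoid V} {F : Finset E} {R : Setoid V} :
    I.merged S₀ F ≤ R ↔ S₀ ≤ R ∧ ∀ e ∈ F, R (I.ends e).1 (I.ends e).2 := by
  rw [merged, sup_le_iff, connectivity_le]
  rfl

theorem le_merged {S₀ : Setoid V} {F : Finset E} : S₀ ≤ I.merged S₀ F := le_sup_left

theorem merged_ends {S₀ : Setoid V} {F : Finset E} {e : E} (he : e ∈ F) :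
    I.merged S₀ F (I.ends e).1 (I.ends e).2 :=
  (I.merged_le.1 le_rfl).2 e he

theorem merged_mono {S₀ : Setoid V} {F F' : Finset E} (h : F ⊆ F') :
    I.merged S₀ F ≤ I.merged S₀ F' :=
  I.merged_le.2 ⟨I.le_merged, fun _ he => I.merged_ends (h he)⟩

open Classical in
-- Collapse the side `P` to the vertex `o`, the end of `f` outside it. This turns `f` into a loop,
-- keeps all other generators of the relation valid, and fixes every vertex outside `P`.
theorem merged_erase_of_not {S₀ : Setoid V} {F : Finset E} {f : E} {P : V → Prop} {o : V}
    (ho : ¬ P o) (hf : ((I.ends f).1 = o ∨ P (I.ends f).1) ∧ ((I.ends f).2 = o ∨ P (I.ends f).2))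
    (hS : ∀ u v, S₀ u v → (P u ↔ P v))
    (hF : ∀ e ∈ F, e ≠ f → (P (I.ends e).1 ↔ P (I.ends e).2))
    {x y : V} (hx : ¬ P x) (hy : ¬ P y) (hxy : I.merged S₀ F x y) :
    I.merged S₀ (F.erase f) x y := by
  set φ : V → V := fun w => if P w then o else w with hφ
  have hle : I.merged S₀ F ≤ (I.merged S₀ (F.erase f)).comap φ := by
    have both : ∀ u v, (P u ↔ P v) → I.merged S₀ (F.erase f) u v →
        I.merged S₀ (F.erase f) (φ u) (φ v) := by
      intro u v huv h
      by_cases hu : P u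
      · simp only [hφ, if_pos hu, if_pos (huv.1 hu)]
        exact Setoid.refl' _ _
      · simp only [hφ, if_neg hu, if_neg (fun h => hu (huv.2 h))]
        exact h
    rw [merged_le]
    refine ⟨fun u v huv => both u v (hS u v huv) (I.le_merged huv), fun e he => ?_⟩
    by_cases hef : e = f
    · subst hef
      have : ∀ u, (u = o ∨ P u) → φ u = o := by
        rintro u (rfl | hu)
        · simp [hφ]
        · simp [hφ, hu]
      change I.merged S₀ (F.erase e) (φ _) (φ _)
      rw [this _ hf.1, this _ hf.2]
    · exact both _ _ (hF e he hef) (I.merged_ends (Finset.mem_erase.2 ⟨hef, he⟩))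
  have := hle hxy
  change I.merged S₀ (F.erase f) (φ x) (φ y) at this
  simpa only [hφ, if_neg hx, if_neg hy] using this

open Classical in
/-- An edge that is the only one to cross a set is not used by connections between two vertices on
the same side. -/
theorem merged_erase {S₀ : Setoid V} {F : Finset E} {f : E} {P : V → Prop}
    (hf : ¬ (P (I.ends f).1 ↔ P (I.ends f).2))
    (hS : ∀ u v, S₀ u v → (P u ↔ P v))
    (hF : ∀ e ∈ F, e ≠ f → (P (I.ends e).1 ↔ P (I.ends e).2))
    {x y : V} (hPxy : P x ↔ P y) (hxy : I.merged S₀ F x y) :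
    I.merged S₀ (F.erase f) x y := by
  -- The four cases are the side of `x` and `y` and the end of `f` lying on that side; the side
  -- without `x` and `y` is the one collapsed.
  by_cases hx : P x
  · by_cases h1 : P (I.ends f).1
    · exact I.merged_erase_of_not (P := fun v => ¬ P v) (o := (I.ends f).1) (by simpa using h1)
        ⟨Or.inl rfl, Or.inr (by tauto)⟩ (fun u v h => not_congr (hS u v h))
        (fun e he hef => not_congr (hF e he hef)) (by tauto) (by tauto) hxy
    · exact I.merged_erase_of_not (P := fun v => ¬ P v) (o := (I.ends f).2) (by tauto)
        ⟨Or.inr h1, Or.inl rfl⟩ (fun u v h => not_congr (hS u v h))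
        (fun e he hef => not_congr (hF e he hef)) (by tauto) (by tauto) hxy
  · by_cases h1 : P (I.ends f).1
    · exact I.merged_erase_of_not (P := P) (o := (I.ends f).2) (by tauto)
        ⟨Or.inr h1, Or.inl rfl⟩ hS hF hx (by tauto) hxy
    · exact I.merged_erase_of_not (P := P) (o := (I.ends f).1) h1
        ⟨Or.inl rfl, Or.inr (by tauto)⟩ hS hF hx (by tauto) hxy

/-! ### Moat growing on the contracted graph and its cost bound. -/

/-- A stage of a moat growing process: edge loads, tight edges selected so far, and the integral of
the number of active moats. -/
structure Stage (E : Type*) where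
  load : E → ℝ
  forest : Finset E
  bound : ℝ

open Classical in
/-- Elementary transitions of a moat growing process on the graph in which the classes of `S₀` are
contracted: growth of the classes that contain an active vertex, and addition of a tight edge. -/
inductive Transition (S₀ : Setoid V) : Stage E → Stage E → Prop
  | grow (g : Stage E) (a : V → Prop) (δ : ℝ) (hδ : 0 ≤ δ)
      (hd : ∀ d, ¬ I.merged S₀ g.forest (I.demand d).1 (I.demand d).2 →
        (∃ w, a w ∧ I.merged S₀ g.forest w (I.demand d).1) ∧
        (∃ w, a w ∧ I.merged S₀ g.forest w (I.demand d).2)) :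
      Transition S₀ g
        { load := fun e => g.load e + δ * I.edgeRate (I.merged S₀ g.forest) a e
          forest := g.forest
          bound := g.bound + δ * classCount (I.merged S₀ g.forest) a }
  | add (g : Stage E) (e : E) (he : ¬ I.merged S₀ g.forest (I.ends e).1 (I.ends e).2)
      (ht : g.load e = I.cost e) :
      Transition S₀ g { g with forest := insert e g.forest }

variable {I}

open Classical in
-- Edges selected after stage `g` form a forest on the classes of `g`: each joins classes that are
-- distinct when it is added, hence also earlier. The count goes by induction from the last stage
-- backwards, since each edge of `F` contracted on the way costs at least one node. That there are
-- no more edges than nodes is all that the degree bound requires.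
theorem forest_facts {S₀ : Setoid V} {g g' : Stage E}
    (h : Relation.ReflTransGen (I.Transition S₀) g g') {F : Finset E} (hF : F ⊆ g'.forest) :
    (∀ f ∈ F \ g.forest, ¬ I.merged S₀ g.forest (I.ends f).1 (I.ends f).2) ∧
    (F \ g.forest).card ≤ (I.nodes (I.merged S₀ g.forest) (F \ g.forest)).card := by
  induction h using Relation.ReflTransGen.head_induction_on with
  | refl => simp [Finset.sdiff_eq_empty_iff_subset.2 hF]
  | @head g _ hstep _ ih =>
    obtain ⟨ih1, ih2⟩ := ih
    cases hstep with
    | grow a δ hδ hd => exact ⟨ih1, ih2⟩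
    | add e he ht =>
      have hle : I.merged S₀ g.forest ≤ I.merged S₀ (insert e g.forest) :=
        I.merged_mono (Finset.subset_insert _ _)
      refine ⟨?_, ?_⟩
      · intro f hf hc
        by_cases hfe : f = e
        · exact he (hfe ▸ hc)
        · refine ih1 f ?_ (hle hc)
          simp only [Finset.mem_sdiff, Finset.mem_insert] at hf ⊢
          tauto
      · by_cases heF : e ∈ F
        · have heg : e ∉ g.forest := fun h => he (I.merged_ends h)
          have hins : F \ g.forest = insert e (F \ insert e g.forest) := by
            ext f
            simp only [Finset.mem_sdiff, Finset.mem_insert]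
            by_cases hfe : f = e
            · subst hfe; tauto
            · tauto
          have hnot : e ∉ F \ insert e g.forest := by simp
          have := I.card_nodes_insert hle he (I.merged_ends (Finset.mem_insert_self _ _))
            (F \ insert e g.forest)
          rw [hins, Finset.card_insert_of_notMem hnot]
          exact (Nat.add_le_add_right ih2 1).trans this
        · have hins : F \ insert e g.forest = F \ g.forest := by
            ext f
            simp only [Finset.mem_sdiff, Finset.mem_insert]
            by_cases hfe : f = e
            · subst hfe; tauto
            · tauto
          rw [hins] at ih2
          exact ih2.trans (I.card_nodes_mono hle _)

open Classical in
-- The degree bound applies because no inactive class is a leaf. Suppose `f` were the only edge of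
-- `F` leaving an inactive class. A pair already joined lies on one side of that class, and an
-- unjoined pair has both ends in active classes, thus outside it. By `merged_erase` no pair needs
-- `f`, against minimality.
theorem sum_growth_le {S₀ : Setoid V} {g g' : Stage E}
    (h : Relation.ReflTransGen (I.Transition S₀) g g') {F : Finset E} (hF : F ⊆ g'.forest)
    (hsol : ∀ d, I.merged S₀ F (I.demand d).1 (I.demand d).2)
    (hmin : ∀ e ∈ F, ∃ d, ¬ I.merged S₀ (F.erase e) (I.demand d).1 (I.demand d).2)
    {a : V → Prop} (hd : ∀ d, ¬ I.merged S₀ g.forest (I.demand d).1 (I.demand d).2 →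
        (∃ w, a w ∧ I.merged S₀ g.forest w (I.demand d).1) ∧
        (∃ w, a w ∧ I.merged S₀ g.forest w (I.demand d).2)) :
    ∑ e ∈ F \ g.forest, I.edgeRate (I.merged S₀ g.forest) a e ≤
      2 * classCount (I.merged S₀ g.forest) a := by
  obtain ⟨hcut, hcard⟩ := forest_facts h hF
  refine I.sum_edgeRate_le hcut hcard ?_
  intro v hv hnode
  set R := I.merged S₀ g.forest with hR
  by_contra hlt
  push Not at hlt
  obtain ⟨f, hf, hfv⟩ := I.mem_nodes.1 hnode
  have hfv' : R (I.ends f).1 v ∨ R (I.ends f).2 v := hfv.imp Quotient.exact Quotient.exact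
  have honly : ∀ e ∈ F \ g.forest, (R (I.ends e).1 v ∨ R (I.ends e).2 v) → e = f := by
    intro e he hev
    exact Finset.card_le_one.1 (Nat.le_of_lt_succ hlt) e (Finset.mem_filter.2 ⟨he, hev⟩) f
      (Finset.mem_filter.2 ⟨hf, hfv'⟩)
  have hcong : ∀ u w, R u w → (R u v ↔ R w v) := fun u w h =>
    ⟨fun h' => Setoid.trans' _ (Setoid.symm' _ h) h', fun h' => Setoid.trans' _ h h'⟩
  obtain ⟨d, hdd⟩ := hmin f (Finset.mem_sdiff.1 hf).1
  refine hdd (I.merged_erase (P := fun w => R w v) ?_ (fun u w h => hcong u w (I.le_merged h)) ?_ ?_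
    (hsol d))
  · intro hiff
    have : R (I.ends f).1 v ∧ R (I.ends f).2 v := by tauto
    exact hcut f hf (Setoid.trans' _ this.1 (Setoid.symm' _ this.2))
  · intro e he hef
    by_cases heg : e ∈ g.forest
    · exact hcong _ _ (I.merged_ends heg)
    · have h1 := honly e (Finset.mem_sdiff.2 ⟨he, heg⟩)
      tauto
  · by_cases hj : R (I.demand d).1 (I.demand d).2
    · exact hcong _ _ hj
    · obtain ⟨⟨w1, h1, h1'⟩, ⟨w2, h2, h2'⟩⟩ := hd d hj
      constructor
      · intro h'
        exact absurd ⟨w1, h1, Setoid.trans' _ h1' h'⟩ hv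
      · intro h'
        exact absurd ⟨w2, h2, Setoid.trans' _ h2' h'⟩ hv

open Classical in
/-- A minimal solution within the selected edges costs at most twice the integral of the number of
active moats. -/
theorem cost_le_of_transitions {S₀ : Setoid V} {g g' : Stage E}
    (h : Relation.ReflTransGen (I.Transition S₀) g g') {F : Finset E} (hF : F ⊆ g'.forest)
    (hsol : ∀ d, I.merged S₀ F (I.demand d).1 (I.demand d).2)
    (hmin : ∀ e ∈ F, ∃ d, ¬ I.merged S₀ (F.erase e) (I.demand d).1 (I.demand d).2) :
    ∑ e ∈ F \ g.forest, (I.cost e - g.load e) ≤ 2 * (g'.bound - g.bound) := by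
  induction h using Relation.ReflTransGen.head_induction_on with
  | refl => simp [Finset.sdiff_eq_empty_iff_subset.2 hF]
  -- Peeling off the first transition: the sum is the part of the cost of `F` not yet paid at stage
  -- `g`. Growth pays at most twice the increase of the bound, and a newly selected edge is fully
  -- paid.
  | @head g _ hstep hrest ih =>
    cases hstep with
    | grow a δ hδ hd =>
      have := sum_growth_le (hrest.head (Transition.grow g a δ hδ hd)) hF hsol hmin hd
      have h2 : (∑ e ∈ F \ g.forest, (I.edgeRate (I.merged S₀ g.forest) a e : ℝ)) ≤
        2 * (classCount (I.merged S₀ g.forest) a : ℝ) := by exact_mod_cast this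
      simp only [← sub_sub] at ih
      rw [Finset.sum_sub_distrib, ← Finset.mul_sum] at ih
      nlinarith
    | add e he ht =>
      refine le_trans (le_of_eq ?_) ih
      symm
      refine Finset.sum_subset ?_ ?_
      · exact Finset.sdiff_subset_sdiff subset_rfl (Finset.subset_insert _ _)
      · intro f hf hf'
        simp only [Finset.mem_sdiff, Finset.mem_insert] at hf hf'
        have : f = e := by tauto
        rw [this, ht, sub_self]

end Moats

end SteinerForest

/-! ### Programs with bounded loops and their compilation. -/

namespace RAM

/-- Structured programs: `iter c b p` runs `p` with counter `c[0,0]` equal to `0, 1, …, N - 1`,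
where `N` is the entry `[b, 0]` of the natural array `0`. -/
inductive Code where
  | skip
  | setNat (a : ℕ) (i j x : NatExpr)
  | setReal (a : ℕ) (i j : NatExpr) (x : RealExpr)
  | seq (p q : Code)
  | cond (b : Test) (p q : Code)
  | iter (c b : ℕ) (p : Code)

namespace Code

/-- Translation to machine programs. -/
def compile : Code → Program
  | skip => .skip
  | setNat a i j x => .setNat a i j x
  | setReal a i j x => .setReal a i j x
  | seq p q => .seq p.compile q.compile
  | cond b p q => .cond b p.compile q.compile
  | iter c b p => .seq (.setNat c (.const 0) (.const 0) (.const 0))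
      (.loop (.neg (.natLE (.get 0 (.const b) (.const 0)) (.get c (.const 0) (.const 0))))
        (.seq p.compile (.setNat c (.const 0) (.const 0)
          (.add (.get c (.const 0) (.const 0)) (.const 1)))))

/-- Memory after `N` rounds of a loop with counter `c` and body `f`. -/
def rounds (c : ℕ) (f : Memory → Memory) (σ : Memory) : ℕ → Memory
  | 0 => σ.setNat c 0 0 0
  | N + 1 => (f (rounds c f σ N)).setNat c 0 0 (N + 1)

open Classical in
/-- The memory after execution. -/
noncomputable def run (ε : ℝ) : Code → Memory → Memory
  | skip, σ => σ
  | setNat a i j x, σ => σ.setNat a (i.eval σ) (j.eval σ) (x.eval σ)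
  | setReal a i j x, σ => σ.setReal a (i.eval σ) (j.eval σ) (x.eval ε σ)
  | seq p q, σ => q.run ε (p.run ε σ)
  | cond b p q, σ => if b.Holds ε σ then p.run ε σ else q.run ε σ
  | iter c b p, σ => rounds c (p.run ε) σ (σ.nat 0 b 0)

/-- The natural arrays that a program may modify. -/
def natWrites : Code → List ℕ
  | skip => []
  | setNat a _ _ _ => [a]
  | setReal _ _ _ _ => []
  | seq p q => p.natWrites ++ q.natWrites
  | cond _ p q => p.natWrites ++ q.natWrites
  | iter c _ p => c :: p.natWrites

/-- The real arrays that a program may modify. -/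
def realWrites : Code → List ℕ
  | skip => []
  | setNat _ _ _ _ => []
  | setReal a _ _ _ => [a]
  | seq p q => p.realWrites ++ q.realWrites
  | cond _ p q => p.realWrites ++ q.realWrites
  | iter _ _ p => p.realWrites

/-- Loop bodies modify neither their counter nor the array of sizes. -/
def WellFormed : Code → Prop
  | skip => True
  | setNat _ _ _ _ => True
  | setReal _ _ _ _ => True
  | seq p q => p.WellFormed ∧ q.WellFormed
  | cond _ p q => p.WellFormed ∧ q.WellFormed
  | iter c _ p => c ≠ 0 ∧ c ∉ p.natWrites ∧ 0 ∉ p.natWrites ∧ p.WellFormed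

/-- A bound on the number of steps in terms of a bound on the sizes. -/
noncomputable def time : Code → Polynomial ℕ
  | skip => 1
  | setNat _ _ _ _ => 1
  | setReal _ _ _ _ => 1
  | seq p q => p.time + q.time
  | cond _ p q => p.time + q.time + 1
  | iter _ _ p => Polynomial.X * (p.time + 2) + 2

theorem rounds_nat {c a : ℕ} {f : Memory → Memory} (h : a ≠ c) (hf : ∀ τ, (f τ).nat a = τ.nat a)
    (σ : Memory) (N : ℕ) : (rounds c f σ N).nat a = σ.nat a := by
  induction N with
  | zero => funext i' j'; simp [rounds, Memory.setNat, h]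
  | succ N ih =>
    rw [← ih]
    funext i' j'
    simp [rounds, Memory.setNat, h, hf]

theorem rounds_real {c a : ℕ} {f : Memory → Memory} (hf : ∀ τ, (f τ).real a = τ.real a)
    (σ : Memory) (N : ℕ) : (rounds c f σ N).real a = σ.real a := by
  induction N with
  | zero => rfl
  | succ N ih =>
    rw [← ih]
    exact hf _

/-- The frame rule: later proofs track unaffected data just by inspecting which arrays a program
writes. -/
theorem run_nat_of_notMem (ε : ℝ) (p : Code) (σ : Memory) {a : ℕ} (h : a ∉ p.natWrites) :
    (p.run ε σ).nat a = σ.nat a := by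
  induction p generalizing σ with
  | skip => rfl
  | setNat a' i j x =>
    have : a ≠ a' := by simpa [natWrites] using h
    funext i' j'
    simp [run, Memory.setNat, this]
  | setReal a' i j x => rfl
  | seq p q ihp ihq =>
    simp only [natWrites, List.mem_append, not_or] at h
    rw [run, ihq _ h.2, ihp _ h.1]
  | cond b p q ihp ihq =>
    simp only [natWrites, List.mem_append, not_or] at h
    rw [run]
    split_ifs
    · exact ihp _ h.1
    · exact ihq _ h.2
  | iter c b p ih =>
    simp only [natWrites, List.mem_cons, not_or] at h
    exact rounds_nat h.1 (fun τ => ih τ h.2) σ _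

theorem run_real_of_notMem (ε : ℝ) (p : Code) (σ : Memory) {a : ℕ} (h : a ∉ p.realWrites) :
    (p.run ε σ).real a = σ.real a := by
  induction p generalizing σ with
  | skip => rfl
  | setReal a' i j x =>
    have : a ≠ a' := by simpa [realWrites] using h
    funext i' j'
    simp [run, Memory.setReal, this]
  | setNat a' i j x => rfl
  | seq p q ihp ihq =>
    simp only [realWrites, List.mem_append, not_or] at h
    rw [run, ihq _ h.2, ihp _ h.1]
  | cond b p q ihp ihq =>
    simp only [realWrites, List.mem_append, not_or] at h
    rw [run]
    split_ifs
    · exact ihp _ h.1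
    · exact ihq _ h.2
  | iter c b p ih =>
    simp only [realWrites] at h
    exact rounds_real (fun τ => ih τ h) σ _

theorem rounds_nat_of_notMem {ε : ℝ} {p : Code} {c a : ℕ} (σ : Memory) (N : ℕ)
    (h : a ∉ c :: p.natWrites) : (rounds c (p.run ε) σ N).nat a = σ.nat a := by
  rw [List.mem_cons, not_or] at h
  exact rounds_nat h.1 (fun τ => run_nat_of_notMem ε p τ h.2) σ N

theorem rounds_real_of_notMem {ε : ℝ} {p : Code} {c a : ℕ} (σ : Memory) (N : ℕ)
    (h : a ∉ p.realWrites) : (rounds c (p.run ε) σ N).real a = σ.real a :=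
  rounds_real (fun τ => run_real_of_notMem ε p τ h) σ N

theorem rounds_counter (c : ℕ) (f : Memory → Memory) (σ : Memory) (N : ℕ) :
    (rounds c f σ N).nat c 0 0 = N := by
  cases N <;> simp [rounds, Memory.setNat]

/-- The rule for loops. -/
theorem run_iter {ε : ℝ} {c b : ℕ} {p : Code} {σ : Memory} (Inv : ℕ → Memory → Prop)
    (h0 : Inv 0 (σ.setNat c 0 0 0))
    (hs : ∀ i < σ.nat 0 b 0, ∀ τ, τ.nat c 0 0 = i →
      (∀ a, a ∉ c :: p.natWrites → τ.nat a = σ.nat a) →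
      (∀ a, a ∉ p.realWrites → τ.real a = σ.real a) → Inv i τ →
      Inv (i + 1) ((p.run ε τ).setNat c 0 0 (i + 1))) :
    Inv (σ.nat 0 b 0) ((iter c b p).run ε σ) := by
  rw [run]
  have : ∀ N ≤ σ.nat 0 b 0, Inv N (rounds c (p.run ε) σ N) := by
    intro N hN
    induction N with
    | zero => exact h0
    | succ N ih =>
      exact hs N hN _ (rounds_counter _ _ _ _) (fun _ => rounds_nat_of_notMem _ _)
        (fun _ => rounds_real_of_notMem _ _) (ih (Nat.le_of_succ_le hN))
  exact this _ le_rfl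

/-- Array `0` is never written, so every loop bound stays fixed and at most `M`; termination and the
polynomial bound then follow by structural induction. -/
theorem exec_compile (ε : ℝ) {p : Code} (hp : p.WellFormed) {M : ℕ} {σ : Memory}
    (hσ : ∀ i, σ.nat 0 i 0 ≤ M) (h0 : 0 ∉ p.natWrites) :
    ∃ T ≤ p.time.eval M, Exec ε p.compile σ T (p.run ε σ) := by
  induction p generalizing σ with
  | skip => exact ⟨1, by simp [time], .skip _⟩
  | setNat a i j x => exact ⟨1, by simp [time], .setNat _ _ _ _ _⟩
  | setReal a i j x => exact ⟨1, by simp [time], .setReal _ _ _ _ _⟩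
  | seq p q ihp ihq =>
    simp only [natWrites, List.mem_append, not_or] at h0
    obtain ⟨T1, h1, e1⟩ := ihp hp.1 hσ h0.1
    obtain ⟨T2, h2, e2⟩ := ihq hp.2 (σ := p.run ε σ)
      (by rw [run_nat_of_notMem ε p σ h0.1]; exact hσ) h0.2
    exact ⟨T1 + T2, by simp only [time, Polynomial.eval_add]; omega, .seq e1 e2⟩
  | cond b p q ihp ihq =>
    simp only [natWrites, List.mem_append, not_or] at h0
    obtain ⟨T1, h1, e1⟩ := ihp hp.1 hσ h0.1
    obtain ⟨T2, h2, e2⟩ := ihq hp.2 hσ h0.2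
    rw [run]
    by_cases hb : b.Holds ε σ
    · rw [if_pos hb]
      exact ⟨T1 + 1, by simp only [time, Polynomial.eval_add, Polynomial.eval_one]; omega,
        .cond_true hb e1⟩
    · rw [if_neg hb]
      exact ⟨T2 + 1, by simp only [time, Polynomial.eval_add, Polynomial.eval_one]; omega,
        .cond_false hb e2⟩
  | iter c b p ih =>
    simp only [natWrites, List.mem_cons, not_or] at h0
    obtain ⟨hc0, hc, -, hp⟩ := hp
    set N := σ.nat 0 b 0 with hN
    have hsize : ∀ i, (rounds c (p.run ε) σ i).nat 0 = σ.nat 0 := fun i =>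
      rounds_nat h0.1 (fun τ => run_nat_of_notMem ε p τ h0.2) σ i
    -- With `r` rounds left, each costs the body plus an increment and a successful test; the final
    -- `1` is the failing test.
    have key : ∀ r i, i + r = N → ∃ T ≤ r * (p.time.eval M + 2) + 1,
        Exec ε (.loop (.neg (.natLE (.get 0 (.const b) (.const 0)) (.get c (.const 0) (.const 0))))
        (.seq p.compile (.setNat c (.const 0) (.const 0)
          (.add (.get c (.const 0) (.const 0)) (.const 1)))))
          (rounds c (p.run ε) σ i) T (rounds c (p.run ε) σ N) := by
      intro r
      induction r with
      | zero =>
        intro i hi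
        obtain rfl : i = N := by omega
        refine ⟨1, by omega, .loop_false ?_⟩
        simp only [Test.Holds, NatExpr.eval, rounds_counter, hsize, not_not, hN, le_refl]
      | succ r ihr =>
        intro i hi
        obtain ⟨T2, h2, e2⟩ := ihr (i + 1) (by omega)
        obtain ⟨T1, h1, e1⟩ := ih hp (σ := rounds c (p.run ε) σ i)
          (by rw [hsize]; exact hσ) h0.2
        have e3 : Exec ε (.setNat c (.const 0) (.const 0)
            (.add (.get c (.const 0) (.const 0)) (.const 1)))
            (p.run ε (rounds c (p.run ε) σ i)) 1 (rounds c (p.run ε) σ (i + 1)) := by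
          have := Exec.setNat (ε := ε) c (.const 0) (.const 0)
            (.add (.get c (.const 0) (.const 0)) (.const 1)) (p.run ε (rounds c (p.run ε) σ i))
          simp only [NatExpr.eval, run_nat_of_notMem ε p _ hc, rounds_counter] at this
          exact this
        refine ⟨(T1 + 1) + T2 + 1, ?_, .loop_true ?_ (.seq e1 e3) e2⟩
        · rw [Nat.succ_mul]; omega
        · simp only [Test.Holds, NatExpr.eval, rounds_counter, hsize]
          omega
    obtain ⟨T, hT, e⟩ := key N 0 (by omega)
    refine ⟨1 + T, ?_, .seq (.setNat _ _ _ _ _) e⟩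
    simp only [time, Polynomial.eval_add, Polynomial.eval_mul, Polynomial.eval_X,
      Polynomial.eval_ofNat]
    have := Nat.mul_le_mul_right (p.time.eval M + 2) (hσ b)
    rw [← hN] at this
    omega

end Code

end RAM

namespace RAM

/-! ### Abbreviations and their evaluation rules. -/

section Macros

def NatExpr.idx (c : ℕ) : NatExpr := .get c (.const 0) (.const 0)

def NatExpr.entry (a : ℕ) (i : NatExpr) : NatExpr := .get a i (.const 0)

def RealExpr.entry (a : ℕ) (i : NatExpr) : RealExpr := .get a i (.const 0)

def Test.natEq (x y : NatExpr) : Test := .conj (.natLE x y) (.natLE y x)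

def Code.setEntry (a : ℕ) (i x : NatExpr) : Code := .setNat a i (.const 0) x

def Code.setRealEntry (a : ℕ) (i : NatExpr) (x : RealExpr) : Code := .setReal a i (.const 0) x

variable (ε : ℝ) (σ : Memory)

@[simp] theorem Memory.setNat_nat (a i j x b k l : ℕ) : (σ.setNat a i j x).nat b k l =
    if b = a ∧ k = i ∧ l = j then x else σ.nat b k l := rfl

@[simp] theorem Memory.setNat_real (a i j x : ℕ) : (σ.setNat a i j x).real = σ.real := rfl

@[simp] theorem Memory.setReal_real (a i j : ℕ) (x : ℝ) (b k l : ℕ) :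
    (σ.setReal a i j x).real b k l = if b = a ∧ k = i ∧ l = j then x else σ.real b k l := rfl

@[simp] theorem Memory.setReal_nat (a i j : ℕ) (x : ℝ) : (σ.setReal a i j x).nat = σ.nat := rfl

@[simp] theorem NatExpr.eval_const (k : ℕ) : (NatExpr.const k).eval σ = k := rfl

@[simp] theorem NatExpr.eval_get (a : ℕ) (i j : NatExpr) :
    (NatExpr.get a i j).eval σ = σ.nat a (i.eval σ) (j.eval σ) := rfl

@[simp] theorem NatExpr.eval_idx (c : ℕ) : (NatExpr.idx c).eval σ = σ.nat c 0 0 := rfl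

@[simp] theorem NatExpr.eval_entry (a : ℕ) (i : NatExpr) :
    (NatExpr.entry a i).eval σ = σ.nat a (i.eval σ) 0 := rfl

@[simp] theorem RealExpr.eval_entry (a : ℕ) (i : NatExpr) :
    (RealExpr.entry a i).eval ε σ = σ.real a (i.eval σ) 0 := rfl

@[simp] theorem RealExpr.eval_zero : RealExpr.zero.eval ε σ = 0 := rfl

@[simp] theorem RealExpr.eval_add (x y : RealExpr) :
    (RealExpr.add x y).eval ε σ = x.eval ε σ + y.eval ε σ := rfl

@[simp] theorem RealExpr.eval_sub (x y : RealExpr) :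
    (RealExpr.sub x y).eval ε σ = x.eval ε σ - y.eval ε σ := rfl

@[simp] theorem RealExpr.eval_half (x : RealExpr) :
    (RealExpr.half x).eval ε σ = x.eval ε σ / 2 := rfl

@[simp] theorem RealExpr.eval_scale (x : RealExpr) :
    (RealExpr.scale x).eval ε σ = ε * x.eval ε σ := rfl

@[simp] theorem Test.holds_natEq (x y : NatExpr) :
    (Test.natEq x y).Holds ε σ ↔ x.eval σ = y.eval σ := le_antisymm_iff.symm

@[simp] theorem Test.holds_realLE (x y : RealExpr) :
    (Test.realLE x y).Holds ε σ ↔ x.eval ε σ ≤ y.eval ε σ := Iff.rfl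

@[simp] theorem Test.holds_neg (b : Test) : (Test.neg b).Holds ε σ ↔ ¬ b.Holds ε σ := Iff.rfl

@[simp] theorem Test.holds_conj (b c : Test) :
    (Test.conj b c).Holds ε σ ↔ b.Holds ε σ ∧ c.Holds ε σ := Iff.rfl

@[simp] theorem Code.run_setEntry (a : ℕ) (i x : NatExpr) :
    (Code.setEntry a i x).run ε σ = σ.setNat a (i.eval σ) 0 (x.eval σ) := rfl

@[simp] theorem Code.run_setRealEntry (a : ℕ) (i : NatExpr) (x : RealExpr) :
    (Code.setRealEntry a i x).run ε σ = σ.setReal a (i.eval σ) 0 (x.eval ε σ) := rfl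

@[simp] theorem Code.run_skip : Code.skip.run ε σ = σ := rfl

@[simp] theorem Code.run_seq (p q : Code) : (Code.seq p q).run ε σ = q.run ε (p.run ε σ) := rfl

open Classical in
@[simp] theorem Code.run_cond (b : Test) (p q : Code) :
    (Code.cond b p q).run ε σ = if b.Holds ε σ then p.run ε σ else q.run ε σ := rfl

@[simp] theorem Code.natWrites_setEntry (a : ℕ) (i x : NatExpr) :
    (Code.setEntry a i x).natWrites = [a] := rfl

@[simp] theorem Code.natWrites_setRealEntry (a : ℕ) (i : NatExpr) (x : RealExpr) :
    (Code.setRealEntry a i x).natWrites = [] := rfl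

@[simp] theorem Code.realWrites_setEntry (a : ℕ) (i x : NatExpr) :
    (Code.setEntry a i x).realWrites = [] := rfl

@[simp] theorem Code.realWrites_setRealEntry (a : ℕ) (i : NatExpr) (x : RealExpr) :
    (Code.setRealEntry a i x).realWrites = [a] := rfl

@[simp] theorem Code.wellFormed_setEntry (a : ℕ) (i x : NatExpr) :
    (Code.setEntry a i x).WellFormed := trivial

@[simp] theorem Code.wellFormed_setRealEntry (a : ℕ) (i : NatExpr) (x : RealExpr) :
    (Code.setRealEntry a i x).WellFormed := trivial

attribute [simp] Code.natWrites Code.realWrites Code.WellFormed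

end Macros

open NatExpr (idx entry)

/-! ### Partitions stored as label arrays. -/

namespace Code

/-- Merge the classes of the vertices `x` and `y` in the label array `L`. -/
def unite (L : ℕ) (x y : NatExpr) : Code :=
  .seq (setEntry 15 (.const 0) (entry L x)) (.seq (setEntry 16 (.const 0) (entry L y))
    (.iter 20 0 (.cond (.natEq (entry L (idx 20)) (idx 16)) (setEntry L (idx 20) (idx 15)) .skip)))

/-- Both labels are saved in scratch cells beforehand, because the loop overwrites the label of `y`
itself. The expression `y` is read after the first save, whence the modified memory in `ht`. -/
theorem run_unite {ε : ℝ} {σ : Memory} {L : ℕ} (hL : L ≠ 15 ∧ L ≠ 16 ∧ L ≠ 20) {x y : NatExpr}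
    {s t : ℕ} (hs : σ.nat L (x.eval σ) 0 = s)
    (ht : σ.nat L (y.eval (σ.setNat 15 0 0 s)) 0 = t) (w : ℕ) :
    ((unite L x y).run ε σ).nat L w 0 =
      if w < σ.nat 0 0 0 ∧ σ.nat L w 0 = t then s else σ.nat L w 0 := by
  obtain ⟨h15, h16, h20⟩ := hL
  have hτ : (unite L x y).run ε σ = (Code.iter 20 0 (.cond (.natEq (entry L (idx 20)) (idx 16))
      (setEntry L (idx 20) (idx 15)) .skip)).run ε
        ((σ.setNat 15 0 0 s).setNat 16 0 0 t) := by
    simp only [unite, run_seq, run_setEntry, NatExpr.eval_const, NatExpr.eval_entry, hs]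
    simp only [Memory.setNat_nat, h15, false_and, if_false, ht]
  rw [hτ]
  refine run_iter (fun i τ => ∀ w, τ.nat L w 0 =
    if w < i ∧ σ.nat L w 0 = t then s else σ.nat L w 0) ?_ ?_ w
  · intro w
    simp [h15, h16, h20]
  · intro i hi τ hc hn _ hinv w
    have e15 : τ.nat 15 0 0 = s := by
      rw [hn 15 (by simp [h15.symm])]
      simp
    have e16 : τ.nat 16 0 0 = t := by
      rw [hn 16 (by simp [h16.symm])]
      simp
    have hi' := hinv i
    simp only [lt_irrefl, false_and, if_false] at hi'
    simp only [run_cond, Test.holds_natEq, NatExpr.eval_entry, NatExpr.eval_idx, hc, e15, e16, hi',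
      run_setEntry, run_skip]
    have hw := hinv w
    by_cases hwi : w = i
    · subst hwi
      split_ifs <;> simp_all
    · have : (w < i + 1) ↔ w < i := by omega
      split_ifs <;> simp_all

end Code

/-- Representatives: every label is a vertex that carries itself as label. -/
def Labelling (n : ℕ) (f : ℕ → ℕ) : Prop := ∀ v < n, f v < n ∧ f (f v) = f v

/-- The partition given by a label array. -/
def labelSetoid (n : ℕ) (f : ℕ → ℕ) : Setoid (Fin n) := Setoid.ker fun v => f v

theorem labelSetoid_iff {n : ℕ} {f : ℕ → ℕ} {u v : Fin n} : labelSetoid n f u v ↔ f u = f v :=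
  Iff.rfl

/-- The relation that identifies two points. -/
def pairSetoid {V : Type*} (u v : V) : Setoid V := Relation.EqvGen.setoid fun a b => a = u ∧ b = v

theorem pairSetoid_le {V : Type*} {u v : V} {R : Setoid V} : pairSetoid u v ≤ R ↔ R u v := by
  constructor
  · intro h
    exact h (Relation.EqvGen.rel _ _ ⟨rfl, rfl⟩)
  · intro h
    refine Setoid.eqvGen_le ?_
    rintro _ _ ⟨rfl, rfl⟩
    exact h

/-- The surviving label `f u` remains its own label: it is either untouched or overwritten by
itself. -/
theorem labelling_relabel {n : ℕ} {f g : ℕ → ℕ} (hf : Labelling n f) {u v : Fin n}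
    (hg : ∀ w, g w = if w < n ∧ f w = f v then f u else f w) :
    Labelling n g ∧ labelSetoid n g = labelSetoid n f ⊔ pairSetoid u v := by
  have hg' : ∀ w < n, g w = if f w = f v then f u else f w := by
    intro w hw
    simp [hg w, hw]
  have hu := hf u u.2
  constructor
  · intro w hw
    obtain ⟨h1, h2⟩ := hf w hw
    rw [hg' w hw]
    split_ifs with h
    · rw [hg' _ hu.1, hu.2]
      exact ⟨hu.1, by split_ifs <;> rfl⟩
    · rw [hg' _ h1, h2, if_neg h]
      exact ⟨h1, rfl⟩
  · apply le_antisymm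
    · intro a b hab
      rw [labelSetoid_iff, hg' a a.2, hg' b b.2] at hab
      have hle : labelSetoid n f ≤ labelSetoid n f ⊔ pairSetoid u v := le_sup_left
      have huv : (labelSetoid n f ⊔ pairSetoid u v) u v := pairSetoid_le.1 le_sup_right
      have key : ∀ c : Fin n, f c = f v → (labelSetoid n f ⊔ pairSetoid u v) c u := fun c hc =>
        Setoid.trans' _ (hle (labelSetoid_iff.2 hc)) (Setoid.symm' _ huv)
      split_ifs at hab with h1 h2 h2
      · exact Setoid.trans' _ (key a h1) (Setoid.symm' _ (key b h2))
      · exact Setoid.trans' _ (key a h1) (hle (labelSetoid_iff.2 hab))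
      · exact Setoid.trans' _ (hle (labelSetoid_iff.2 hab)) (Setoid.symm' _ (key b h2))
      · exact hle (labelSetoid_iff.2 hab)
    · refine sup_le ?_ (pairSetoid_le.2 ?_)
      · intro a b hab
        rw [labelSetoid_iff] at hab ⊢
        rw [hg' a a.2, hg' b b.2, hab]
      · rw [labelSetoid_iff, hg' u u.2, hg' v v.2]
        simp

/-- The memory still holds the input. -/
def Loaded {n m h k : ℕ} (I : SteinerForest (Fin n) (Fin m) (Fin h))
    (𝒮 : Fin k → Finset (Fin n)) (σ : Memory) : Prop :=
  (∀ a < 4, σ.nat a = (encode I 𝒮).nat a) ∧ σ.real 0 = (encode I 𝒮).real 0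

section Loaded

variable {n m h k : ℕ} {I : SteinerForest (Fin n) (Fin m) (Fin h)} {𝒮 : Fin k → Finset (Fin n)}
  {σ : Memory} {ε : ℝ}

theorem loaded_encode : Loaded I 𝒮 (encode I 𝒮) := ⟨fun _ _ => rfl, rfl⟩

theorem Loaded.congr (hσ : Loaded I 𝒮 σ) {τ : Memory} (h1 : ∀ a < 4, τ.nat a = σ.nat a)
    (h2 : τ.real 0 = σ.real 0) : Loaded I 𝒮 τ :=
  ⟨fun a ha => (h1 a ha).trans (hσ.1 a ha), h2.trans hσ.2⟩

theorem Loaded.run (hσ : Loaded I 𝒮 σ) {p : Code} (h1 : ∀ a < 4, a ∉ p.natWrites)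
    (h2 : 0 ∉ p.realWrites) : Loaded I 𝒮 (p.run ε σ) :=
  hσ.congr (fun a ha => p.run_nat_of_notMem ε σ (h1 a ha)) (p.run_real_of_notMem ε σ h2)

theorem Loaded.setNat (hσ : Loaded I 𝒮 σ) {a i j x : ℕ} (ha : 4 ≤ a) :
    Loaded I 𝒮 (σ.setNat a i j x) := by
  refine hσ.congr (fun b hb => ?_) rfl
  funext k l
  have : b ≠ a := by omega
  simp [this]

theorem Loaded.vertices (hσ : Loaded I 𝒮 σ) : σ.nat 0 0 0 = n := by
  rw [hσ.1 0 (by norm_num)]; rfl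

theorem Loaded.edges (hσ : Loaded I 𝒮 σ) : σ.nat 0 1 0 = m := by
  rw [hσ.1 0 (by norm_num)]; rfl

theorem Loaded.demands (hσ : Loaded I 𝒮 σ) : σ.nat 0 2 0 = h := by
  rw [hσ.1 0 (by norm_num)]; rfl

theorem Loaded.sets (hσ : Loaded I 𝒮 σ) : σ.nat 0 3 0 = k := by
  rw [hσ.1 0 (by norm_num)]; rfl

theorem Loaded.fst (hσ : Loaded I 𝒮 σ) (e : Fin m) : σ.nat 1 e 0 = (I.ends e).1 := by
  rw [hσ.1 1 (by norm_num)]; simp [encode]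

theorem Loaded.snd (hσ : Loaded I 𝒮 σ) (e : Fin m) : σ.nat 1 e 1 = (I.ends e).2 := by
  rw [hσ.1 1 (by norm_num)]; simp [encode]

theorem Loaded.demand_fst (hσ : Loaded I 𝒮 σ) (d : Fin h) : σ.nat 2 d 0 = (I.demand d).1 := by
  rw [hσ.1 2 (by norm_num)]; simp [encode]

theorem Loaded.demand_snd (hσ : Loaded I 𝒮 σ) (d : Fin h) : σ.nat 2 d 1 = (I.demand d).2 := by
  rw [hσ.1 2 (by norm_num)]; simp [encode]

theorem Loaded.mem (hσ : Loaded I 𝒮 σ) (i : Fin k) (v : Fin n) :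
    σ.nat 3 i v = 1 ↔ v ∈ 𝒮 i := by
  rw [hσ.1 3 (by norm_num)]; simp [encode]

theorem Loaded.cost (hσ : Loaded I 𝒮 σ) (e : Fin m) : σ.real 0 e 0 = I.cost e := by
  rw [hσ.2]; simp [encode]

end Loaded

end RAM

namespace RAM

open NatExpr (idx entry)

/-- The first column of a natural array. -/
def Memory.col (σ : Memory) (a : ℕ) : ℕ → ℕ := fun v => σ.nat a v 0

/-- The edges that carry a mark in the array `a`. -/
def marked (m : ℕ) (σ : Memory) (a : ℕ) : Finset (Fin m) :=
  Finset.univ.filter fun e => σ.nat a (e : ℕ) 0 = 1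

theorem mem_marked {m : ℕ} {σ : Memory} {a : ℕ} {e : Fin m} :
    e ∈ marked m σ a ↔ σ.nat a e 0 = 1 := by
  simp [marked]

theorem marked_congr {m : ℕ} {σ τ : Memory} {a : ℕ} (h : τ.nat a = σ.nat a) :
    marked m τ a = marked m σ a := by
  rw [marked, marked, h]

theorem col_congr {σ τ : Memory} {a : ℕ} (h : τ.nat a = σ.nat a) : τ.col a = σ.col a := by
  funext v
  simp only [Memory.col, h]

theorem setNat_nat_of_ne {σ : Memory} {a b i j x : ℕ} (h : b ≠ a) :
    (σ.setNat a i j x).nat b = σ.nat b := by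
  funext k l
  simp [h]

theorem setReal_real_of_ne {σ : Memory} {a b i j : ℕ} {x : ℝ} (h : b ≠ a) :
    (σ.setReal a i j x).real b = σ.real b := by
  funext k l
  simp [h]

/-! ### Subroutines on edges, shared by both processes. -/

namespace Code

/-- First endpoint of the current edge. -/
def eFst : NatExpr := .get 1 (idx 21) (.const 0)

/-- Second endpoint of the current edge. -/
def eSnd : NatExpr := .get 1 (idx 21) (.const 1)

/-- Add every edge whose load in array `l` has reached its cost and that joins distinct classes. -/
def mergeTight (L l M : ℕ) : Code :=
  .iter 21 1 (.cond (.conj (.realLE (.entry 0 (idx 21)) (.entry l (idx 21)))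
      (.neg (.natEq (entry L eFst) (entry L eSnd))))
    (.seq (setEntry M (idx 21) (.const 1)) (unite L eFst eSnd)) .skip)

/-- Run `p₁` or `p₂` if the current edge is cut by one or two active classes. -/
def onEdge (L A : ℕ) (p₁ p₂ : Code) : Code :=
  .cond (.natEq (entry L eFst) (entry L eSnd)) .skip
    (.cond (.natEq (entry A (entry L eFst)) (.const 1))
      (.cond (.natEq (entry A (entry L eSnd)) (.const 1)) p₂ p₁)
      (.cond (.natEq (entry A (entry L eSnd)) (.const 1)) p₁ .skip))

/-- Increase loads for a duration stored in the real array `b`. -/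
def growEdges (L A l b : ℕ) : Code :=
  .iter 21 1 (onEdge L A
    (setRealEntry l (idx 21) (.add (.entry l (idx 21)) (.entry b (.const 0))))
    (setRealEntry l (idx 21)
      (.add (.add (.entry l (idx 21)) (.entry b (.const 0))) (.entry b (.const 0)))))

/-- Replace the minimum in the real array `b` by `x` if it is not defined or larger. -/
def minUpdate (b : ℕ) (x : RealExpr) : Code :=
  .cond (.conj (.natEq (idx 13) (.const 1)) (.realLE (.entry b (.const 0)) x)) .skip
    (.seq (setEntry 13 (.const 0) (.const 1)) (setRealEntry b (.const 0) x))

/-- Take the delays until edges become tight into account. -/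
def minEdges (L A l b : ℕ) : Code :=
  .iter 21 1 (onEdge L A
    (minUpdate b (.sub (.entry 0 (idx 21)) (.entry l (idx 21))))
    (minUpdate b (.half (.sub (.entry 0 (idx 21)) (.entry l (idx 21))))))

end Code

section Specs

variable {n m h k : ℕ} {I : SteinerForest (Fin n) (Fin m) (Fin h)} {𝒮 : Fin k → Finset (Fin n)}
  {σ : Memory} {ε : ℝ}

theorem merged_insert {S₀ : Setoid (Fin n)} {F : Finset (Fin m)} {e : Fin m} :
    I.merged S₀ (insert e F) = I.merged S₀ F ⊔ pairSetoid (I.ends e).1 (I.ends e).2 := by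
  apply le_antisymm
  · rw [SteinerForest.merged_le]
    refine ⟨I.le_merged.trans le_sup_left, fun f hf => ?_⟩
    rcases Finset.mem_insert.1 hf with rfl | hf
    · exact pairSetoid_le.1 le_sup_right
    · exact (le_sup_left : I.merged S₀ F ≤ _) (I.merged_ends hf)
  · exact sup_le (I.merged_mono (Finset.subset_insert _ _))
      (pairSetoid_le.2 (I.merged_ends (Finset.mem_insert_self _ _)))

/-- Arrays that are neither input nor used for counters and scratch. -/
def Free (a : ℕ) : Prop := 4 ≤ a ∧ a ≠ 15 ∧ a ≠ 16 ∧ a < 20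

theorem unite_spec {L : ℕ} (hL : Free L) (hσ : Loaded I 𝒮 σ) {x y : NatExpr} {u v : Fin n}
    (hx : x.eval σ = u) (hy : ∀ s, y.eval (σ.setNat 15 0 0 s) = v)
    (hlab : Labelling n (σ.col L)) :
    Labelling n (((Code.unite L x y).run ε σ).col L) ∧
    labelSetoid n (((Code.unite L x y).run ε σ).col L) =
      labelSetoid n (σ.col L) ⊔ pairSetoid u v := by
  refine labelling_relabel hlab fun w => ?_
  have := Code.run_unite (ε := ε) (σ := σ) (L := L)
    ⟨hL.2.1, hL.2.2.1, by have := hL.2.2.2; omega⟩ (x := x) (y := y)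
    (s := σ.nat L u 0) (t := σ.nat L v 0) (by rw [hx])
    (by rw [hy]) w
  rw [hσ.vertices] at this
  exact this

/-- The property `P` of the selected edge set is left open so that both processes can use the same
routine: in the first it says that all selected edges are tight, in the second that the stage is
reachable by transitions. The test only gives `cost ≤ load`; where equality is needed, the caller
supplies the other inequality. -/
theorem mergeTight_spec {L l M : ℕ} (hL : Free L) (hM : Free M) (hLM : L ≠ M)
    (hσ : Loaded I 𝒮 σ) {S₀ : Setoid (Fin n)} {P : Finset (Fin m) → Prop}
    (hlab : Labelling n (σ.col L))
    (hS : labelSetoid n (σ.col L) = I.merged S₀ (marked m σ M)) (hP : P (marked m σ M))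
    (hadd : ∀ F e, P F → ¬ I.merged S₀ F (I.ends e).1 (I.ends e).2 →
      I.cost e ≤ σ.real l e 0 → P (insert e F)) {τ : Memory}
    (hτ : τ = (Code.mergeTight L l M).run ε σ) :
    Labelling n (τ.col L) ∧ labelSetoid n (τ.col L) = I.merged S₀ (marked m τ M) ∧
    P (marked m τ M) ∧ ∀ e, I.cost e ≤ σ.real l e 0 →
      labelSetoid n (τ.col L) (I.ends e).1 (I.ends e).2 := by
  obtain ⟨hL4, hL15, hL16, hL20⟩ := hL
  obtain ⟨hM4, hM15, hM16, hM20⟩ := hM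
  have := Code.run_iter (ε := ε) (c := 21) (b := 1) (σ := σ)
    (p := .cond (.conj (.realLE (.entry 0 (idx 21)) (.entry l (idx 21)))
      (.neg (.natEq (entry L Code.eFst) (entry L Code.eSnd))))
      (.seq (Code.setEntry M (idx 21) (.const 1)) (Code.unite L Code.eFst Code.eSnd)) .skip)
    (fun i τ => Labelling n (τ.col L) ∧ labelSetoid n (τ.col L) = I.merged S₀ (marked m τ M) ∧
      P (marked m τ M) ∧ ∀ e : Fin m, (e : ℕ) < i → I.cost e ≤ σ.real l e 0 →
      τ.nat L (I.ends e).1 0 = τ.nat L (I.ends e).2 0) ?_ ?_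
  · rw [hσ.edges] at this
    rw [hτ]
    exact ⟨this.1, this.2.1, this.2.2.1, fun e => this.2.2.2 e e.2⟩
  · rw [col_congr (setNat_nat_of_ne (by omega : L ≠ 21)),
      marked_congr (setNat_nat_of_ne (by omega : M ≠ 21))]
    exact ⟨hlab, hS, hP, fun e he => absurd he (Nat.not_lt_zero _)⟩
  · intro i hi τ hc hn hr ⟨h1, h2, h3, h4⟩
    rw [hσ.edges] at hi
    obtain ⟨e, rfl⟩ : ∃ e : Fin m, (e : ℕ) = i := ⟨⟨i, hi⟩, rfl⟩
    have hload : Loaded I 𝒮 τ := by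
      refine hσ.congr (fun a ha => hn a ?_) (hr 0 (by simp [Code.unite]))
      simp [Code.unite]
      omega
    have hl : τ.real l = σ.real l := hr l (by simp [Code.unite])
    rw [col_congr (setNat_nat_of_ne (by omega : L ≠ 21)),
      marked_congr (setNat_nat_of_ne (by omega : M ≠ 21)),
      setNat_nat_of_ne (by omega : L ≠ 21)]
    simp only [Code.run_cond, Test.holds_conj, Test.holds_realLE, Test.holds_neg, Test.holds_natEq,
      RealExpr.eval_entry, NatExpr.eval_entry, NatExpr.eval_idx, Code.eFst, Code.eSnd,
      NatExpr.eval_get, NatExpr.eval_const, hc, hload.fst, hload.snd, hload.cost, hl]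
    split_ifs with hcond
    · simp only [Code.run_seq, Code.run_setEntry, NatExpr.eval_idx, NatExpr.eval_const, hc]
      set τ1 := τ.setNat M e 0 1 with hτ1
      have hload1 : Loaded I 𝒮 τ1 := hload.setNat hM4
      have hcol1 : τ1.col L = τ.col L := col_congr (setNat_nat_of_ne hLM)
      have hx : (NatExpr.get 1 (idx 21) (NatExpr.const 0)).eval τ1 = ((I.ends e).1 : ℕ) := by
        have : (21 : ℕ) ≠ M := by omega
        simp only [NatExpr.eval_get, NatExpr.eval_idx, NatExpr.eval_const, hτ1,
          setNat_nat_of_ne this, hc]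
        rw [← hτ1, hload1.fst]
      have hy : ∀ s, (NatExpr.get 1 (idx 21) (NatExpr.const 1)).eval (τ1.setNat 15 0 0 s) =
          ((I.ends e).2 : ℕ) := by
        intro s
        have : (21 : ℕ) ≠ M := by omega
        have hload2 : Loaded I 𝒮 (τ1.setNat 15 0 0 s) := hload1.setNat (by norm_num)
        simp only [NatExpr.eval_get, NatExpr.eval_idx, NatExpr.eval_const]
        rw [setNat_nat_of_ne (by norm_num : (21 : ℕ) ≠ 15), hτ1, setNat_nat_of_ne this, hc, ← hτ1,
          hload2.snd]
      obtain ⟨k1, k2⟩ := unite_spec (ε := ε) (σ := τ1) ⟨hL4, hL15, hL16, hL20⟩ hload1 hx hy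
        (by rw [hcol1]; exact h1)
      have hmark : marked m ((Code.unite L (NatExpr.get 1 (idx 21) (NatExpr.const 0))
          (NatExpr.get 1 (idx 21) (NatExpr.const 1))).run ε τ1) M =
          insert e (marked m τ M) := by
        rw [marked_congr (Code.run_nat_of_notMem ε _ τ1 (a := M) (by
          simp [Code.unite]; omega))]
        ext f
        simp only [mem_marked, Finset.mem_insert, hτ1, Memory.setNat_nat, true_and, and_true]
        by_cases hfe : f = e
        · simp [hfe]
        · have : (f : ℕ) ≠ e := fun h' => hfe (Fin.ext h')
          simp [hfe, this]
      have hmerged : labelSetoid n (((Code.unite L (NatExpr.get 1 (idx 21) (NatExpr.const 0))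
          (NatExpr.get 1 (idx 21) (NatExpr.const 1))).run ε τ1).col L) =
          I.merged S₀ (insert e (marked m τ M)) := by
        rw [k2, hcol1, h2, merged_insert]
      refine ⟨k1, ?_, ?_, ?_⟩
      · rw [hmark, hmerged]
      · rw [hmark]
        refine hadd _ e h3 ?_ hcond.1
        rw [← h2]
        exact hcond.2
      · intro f hf hcf
        change labelSetoid n (((Code.unite L (NatExpr.get 1 (idx 21) (NatExpr.const 0))
          (NatExpr.get 1 (idx 21) (NatExpr.const 1))).run ε τ1).col L) _ _
        rw [hmerged]
        rcases Nat.lt_succ_iff_lt_or_eq.1 hf with hf | hf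
        · have : labelSetoid n (τ.col L) _ _ := h4 f hf hcf
          rw [h2] at this
          exact I.merged_mono (Finset.subset_insert _ _) this
        · obtain rfl : f = e := Fin.ext hf
          exact I.merged_ends (Finset.mem_insert_self _ _)
    · refine ⟨h1, h2, h3, ?_⟩
      intro f hf hcf
      rcases Nat.lt_succ_iff_lt_or_eq.1 hf with hf | hf
      · exact h4 f hf hcf
      · obtain rfl : f = e := Fin.ext hf
        by_contra hne
        exact hcond ⟨hcf, hne⟩

/-- The flags in array `A` indicate the classes that contain a vertex with property `a`. -/
def Flags (n : ℕ) (σ : Memory) (L A : ℕ) (a : Fin n → Prop) : Prop :=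
  ∀ v : Fin n, σ.nat A (σ.nat L v 0) 0 = 1 ↔ ∃ w, a w ∧ labelSetoid n (σ.col L) w v

/-- An edge has two ends, so its rate is 0, 1 or 2 and a case distinction replaces arithmetic with
rates. -/
theorem run_onEdge {L A : ℕ} {p₁ p₂ : Code} (hσ : Loaded I 𝒮 σ) {a : Fin n → Prop}
    (hA : Flags n σ L A a) {e : Fin m} (he : σ.nat 21 0 0 = e) :
    (Code.onEdge L A p₁ p₂).run ε σ =
      if I.edgeRate (labelSetoid n (σ.col L)) a e = 0 then σ else
      if I.edgeRate (labelSetoid n (σ.col L)) a e = 1 then p₁.run ε σ else p₂.run ε σ := by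
  classical
  simp only [Code.onEdge, Code.eFst, Code.eSnd, Code.run_cond, Test.holds_natEq, NatExpr.eval_entry,
    NatExpr.eval_get, NatExpr.eval_idx, NatExpr.eval_const, he, hσ.fst, hσ.snd, hA _,
    Code.run_skip, SteinerForest.edgeRate]
  by_cases h0 : σ.nat L (I.ends e).1 0 = σ.nat L (I.ends e).2 0
  · have : labelSetoid n (σ.col L) (I.ends e).1 (I.ends e).2 := h0
    simp [h0, this]
  · have : ¬ labelSetoid n (σ.col L) (I.ends e).1 (I.ends e).2 := h0
    simp only [if_neg h0, if_neg this]
    by_cases h1 : ∃ w, a w ∧ labelSetoid n (σ.col L) w (I.ends e).1 <;>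
    by_cases h2 : ∃ w, a w ∧ labelSetoid n (σ.col L) w (I.ends e).2 <;>
    simp [h1, h2]

theorem growEdges_spec {L A l b : ℕ} (hl : l ≠ 0) (hlb : l ≠ b) (hL : L ≠ 21) (hA21 : A ≠ 21)
    (hσ : Loaded I 𝒮 σ) {a : Fin n → Prop} (hA : Flags n σ L A a) (e : Fin m) :
    ((Code.growEdges L A l b).run ε σ).real l e 0 =
      σ.real l e 0 + σ.real b 0 0 * I.edgeRate (labelSetoid n (σ.col L)) a e := by
  have := Code.run_iter (ε := ε) (c := 21) (b := 1) (σ := σ)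
    (p := Code.onEdge L A
    (Code.setRealEntry l (idx 21) (.add (.entry l (idx 21)) (.entry b (.const 0))))
    (Code.setRealEntry l (idx 21)
      (.add (.add (.entry l (idx 21)) (.entry b (.const 0))) (.entry b (.const 0)))))
    (fun i τ => ∀ e : Fin m, τ.real l e 0 = σ.real l e 0 + if (e : ℕ) < i then
      σ.real b 0 0 * (I.edgeRate (labelSetoid n (σ.col L)) a e : ℝ) else 0) ?_ ?_
  · rw [hσ.edges] at this
    have := this e
    rw [if_pos e.2] at this
    exact this
  · intro e
    simp
  · intro i hi τ hc hn hr hinv f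
    rw [hσ.edges] at hi
    obtain ⟨e, rfl⟩ : ∃ e : Fin m, (e : ℕ) = i := ⟨⟨i, hi⟩, rfl⟩
    have hwr : ∀ a, a ≠ 21 → τ.nat a = σ.nat a := fun a ha => hn a (by simp [Code.onEdge, ha])
    have hload : Loaded I 𝒮 τ :=
      hσ.congr (fun a ha => hwr a (by omega)) (hr 0 (by simp [Code.onEdge, hl.symm]))
    have hcol := col_congr (hwr L hL)
    have hA' : Flags n τ L A a := by
      intro v
      rw [hwr A hA21, hwr L hL, hcol]
      exact hA v
    have hb : τ.real b = σ.real b := hr b (by simp [Code.onEdge, hlb.symm])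
    have hinvf := hinv f
    have hinve := hinv e
    rw [if_neg (lt_irrefl _)] at hinve
    rw [run_onEdge hload hA' hc, hcol]
    have hle : I.edgeRate (labelSetoid n (σ.col L)) a e ≤ 2 := by
      rw [SteinerForest.edgeRate]
      split_ifs <;> simp
    by_cases hfe : f = e
    · subst hfe
      rw [if_pos (Nat.lt_succ_self _)]
      simp only [Memory.setNat_real]
      split_ifs with h0 h1
      · rw [h0, hinve]; simp
      · rw [h1]
        simp [hc, hinve, hb]
      · have h2 : I.edgeRate (labelSetoid n (σ.col L)) a f = 2 := by omega
        rw [h2]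
        simp [hc, hinve, hb]
        ring
    · have hne : (f : ℕ) ≠ e := fun h' => hfe (Fin.ext h')
      have : (f : ℕ) < e + 1 ↔ (f : ℕ) < e := by omega
      simp only [this, Memory.setNat_real]
      rw [← hinvf]
      split_ifs <;> simp [hc, hne]

/-- A flag together with a value represent the minimum of the reals with property `P`, if any. -/
def Least (f : ℕ) (x : ℝ) (P : ℝ → Prop) : Prop :=
  (f = 1 ∧ P x ∧ ∀ y, P y → x ≤ y) ∨ (f ≠ 1 ∧ ∀ y, ¬ P y)

theorem Least.congr {f : ℕ} {x : ℝ} {P Q : ℝ → Prop} (hP : Least f x P) (h : ∀ y, P y ↔ Q y) :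
    Least f x Q := by
  obtain rfl : P = Q := by
    funext y
    exact propext (h y)
  exact hP

/-- The flag in array `13` is written before `x` is read again, so `x` must not depend on it. -/
theorem minUpdate_spec {b : ℕ} {x : RealExpr}
    (hx : x.eval ε (σ.setNat 13 0 0 1) = x.eval ε σ) {P : ℝ → Prop}
    (hP : Least (σ.nat 13 0 0) (σ.real b 0 0) P) :
    Least (((Code.minUpdate b x).run ε σ).nat 13 0 0) (((Code.minUpdate b x).run ε σ).real b 0 0)
      (fun y => P y ∨ y = x.eval ε σ) := by
  simp only [Code.minUpdate, Code.run_cond, Test.holds_conj, Test.holds_natEq, Test.holds_realLE,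
    NatExpr.eval_idx, NatExpr.eval_const, RealExpr.eval_entry]
  split_ifs with hc
  · rcases hP with ⟨h1, h2, h3⟩ | ⟨h1, h2⟩
    · refine Or.inl ⟨h1, Or.inl h2, ?_⟩
      rintro y (hy | rfl)
      · exact h3 y hy
      · exact hc.2
    · exact absurd hc.1 h1
  · refine Or.inl ⟨by simp, Or.inr (by simp [hx]), ?_⟩
    intro y hy
    simp only [Code.run_seq, Code.run_setEntry, Code.run_setRealEntry, NatExpr.eval_const,
      Memory.setReal_real, and_self, if_true, hx]
    rcases hP with ⟨h1, h2, h3⟩ | ⟨h1, h2⟩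
    · rcases hy with hy | rfl
      · have : ¬ σ.real b 0 0 ≤ x.eval ε σ := fun h' => hc ⟨h1, h'⟩
        linarith [h3 y hy]
      · exact le_rfl
    · rcases hy with hy | rfl
      · exact absurd hy (h2 y)
      · exact le_rfl

/-- Division by the rate is free at rate 1 and a halving at rate 2. The initial property `P` allows
candidates from elsewhere, such as the time left. -/
theorem minEdges_spec {L A l b : ℕ} (hl : l ≠ b) (hb : b ≠ 0) (hL : L ≠ 13 ∧ L ≠ 21)
    (hA : A ≠ 13 ∧ A ≠ 21) (hσ : Loaded I 𝒮 σ) {a : Fin n → Prop} (hfl : Flags n σ L A a)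
    {P : ℝ → Prop} (hP : Least (σ.nat 13 0 0) (σ.real b 0 0) P) {τ : Memory}
    (hτ : τ = (Code.minEdges L A l b).run ε σ) :
    Least (τ.nat 13 0 0) (τ.real b 0 0) (fun y => P y ∨ ∃ e,
      I.edgeRate (labelSetoid n (σ.col L)) a e ≠ 0 ∧
      y = (I.cost e - σ.real l e 0) / (I.edgeRate (labelSetoid n (σ.col L)) a e : ℝ)) := by
  have := Code.run_iter (ε := ε) (c := 21) (b := 1) (σ := σ)
    (p := Code.onEdge L A
    (Code.minUpdate b (.sub (.entry 0 (idx 21)) (.entry l (idx 21))))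
    (Code.minUpdate b (.half (.sub (.entry 0 (idx 21)) (.entry l (idx 21))))))
    (fun i τ => Least (τ.nat 13 0 0) (τ.real b 0 0) (fun y => P y ∨ ∃ e : Fin m, (e : ℕ) < i ∧
      I.edgeRate (labelSetoid n (σ.col L)) a e ≠ 0 ∧
      y = (I.cost e - σ.real l e 0) / (I.edgeRate (labelSetoid n (σ.col L)) a e : ℝ))) ?_ ?_
  · rw [hσ.edges] at this
    rw [hτ]
    exact this.congr fun y => by simp
  · simpa using hP
  · intro i hi τ hc hn hr hinv
    rw [hσ.edges] at hi
    obtain ⟨e, rfl⟩ : ∃ e : Fin m, (e : ℕ) = i := ⟨⟨i, hi⟩, rfl⟩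
    have hwr : ∀ a, a ≠ 21 → a ≠ 13 → τ.nat a = σ.nat a := fun a h1 h2 =>
      hn a (by simp [Code.onEdge, Code.minUpdate, h1, h2])
    have hwr' : ∀ a, a ≠ b → τ.real a = σ.real a := fun a h1 =>
      hr a (by simp [Code.onEdge, Code.minUpdate, h1])
    have hload : Loaded I 𝒮 τ :=
      hσ.congr (fun a ha => hwr a (by omega) (by omega)) (hwr' 0 hb.symm)
    have hLn := hwr L hL.2 hL.1
    have hcol := col_congr hLn
    have hA' : Flags n τ L A a := by
      intro v
      rw [hwr A hA.2 hA.1, hLn, hcol]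
      exact hfl v
    rw [run_onEdge hload hA' hc, hcol]
    have hle : I.edgeRate (labelSetoid n (σ.col L)) a e ≤ 2 := by
      rw [SteinerForest.edgeRate]
      split_ifs <;> simp
    set r := I.edgeRate (labelSetoid n (σ.col L)) a e with hr'
    have hsucc : ∀ y : ℝ, (∃ f : Fin m, (f : ℕ) < e + 1 ∧
        I.edgeRate (labelSetoid n (σ.col L)) a f ≠ 0 ∧
        y = (I.cost f - σ.real l f 0) / (I.edgeRate (labelSetoid n (σ.col L)) a f : ℝ)) ↔
        (∃ f : Fin m, (f : ℕ) < e ∧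
        I.edgeRate (labelSetoid n (σ.col L)) a f ≠ 0 ∧
        y = (I.cost f - σ.real l f 0) / (I.edgeRate (labelSetoid n (σ.col L)) a f : ℝ)) ∨
        (r ≠ 0 ∧ y = (I.cost e - σ.real l e 0) / (r : ℝ)) := by
      intro y
      constructor
      · rintro ⟨f, hf, hf'⟩
        rcases Nat.lt_succ_iff_lt_or_eq.1 hf with hf | hf
        · exact Or.inl ⟨f, hf, hf'⟩
        · obtain rfl : f = e := Fin.ext hf
          exact Or.inr hf'
      · rintro (⟨f, hf, hf'⟩ | hf')
        · exact ⟨f, by omega, hf'⟩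
        · exact ⟨e, by omega, hf'⟩
    have hx : (RealExpr.sub (.entry 0 (idx 21)) (.entry l (idx 21))).eval ε τ =
        I.cost e - σ.real l e 0 := by
      simp only [RealExpr.eval_sub, RealExpr.eval_entry, NatExpr.eval_idx, hc, hload.cost,
        hwr' l hl]
    have h21 : ∀ τ : Memory, (τ.setNat 21 0 0 (e + 1)).nat 13 = τ.nat 13 := fun τ =>
      setNat_nat_of_ne (by norm_num)
    rw [h21, Memory.setNat_real]
    split_ifs with h0 h1
    · refine hinv.congr fun y => ?_
      rw [hsucc]
      simp [h0]
    · refine (minUpdate_spec (ε := ε) (by simp) hinv).congr fun y => ?_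
      rw [hsucc, hx, h1]
      simp [or_assoc]
    · have h2 : r = 2 := by omega
      refine (minUpdate_spec (ε := ε) (by simp) hinv).congr fun y => ?_
      rw [hsucc, RealExpr.eval_half, hx, h2]
      simp [or_assoc]

end Specs

end RAM

namespace RAM

open NatExpr (idx entry)

/-! ### Subroutines on vertices: activity and budgets. -/

namespace Code

/-- Set the first `n` entries of a natural array to `0`. -/
def clear (a : ℕ) : Code := .iter 22 0 (setEntry a (idx 22) (.const 0))

/-- Set the first `n` entries of a real array to `0`. -/
def clearReal (a : ℕ) : Code := .iter 22 0 (setRealEntry a (idx 22) .zero)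

/-- Flag the labels of the classes that separate a demand pair. -/
def demandFlags : Code :=
  .seq (clear 10) (.iter 22 2 (.cond
    (.natEq (entry 5 (.get 2 (idx 22) (.const 0))) (entry 5 (.get 2 (idx 22) (.const 1)))) .skip
    (.seq (setEntry 10 (entry 5 (.get 2 (idx 22) (.const 0))) (.const 1))
      (setEntry 10 (entry 5 (.get 2 (idx 22) (.const 1))) (.const 1)))))

/-- Sum up the vertex weights of every class. -/
def budgetTotals : Code :=
  .seq (clearReal 4) (.iter 22 0 (setRealEntry 4 (entry 5 (idx 22))
    (.add (.entry 4 (entry 5 (idx 22))) (.entry 3 (idx 22)))))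

/-- Flag the labels of active classes. -/
def activeFlags : Code :=
  .iter 22 0 (.cond (.conj (.neg (.natEq (entry 10 (idx 22)) (.const 1)))
      (.realLE (.entry 4 (idx 22)) .zero))
    (setEntry 11 (idx 22) (.const 0)) (setEntry 11 (idx 22) (.const 1)))

/-- Flag the labels of the coarser classes that contain an active class. -/
def projectFlags : Code :=
  .seq (clear 12) (.iter 22 0 (.cond (.natEq (entry 11 (entry 5 (idx 22))) (.const 1))
    (setEntry 12 (entry 6 (idx 22)) (.const 1)) .skip))

/-- Take the delays until budgets are used up into account. -/
def minBudgets : Code :=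
  .iter 22 0 (.cond (.conj (.neg (.natEq (entry 10 (entry 5 (idx 22))) (.const 1)))
      (.neg (.realLE (.entry 4 (entry 5 (idx 22))) .zero)))
    (minUpdate 5 (.entry 4 (entry 5 (idx 22)))) .skip)

/-- Change the weights of representatives according to the growth of budgets. -/
def growBudgets : Code :=
  .iter 22 0 (.cond (.natEq (entry 5 (idx 22)) (idx 22))
    (.cond (.natEq (entry 10 (idx 22)) (.const 1))
      (setRealEntry 3 (idx 22) (.add (.entry 3 (idx 22)) (.scale (.entry 5 (.const 0)))))
      (.cond (.realLE (.entry 4 (idx 22)) .zero) .skip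
        (setRealEntry 3 (idx 22) (.sub (.entry 3 (idx 22)) (.entry 5 (.const 0)))))) .skip)

end Code

section Specs

variable {n m h k : ℕ} {I : SteinerForest (Fin n) (Fin m) (Fin h)} {𝒮 : Fin k → Finset (Fin n)}
  {σ : Memory} {ε : ℝ}

theorem clear_spec {a : ℕ} (ha : a ≠ 22) (hσ : Loaded I 𝒮 σ) {x : ℕ} (hx : x < n) :
    ((Code.clear a).run ε σ).nat a x 0 = 0 := by
  have := Code.run_iter (ε := ε) (c := 22) (b := 0) (σ := σ)
    (p := Code.setEntry a (idx 22) (.const 0)) (fun i τ => ∀ x < i, τ.nat a x 0 = 0) ?_ ?_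
  · rw [hσ.vertices] at this
    exact this x hx
  · intro x hx
    omega
  · intro i hi τ hc hn hr hinv x hx
    rcases Nat.lt_succ_iff_lt_or_eq.1 hx with hx | rfl
    · simp [ha, hinv x hx]
    · simp [ha, hc]

theorem clearReal_spec {a : ℕ} (hσ : Loaded I 𝒮 σ) {x : ℕ} (hx : x < n) :
    ((Code.clearReal a).run ε σ).real a x 0 = 0 := by
  have := Code.run_iter (ε := ε) (c := 22) (b := 0) (σ := σ)
    (p := Code.setRealEntry a (idx 22) .zero) (fun i τ => ∀ x < i, τ.real a x 0 = 0) ?_ ?_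
  · rw [hσ.vertices] at this
    exact this x hx
  · intro x hx
    omega
  · intro i hi τ hc hn hr hinv x hx
    rcases Nat.lt_succ_iff_lt_or_eq.1 hx with hx | rfl
    · simp [hinv x hx]
    · simp [hc]

theorem demandFlags_spec (hσ : Loaded I 𝒮 σ) {x : ℕ} (hx : x < n) :
    (Code.demandFlags.run ε σ).nat 10 x 0 = 1 ↔ ∃ d : Fin h,
      σ.nat 5 (I.demand d).1 0 ≠ σ.nat 5 (I.demand d).2 0 ∧
      (σ.nat 5 (I.demand d).1 0 = x ∨ σ.nat 5 (I.demand d).2 0 = x) := by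
  set τ0 := (Code.clear 10).run ε σ with hτ0
  have h5 : τ0.nat 5 = σ.nat 5 := Code.run_nat_of_notMem _ _ _ (by simp [Code.clear])
  have hl0 : Loaded I 𝒮 τ0 := hσ.run (by intro a ha; simp [Code.clear]; omega) (by simp [Code.clear])
  have := Code.run_iter (ε := ε) (c := 22) (b := 2) (σ := τ0)
    (p := .cond
      (.natEq (entry 5 (.get 2 (idx 22) (.const 0))) (entry 5 (.get 2 (idx 22) (.const 1)))) .skip
      (.seq (Code.setEntry 10 (entry 5 (.get 2 (idx 22) (.const 0))) (.const 1))
      (Code.setEntry 10 (entry 5 (.get 2 (idx 22) (.const 1))) (.const 1))))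
    (fun i τ => τ.nat 10 x 0 = 1 ↔ ∃ d : Fin h, (d : ℕ) < i ∧
      σ.nat 5 (I.demand d).1 0 ≠ σ.nat 5 (I.demand d).2 0 ∧
      (σ.nat 5 (I.demand d).1 0 = x ∨ σ.nat 5 (I.demand d).2 0 = x)) ?_ ?_
  · rw [hl0.demands] at this
    refine this.trans ?_
    simp
  · simp [hτ0, clear_spec (ε := ε) (by norm_num : (10 : ℕ) ≠ 22) hσ hx]
  · intro i hi τ hc hn hr hinv
    rw [hl0.demands] at hi
    obtain ⟨d, rfl⟩ : ∃ d : Fin h, (d : ℕ) = i := ⟨⟨i, hi⟩, rfl⟩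
    have hload : Loaded I 𝒮 τ := hl0.congr (fun a ha => hn a (by simp; omega)) (hr 0 (by simp))
    have h5' : τ.nat 5 = σ.nat 5 := (hn 5 (by simp)).trans h5
    have hsplit : (∃ f : Fin h, (f : ℕ) < d + 1 ∧
      σ.nat 5 (I.demand f).1 0 ≠ σ.nat 5 (I.demand f).2 0 ∧
      (σ.nat 5 (I.demand f).1 0 = x ∨ σ.nat 5 (I.demand f).2 0 = x)) ↔
      (τ.nat 10 x 0 = 1 ∨ (σ.nat 5 (I.demand d).1 0 ≠ σ.nat 5 (I.demand d).2 0 ∧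
      (σ.nat 5 (I.demand d).1 0 = x ∨ σ.nat 5 (I.demand d).2 0 = x))) := by
      rw [hinv]
      constructor
      · rintro ⟨f, hf, hf'⟩
        rcases Nat.lt_succ_iff_lt_or_eq.1 hf with hf | hf
        · exact Or.inl ⟨f, hf, hf'⟩
        · obtain rfl : f = d := Fin.ext hf
          exact Or.inr hf'
      · rintro (⟨f, hf, hf'⟩ | hf')
        · exact ⟨f, by omega, hf'⟩
        · exact ⟨d, by omega, hf'⟩
    rw [hsplit]
    simp only [Code.run_cond, Test.holds_natEq, NatExpr.eval_entry, NatExpr.eval_get,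
      NatExpr.eval_idx, NatExpr.eval_const, hc, hload.demand_fst, hload.demand_snd, h5',
      Code.run_skip]
    split_ifs with hcond
    · simp [hcond]
    · have hne : (I.demand d).1 ≠ (I.demand d).2 := fun h' => hcond (by rw [h'])
      simp only [Code.run_seq, Code.run_setEntry, NatExpr.eval_entry, NatExpr.eval_get,
        NatExpr.eval_idx, NatExpr.eval_const, hc, hload.demand_fst, h5', Memory.setNat_nat]
      simp [hload.demand_snd, hcond, eq_comm (a := x)]
      tauto

theorem budgetTotals_spec (hσ : Loaded I 𝒮 σ) {x : ℕ} (hx : x < n) :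
    (Code.budgetTotals.run ε σ).real 4 x 0 =
      ∑ w ∈ Finset.univ.filter (fun w : Fin n => σ.nat 5 w 0 = x), σ.real 3 w 0 := by
  set τ0 := (Code.clearReal 4).run ε σ with hτ0
  have h5 : τ0.nat 5 = σ.nat 5 := Code.run_nat_of_notMem _ _ _ (by simp [Code.clearReal])
  have h3 : τ0.real 3 = σ.real 3 := Code.run_real_of_notMem _ _ _ (by simp [Code.clearReal])
  have hl0 : Loaded I 𝒮 τ0 :=
    hσ.run (by intro a ha; simp [Code.clearReal]; omega) (by simp [Code.clearReal])
  have := Code.run_iter (ε := ε) (c := 22) (b := 0) (σ := τ0)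
    (p := Code.setRealEntry 4 (entry 5 (idx 22))
      (.add (.entry 4 (entry 5 (idx 22))) (.entry 3 (idx 22))))
    (fun i τ => τ.real 4 x 0 =
      ∑ w ∈ Finset.univ.filter (fun w : Fin n => σ.nat 5 w 0 = x ∧ (w : ℕ) < i), σ.real 3 w 0) ?_ ?_
  · rw [hl0.vertices] at this
    refine this.trans ?_
    simp
  · simp [hτ0, clearReal_spec (ε := ε) hσ hx]
  · intro i hi τ hc hn hr hinv
    rw [hl0.vertices] at hi
    obtain ⟨v, rfl⟩ : ∃ v : Fin n, (v : ℕ) = i := ⟨⟨i, hi⟩, rfl⟩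
    have h5' : τ.nat 5 = σ.nat 5 := (hn 5 (by simp)).trans h5
    have h3' : τ.real 3 = σ.real 3 := (hr 3 (by simp)).trans h3
    simp only [Code.run_setRealEntry, Memory.setNat_real, Memory.setReal_real, NatExpr.eval_entry,
      NatExpr.eval_idx, RealExpr.eval_add, RealExpr.eval_entry, hc, h5', h3', true_and, and_true]
    have hs : (Finset.univ.filter fun w : Fin n => σ.nat 5 w 0 = x ∧ (w : ℕ) < v + 1) =
        if σ.nat 5 v 0 = x then
          insert v (Finset.univ.filter fun w : Fin n => σ.nat 5 w 0 = x ∧ (w : ℕ) < v)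
        else Finset.univ.filter fun w : Fin n => σ.nat 5 w 0 = x ∧ (w : ℕ) < v := by
      ext w
      have hiff : (w : ℕ) < v + 1 ↔ (w = v ∨ (w : ℕ) < v) := by
        rw [Fin.ext_iff]; omega
      split_ifs with hv
      · simp only [Finset.mem_filter, Finset.mem_univ, true_and, Finset.mem_insert, hiff]
        constructor
        · tauto
        · rintro (rfl | h')
          · exact ⟨hv, Or.inl rfl⟩
          · tauto
      · simp only [Finset.mem_filter, Finset.mem_univ, true_and, hiff]
        constructor
        · rintro ⟨h1, rfl | h2⟩
          · exact absurd h1 hv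
          · exact ⟨h1, h2⟩
        · tauto
    rw [hs]
    split_ifs with h1 h2 h2
    · rw [Finset.sum_insert (by simp), ← hinv, h1, add_comm]
    · exact absurd h1.symm h2
    · exact absurd h2.symm h1
    · exact hinv

theorem activeFlags_spec (hσ : Loaded I 𝒮 σ) {x : ℕ} (hx : x < n) :
    (Code.activeFlags.run ε σ).nat 11 x 0 = 1 ↔ (σ.nat 10 x 0 = 1 ∨ 0 < σ.real 4 x 0) := by
  have := Code.run_iter (ε := ε) (c := 22) (b := 0) (σ := σ)
    (p := .cond (.conj (.neg (.natEq (entry 10 (idx 22)) (.const 1)))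
      (.realLE (.entry 4 (idx 22)) .zero))
    (Code.setEntry 11 (idx 22) (.const 0)) (Code.setEntry 11 (idx 22) (.const 1)))
    (fun i τ => ∀ x < i, τ.nat 11 x 0 = 1 ↔ (σ.nat 10 x 0 = 1 ∨ 0 < σ.real 4 x 0)) ?_ ?_
  · rw [hσ.vertices] at this
    exact this x hx
  · intro x hx
    omega
  · intro i hi τ hc hn hr hinv x hx
    have h10 : τ.nat 10 = σ.nat 10 := hn 10 (by simp)
    have h4 : τ.real 4 = σ.real 4 := hr 4 (by simp)
    simp only [Code.run_cond, Test.holds_conj, Test.holds_neg, Test.holds_natEq, Test.holds_realLE,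
      NatExpr.eval_entry, NatExpr.eval_idx, NatExpr.eval_const, RealExpr.eval_entry,
      RealExpr.eval_zero, hc, h10, h4]
    rcases Nat.lt_succ_iff_lt_or_eq.1 hx with hx | rfl
    · have : x ≠ i := by omega
      split_ifs <;> simp [hc, hinv x hx, this]
    · split_ifs with hcond
      · simp [hc, hcond.1, hcond.2]
      · have : σ.nat 10 x 0 = 1 ∨ 0 < σ.real 4 x 0 := by
          by_contra! h'
          exact hcond ⟨h'.1, h'.2⟩
        simp [hc, this]

theorem projectFlags_spec (hσ : Loaded I 𝒮 σ) {x : ℕ} (hx : x < n) :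
    (Code.projectFlags.run ε σ).nat 12 x 0 = 1 ↔
      ∃ w : Fin n, σ.nat 11 (σ.nat 5 w 0) 0 = 1 ∧ σ.nat 6 w 0 = x := by
  set τ0 := (Code.clear 12).run ε σ with hτ0
  have h5 : τ0.nat 5 = σ.nat 5 := Code.run_nat_of_notMem _ _ _ (by simp [Code.clear])
  have h6 : τ0.nat 6 = σ.nat 6 := Code.run_nat_of_notMem _ _ _ (by simp [Code.clear])
  have h11 : τ0.nat 11 = σ.nat 11 := Code.run_nat_of_notMem _ _ _ (by simp [Code.clear])
  have hl0 : Loaded I 𝒮 τ0 := hσ.run (by intro a ha; simp [Code.clear]; omega) (by simp [Code.clear])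
  have := Code.run_iter (ε := ε) (c := 22) (b := 0) (σ := τ0)
    (p := .cond (.natEq (entry 11 (entry 5 (idx 22))) (.const 1))
      (Code.setEntry 12 (entry 6 (idx 22)) (.const 1)) .skip)
    (fun i τ => τ.nat 12 x 0 = 1 ↔ ∃ w : Fin n, (w : ℕ) < i ∧
      σ.nat 11 (σ.nat 5 w 0) 0 = 1 ∧ σ.nat 6 w 0 = x) ?_ ?_
  · rw [hl0.vertices] at this
    refine this.trans ?_
    simp
  · simp [hτ0, clear_spec (ε := ε) (by norm_num : (12 : ℕ) ≠ 22) hσ hx]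
  · intro i hi τ hc hn hr hinv
    rw [hl0.vertices] at hi
    obtain ⟨v, rfl⟩ : ∃ v : Fin n, (v : ℕ) = i := ⟨⟨i, hi⟩, rfl⟩
    have h5' : τ.nat 5 = σ.nat 5 := (hn 5 (by simp)).trans h5
    have h6' : τ.nat 6 = σ.nat 6 := (hn 6 (by simp)).trans h6
    have h11' : τ.nat 11 = σ.nat 11 := (hn 11 (by simp)).trans h11
    have hsplit : (∃ w : Fin n, (w : ℕ) < v + 1 ∧
        σ.nat 11 (σ.nat 5 w 0) 0 = 1 ∧ σ.nat 6 w 0 = x) ↔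
        (τ.nat 12 x 0 = 1 ∨ (σ.nat 11 (σ.nat 5 v 0) 0 = 1 ∧ σ.nat 6 v 0 = x)) := by
      rw [hinv]
      constructor
      · rintro ⟨f, hf, hf'⟩
        rcases Nat.lt_succ_iff_lt_or_eq.1 hf with hf | hf
        · exact Or.inl ⟨f, hf, hf'⟩
        · obtain rfl : f = v := Fin.ext hf
          exact Or.inr hf'
      · rintro (⟨f, hf, hf'⟩ | hf')
        · exact ⟨f, by omega, hf'⟩
        · exact ⟨v, by omega, hf'⟩
    rw [hsplit]
    simp only [Code.run_cond, Test.holds_natEq, NatExpr.eval_entry,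
      NatExpr.eval_idx, NatExpr.eval_const, hc, h5', h11', Code.run_skip]
    split_ifs with hcond
    · simp [hc, hcond, h6', eq_comm (a := x)]
      tauto
    · simp [hcond]

theorem minBudgets_spec (hσ : Loaded I 𝒮 σ) {P : ℝ → Prop}
    (hP : Least (σ.nat 13 0 0) (σ.real 5 0 0) P) {τ : Memory} (hτ : τ = Code.minBudgets.run ε σ) :
    Least (τ.nat 13 0 0) (τ.real 5 0 0) (fun y => P y ∨ ∃ v : Fin n,
      σ.nat 10 (σ.nat 5 v 0) 0 ≠ 1 ∧ 0 < σ.real 4 (σ.nat 5 v 0) 0 ∧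
      y = σ.real 4 (σ.nat 5 v 0) 0) := by
  have := Code.run_iter (ε := ε) (c := 22) (b := 0) (σ := σ)
    (p := .cond (.conj (.neg (.natEq (entry 10 (entry 5 (idx 22))) (.const 1)))
      (.neg (.realLE (.entry 4 (entry 5 (idx 22))) .zero)))
    (Code.minUpdate 5 (.entry 4 (entry 5 (idx 22)))) .skip)
    (fun i τ => Least (τ.nat 13 0 0) (τ.real 5 0 0) (fun y => P y ∨ ∃ v : Fin n, (v : ℕ) < i ∧
      σ.nat 10 (σ.nat 5 v 0) 0 ≠ 1 ∧ 0 < σ.real 4 (σ.nat 5 v 0) 0 ∧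
      y = σ.real 4 (σ.nat 5 v 0) 0)) ?_ ?_
  · rw [hσ.vertices] at this
    rw [hτ]
    exact this.congr fun y => by simp
  · simpa using hP
  · intro i hi τ hc hn hr hinv
    rw [hσ.vertices] at hi
    obtain ⟨v, rfl⟩ : ∃ v : Fin n, (v : ℕ) = i := ⟨⟨i, hi⟩, rfl⟩
    have h5 : τ.nat 5 = σ.nat 5 := hn 5 (by simp [Code.minUpdate])
    have h10 : τ.nat 10 = σ.nat 10 := hn 10 (by simp [Code.minUpdate])
    have h4 : τ.real 4 = σ.real 4 := hr 4 (by simp [Code.minUpdate])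
    have hsplit : ∀ y : ℝ, (∃ w : Fin n, (w : ℕ) < v + 1 ∧
      σ.nat 10 (σ.nat 5 w 0) 0 ≠ 1 ∧ 0 < σ.real 4 (σ.nat 5 w 0) 0 ∧
      y = σ.real 4 (σ.nat 5 w 0) 0) ↔ ((∃ w : Fin n, (w : ℕ) < v ∧
      σ.nat 10 (σ.nat 5 w 0) 0 ≠ 1 ∧ 0 < σ.real 4 (σ.nat 5 w 0) 0 ∧
      y = σ.real 4 (σ.nat 5 w 0) 0) ∨ (σ.nat 10 (σ.nat 5 v 0) 0 ≠ 1 ∧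
      0 < σ.real 4 (σ.nat 5 v 0) 0 ∧ y = σ.real 4 (σ.nat 5 v 0) 0)) := by
      intro y
      constructor
      · rintro ⟨f, hf, hf'⟩
        rcases Nat.lt_succ_iff_lt_or_eq.1 hf with hf | hf
        · exact Or.inl ⟨f, hf, hf'⟩
        · obtain rfl : f = v := Fin.ext hf
          exact Or.inr hf'
      · rintro (⟨f, hf, hf'⟩ | hf')
        · exact ⟨f, by omega, hf'⟩
        · exact ⟨v, by omega, hf'⟩
    have h22 : ∀ τ : Memory, (τ.setNat 22 0 0 (v + 1)).nat 13 = τ.nat 13 := fun τ =>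
      setNat_nat_of_ne (by norm_num)
    have hx : (RealExpr.entry 4 (entry 5 (idx 22))).eval ε τ = σ.real 4 (σ.nat 5 v 0) 0 := by
      simp [hc, h5, h4]
    rw [h22, Memory.setNat_real]
    simp only [Code.run_cond, Test.holds_conj, Test.holds_neg, Test.holds_natEq, Test.holds_realLE,
      NatExpr.eval_entry, NatExpr.eval_idx, NatExpr.eval_const, RealExpr.eval_entry,
      RealExpr.eval_zero, hc, h10, h4, h5, Code.run_skip, not_le]
    split_ifs with hcond
    · refine (minUpdate_spec (ε := ε) (by simp) hinv).congr fun y => ?_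
      rw [hsplit, hx]
      simp [hcond, or_assoc]
    · refine hinv.congr fun y => ?_
      rw [hsplit]
      have : ¬ (σ.nat 10 (σ.nat 5 v 0) 0 ≠ 1 ∧
        0 < σ.real 4 (σ.nat 5 v 0) 0 ∧ y = σ.real 4 (σ.nat 5 v 0) 0) := by tauto
      simp only [this, or_false]

/-- Only the vertex carrying its own label is changed, so the weight of each component changes by
exactly one increment. -/
theorem growBudgets_spec (hσ : Loaded I 𝒮 σ) (v : Fin n) :
    (Code.growBudgets.run ε σ).real 3 v 0 = σ.real 3 v 0 +
      if σ.nat 5 v 0 = v then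
        if σ.nat 10 v 0 = 1 then ε * σ.real 5 0 0 else
        if σ.real 4 v 0 ≤ 0 then 0 else - σ.real 5 0 0
      else 0 := by
  have := Code.run_iter (ε := ε) (c := 22) (b := 0) (σ := σ)
    (p := .cond (.natEq (entry 5 (idx 22)) (idx 22))
    (.cond (.natEq (entry 10 (idx 22)) (.const 1))
      (Code.setRealEntry 3 (idx 22) (.add (.entry 3 (idx 22)) (.scale (.entry 5 (.const 0)))))
      (.cond (.realLE (.entry 4 (idx 22)) .zero) .skip
        (Code.setRealEntry 3 (idx 22) (.sub (.entry 3 (idx 22)) (.entry 5 (.const 0)))))) .skip)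
    (fun i τ => ∀ v : Fin n, τ.real 3 v 0 = σ.real 3 v 0 + if (v : ℕ) < i then
      (if σ.nat 5 v 0 = v then
        if σ.nat 10 v 0 = 1 then ε * σ.real 5 0 0 else
        if σ.real 4 v 0 ≤ 0 then 0 else - σ.real 5 0 0
      else 0) else 0) ?_ ?_
  · rw [hσ.vertices] at this
    have := this v
    rw [if_pos v.2] at this
    exact this
  · intro v
    simp
  · intro i hi τ hc hn hr hinv v
    rw [hσ.vertices] at hi
    obtain ⟨u, rfl⟩ : ∃ u : Fin n, (u : ℕ) = i := ⟨⟨i, hi⟩, rfl⟩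
    have h5 : τ.nat 5 = σ.nat 5 := hn 5 (by simp)
    have h10 : τ.nat 10 = σ.nat 10 := hn 10 (by simp)
    have h4 : τ.real 4 = σ.real 4 := hr 4 (by simp)
    have h5r : τ.real 5 = σ.real 5 := hr 5 (by simp)
    have hv := hinv v
    simp only [Code.run_cond, Test.holds_natEq, Test.holds_realLE,
      NatExpr.eval_entry, NatExpr.eval_idx, NatExpr.eval_const, RealExpr.eval_entry,
      RealExpr.eval_zero, hc, h10, h4, h5, Code.run_skip, Memory.setNat_real]
    by_cases hvu : v = u
    · subst hvu
      rw [if_neg (lt_irrefl _), add_zero] at hv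
      rw [if_pos (Nat.lt_succ_self _)]
      split_ifs <;> simp [hc, hv, h5r, sub_eq_add_neg]
    · have hne : (v : ℕ) ≠ u := fun h' => hvu (Fin.ext h')
      have : (v : ℕ) < u + 1 ↔ (v : ℕ) < u := by omega
      simp only [this]
      rw [← hv]
      split_ifs <;> simp [hc, hne]

end Specs

end RAM

namespace RAM

open NatExpr (idx entry)

/-! ### Simulating one event of the extended algorithm. -/

namespace Code

/-- Determine activity and the delay until the next event. -/
def measure : Code :=
  .seq demandFlags (.seq budgetTotals (.seq activeFlags
    (.seq (setEntry 13 (.const 0) (.const 0)) (.seq (minEdges 5 11 1 5) minBudgets))))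

/-- Let time pass until the next event and merge components. -/
def advance : Code := .seq (growEdges 5 11 1 5) (.seq growBudgets (mergeTight 5 1 8))

end Code

section Specs

variable {n m h k : ℕ} (I : SteinerForest (Fin n) (Fin m) (Fin h)) (𝒮 : Fin k → Finset (Fin n))

/-- The memory represents a state of the moat growing algorithm. -/
structure RepRun (σ : Memory) (s : SteinerForest.State (Fin n)) : Prop where
  loaded : Loaded I 𝒮 σ
  labelling : Labelling n (σ.col 5)
  joined : labelSetoid n (σ.col 5) = I.joined s
  load : ∀ e : Fin m, σ.real 1 e 0 = I.load s.dual e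
  budget : ∀ v : Fin n, ∑ w ∈ I.component (I.tight s.dual) v, σ.real 3 w 0 =
    s.budget (I.component (I.tight s.dual) v)
  merged_marked : I.merged ⊥ (marked m σ 8) = I.joined s
  tight_marked : ∀ e ∈ marked m σ 8, I.load s.dual e = I.cost e

/-- The memory holds the activity of the components of a state. -/
structure RepActive (σ : Memory) (s : SteinerForest.State (Fin n)) : Prop where
  flags : Flags n σ 5 11 (I.Awake s)
  demand : ∀ v : Fin n, σ.nat 10 (σ.nat 5 v 0) 0 = 1 ↔
    I.DemandActive (I.component (I.tight s.dual) v)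
  budget : ∀ v : Fin n, σ.real 4 (σ.nat 5 v 0) 0 = s.budget (I.component (I.tight s.dual) v)

variable {I 𝒮} {σ τ : Memory} {ε : ℝ} {s : SteinerForest.State (Fin n)}

theorem RepRun.congr (hσ : RepRun I 𝒮 σ s) (hl : Loaded I 𝒮 τ) (h5 : τ.nat 5 = σ.nat 5)
    (h8 : τ.nat 8 = σ.nat 8) (h1 : τ.real 1 = σ.real 1) (h3 : τ.real 3 = σ.real 3) :
    RepRun I 𝒮 τ s where
  loaded := hl
  labelling := by rw [col_congr h5]; exact hσ.labelling
  joined := by rw [col_congr h5]; exact hσ.joined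
  load := by rw [h1]; exact hσ.load
  budget := by rw [h3]; exact hσ.budget
  merged_marked := by rw [marked_congr h8]; exact hσ.merged_marked
  tight_marked := by rw [marked_congr h8]; exact hσ.tight_marked

theorem RepActive.congr (hσ : RepActive I σ s) (h5 : τ.nat 5 = σ.nat 5)
    (h10 : τ.nat 10 = σ.nat 10) (h11 : τ.nat 11 = σ.nat 11) (h4 : τ.real 4 = σ.real 4) :
    RepActive I τ s where
  flags := by
    intro v
    rw [h5, h11, col_congr h5]
    exact hσ.flags v
  demand := by rw [h5, h10]; exact hσ.demand
  budget := by rw [h5, h4]; exact hσ.budget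

theorem RepRun.mem_component (hσ : RepRun I 𝒮 σ s) {u v : Fin n} :
    u ∈ I.component (I.tight s.dual) v ↔ σ.nat 5 u 0 = σ.nat 5 v 0 := by
  rw [I.mem_component]
  change I.joined s v u ↔ _
  rw [← hσ.joined, labelSetoid_iff]
  exact eq_comm

theorem RepRun.demandActive (hσ : RepRun I 𝒮 σ s) (v : Fin n) :
    I.DemandActive (I.component (I.tight s.dual) v) ↔ ∃ d : Fin h,
      σ.nat 5 (I.demand d).1 0 ≠ σ.nat 5 (I.demand d).2 0 ∧
      (σ.nat 5 (I.demand d).1 0 = σ.nat 5 v 0 ∨ σ.nat 5 (I.demand d).2 0 = σ.nat 5 v 0) := by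
  refine exists_congr fun d => ?_
  rw [SteinerForest.Separates, hσ.mem_component, hσ.mem_component]
  constructor
  · rintro (⟨h1, h2⟩ | ⟨h1, h2⟩)
    · exact ⟨fun h' => h2 (h' ▸ h1), Or.inl h1⟩
    · exact ⟨fun h' => h2 (h' ▸ h1), Or.inr h1⟩
  · rintro ⟨h0, h1 | h1⟩
    · exact Or.inl ⟨h1, fun h2 => h0 (h1.trans h2.symm)⟩
    · exact Or.inr ⟨h1, fun h2 => h0 (h2.trans h1.symm)⟩

theorem awake_iff {v : Fin n} : I.Awake s v ↔
    (I.DemandActive (I.component (I.tight s.dual) v) ∨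
      0 < s.budget (I.component (I.tight s.dual) v)) := by
  rw [SteinerForest.Awake, I.mem_active]
  exact and_iff_right I.component_mem

theorem measure_spec (hσ : RepRun I 𝒮 σ s) (hτ : τ = Code.measure.run ε σ) :
    RepActive I τ s ∧ Least (τ.nat 13 0 0) (τ.real 5 0 0) (fun x => x ∈ I.eventDelays s) := by
  set τ1 := Code.demandFlags.run ε σ with hτ1
  set τ2 := Code.budgetTotals.run ε τ1 with hτ2
  set τ3 := Code.activeFlags.run ε τ2 with hτ3
  set τ4 := τ3.setNat 13 0 0 0 with hτ4
  set τ5 := (Code.minEdges 5 11 1 5).run ε τ4 with hτ5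
  have hτ' : τ = Code.minBudgets.run ε τ5 := hτ
  have hr1 : RepRun I 𝒮 τ1 s := by
    refine hσ.congr (hσ.loaded.run (fun a ha => ?_) ?_) ?_ ?_ ?_ ?_
    · simp [Code.demandFlags, Code.clear]; omega
    · simp [Code.demandFlags, Code.clear]
    all_goals
      first
        | exact Code.run_nat_of_notMem _ _ _ (by simp [Code.demandFlags, Code.clear])
        | exact Code.run_real_of_notMem _ _ _ (by simp [Code.demandFlags, Code.clear])
  have hr2 : RepRun I 𝒮 τ2 s := by
    refine hr1.congr (hr1.loaded.run (fun a ha => ?_) ?_) ?_ ?_ ?_ ?_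
    · simp [Code.budgetTotals, Code.clearReal]; omega
    · simp [Code.budgetTotals, Code.clearReal]
    all_goals
      first
        | exact Code.run_nat_of_notMem _ _ _ (by simp [Code.budgetTotals, Code.clearReal])
        | exact Code.run_real_of_notMem _ _ _ (by simp [Code.budgetTotals, Code.clearReal])
  have hr4 : RepRun I 𝒮 τ4 s := by
    have hr3 : RepRun I 𝒮 τ3 s := by
      refine hr2.congr (hr2.loaded.run (fun a ha => ?_) ?_) ?_ ?_ ?_ ?_
      · simp [Code.activeFlags]; omega
      · simp [Code.activeFlags]
      all_goals
        first
          | exact Code.run_nat_of_notMem _ _ _ (by simp [Code.activeFlags])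
          | exact Code.run_real_of_notMem _ _ _ (by simp [Code.activeFlags])
    exact hr3.congr (hr3.loaded.setNat (by norm_num)) (setNat_nat_of_ne (by norm_num))
      (setNat_nat_of_ne (by norm_num)) rfl rfl
  have hr5 : RepRun I 𝒮 τ5 s := by
    refine hr4.congr (hr4.loaded.run (fun a ha => ?_) ?_) ?_ ?_ ?_ ?_
    · simp [Code.minEdges, Code.onEdge, Code.minUpdate]; omega
    · simp [Code.minEdges, Code.onEdge, Code.minUpdate]
    all_goals
      first
        | exact Code.run_nat_of_notMem _ _ _ (by
            simp [Code.minEdges, Code.onEdge, Code.minUpdate])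
        | exact Code.run_real_of_notMem _ _ _ (by
            simp [Code.minEdges, Code.onEdge, Code.minUpdate])
  have f1 : τ1.nat 5 = σ.nat 5 := Code.run_nat_of_notMem _ _ _ (by
    simp [Code.demandFlags, Code.clear])
  have f2 : τ2.nat 5 = τ1.nat 5 := Code.run_nat_of_notMem _ _ _ (by
    simp [Code.budgetTotals, Code.clearReal])
  have f2' : τ2.nat 10 = τ1.nat 10 := Code.run_nat_of_notMem _ _ _ (by
    simp [Code.budgetTotals, Code.clearReal])
  have f3 : τ3.nat 5 = τ2.nat 5 := Code.run_nat_of_notMem _ _ _ (by simp [Code.activeFlags])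
  have f3' : τ3.nat 10 = τ2.nat 10 := Code.run_nat_of_notMem _ _ _ (by simp [Code.activeFlags])
  have f3r : τ3.real 4 = τ2.real 4 := Code.run_real_of_notMem _ _ _ (by simp [Code.activeFlags])
  have f4 : τ4.nat 5 = σ.nat 5 :=
    (setNat_nat_of_ne (by norm_num)).trans (f3.trans (f2.trans f1))
  have hlt : ∀ v : Fin n, σ.nat 5 v 0 < n := fun v => (hσ.labelling v v.2).1
  have hdem : ∀ v : Fin n, τ1.nat 10 (σ.nat 5 v 0) 0 = 1 ↔
      I.DemandActive (I.component (I.tight s.dual) v) := by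
    intro v
    rw [hσ.demandActive, demandFlags_spec hσ.loaded (hlt v)]
  have hbud : ∀ v : Fin n, τ2.real 4 (σ.nat 5 v 0) 0 =
      s.budget (I.component (I.tight s.dual) v) := by
    intro v
    rw [budgetTotals_spec hr1.loaded (hlt v), ← hr1.budget v]
    refine Finset.sum_congr ?_ fun _ _ => rfl
    ext w
    rw [hr1.mem_component, f1]
    simp
  have hflags4 : Flags n τ4 5 11 (I.Awake s) := by
    intro v
    rw [hr4.joined, I.exists_awake_iff, f4, hτ4, setNat_nat_of_ne (by norm_num),
      activeFlags_spec hr2.loaded (hlt v), hbud, f2', hdem, awake_iff]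
  have hr4a : RepActive I τ4 s :=
    { flags := hflags4
      demand := by
        intro v
        rw [f4, hτ4, setNat_nat_of_ne (by norm_num), f3', f2', hdem]
      budget := by
        intro v
        rw [f4, hτ4, Memory.setNat_real, f3r, hbud] }
  have hr5a : RepActive I τ5 s := by
    refine hr4a.congr ?_ ?_ ?_ ?_
    all_goals
      first
        | exact Code.run_nat_of_notMem _ _ _ (by
            simp [Code.minEdges, Code.onEdge, Code.minUpdate])
        | exact Code.run_real_of_notMem _ _ _ (by
            simp [Code.minEdges, Code.onEdge, Code.minUpdate])
  refine ⟨?_, ?_⟩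
  · rw [hτ']
    refine hr5a.congr ?_ ?_ ?_ ?_
    all_goals
      first
        | exact Code.run_nat_of_notMem _ _ _ (by simp [Code.minBudgets, Code.minUpdate])
        | exact Code.run_real_of_notMem _ _ _ (by simp [Code.minBudgets, Code.minUpdate])
  · have hL0 : Least (τ4.nat 13 0 0) (τ4.real 5 0 0) (fun _ => False) :=
      Or.inr ⟨by simp [hτ4], fun _ h' => h'⟩
    have hL5 := minEdges_spec (ε := ε) (by norm_num : (1 : ℕ) ≠ 5) (by norm_num) (by norm_num)
      (by norm_num) hr4.loaded hflags4 hL0 hτ5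
    refine (minBudgets_spec hr5.loaded hL5 hτ').congr fun x => ?_
    rw [I.mem_eventDelays, hr4.joined]
    simp only [false_or, ← I.rate_eq, hr4.load, hr5a.budget, ne_eq, hr5a.demand]
    refine or_congr (exists_congr fun e => and_congr Iff.rfl eq_comm) ?_
    constructor
    · rintro ⟨v, h1, h2, h3⟩
      exact ⟨_, I.mem_active.2 ⟨I.component_mem, Or.inr h2⟩, h1, h3.symm⟩
    · rintro ⟨S, h1, h2, h3⟩
      obtain ⟨v, rfl⟩ := I.mem_components.1 (I.mem_active.1 h1).1
      exact ⟨v, h2, (I.mem_active.1 h1).2.resolve_left h2, h3.symm⟩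

/-- Feasibility after the event turns "load at least cost" into tightness, so exactly the new tight
edges are used for merging. -/
theorem advance_spec (hσ : RepRun I 𝒮 σ s) (ha : RepActive I σ s) (hs : I.Feasible s)
    (hh : ¬ I.Halted s) (hδ : σ.real 5 0 0 = I.delay s) :
    RepRun I 𝒮 (Code.advance.run ε σ) (I.step ε s) := by
  set τ1 := (Code.growEdges 5 11 1 5).run ε σ with hτ1
  set τ2 := Code.growBudgets.run ε τ1 with hτ2
  set τ := (Code.mergeTight 5 1 8).run ε τ2 with hτ
  change RepRun I 𝒮 τ (I.step ε s)
  have n1 : ∀ a, a ≠ 21 → τ1.nat a = σ.nat a := fun a h' =>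
    Code.run_nat_of_notMem _ _ _ (by simp [Code.growEdges, Code.onEdge, h'])
  have r1 : ∀ a, a ≠ 1 → τ1.real a = σ.real a := fun a h' =>
    Code.run_real_of_notMem _ _ _ (by simp [Code.growEdges, Code.onEdge, h'])
  have n2 : ∀ a, a ≠ 22 → τ2.nat a = τ1.nat a := fun a h' =>
    Code.run_nat_of_notMem _ _ _ (by simp [Code.growBudgets, h'])
  have r2 : ∀ a, a ≠ 3 → τ2.real a = τ1.real a := fun a h' =>
    Code.run_real_of_notMem _ _ _ (by simp [Code.growBudgets, h'])
  have l1 : Loaded I 𝒮 τ1 := hσ.loaded.congr (fun a ha => n1 a (by omega)) (r1 0 (by norm_num))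
  have l2 : Loaded I 𝒮 τ2 := l1.congr (fun a ha => n2 a (by omega)) (r2 0 (by norm_num))
  have l3 : Loaded I 𝒮 τ := l2.run (fun a ha => by simp [Code.mergeTight, Code.unite]; omega)
    (by simp [Code.mergeTight, Code.unite])
  have r3 : τ.real = τ2.real := by
    funext a
    exact Code.run_real_of_notMem _ _ _ (by simp [Code.mergeTight, Code.unite])
  have hload : ∀ e : Fin m, τ2.real 1 e 0 = I.load (I.step ε s).dual e := by
    intro e
    rw [r2 1 (by norm_num), hτ1, growEdges_spec (by norm_num) (by norm_num) (by norm_num)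
      (by norm_num) hσ.loaded ha.flags, hσ.load, hσ.joined, ← I.rate_eq, hδ,
      SteinerForest.step_load]
  have hcol : τ2.col 5 = σ.col 5 := col_congr ((n2 5 (by norm_num)).trans (n1 5 (by norm_num)))
  have hmark : marked m τ2 8 = marked m σ 8 :=
    marked_congr ((n2 8 (by norm_num)).trans (n1 8 (by norm_num)))
  have hfeas := hs.step (ε := ε)
  obtain ⟨k1, k2, k3, k4⟩ := mergeTight_spec (ε := ε) (l := 1) (M := 8) (L := 5)
    (by norm_num [Free]) (by norm_num [Free]) (by norm_num) l2 (S₀ := ⊥)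
    (P := fun F => ∀ e ∈ F, I.load (I.step ε s).dual e = I.cost e)
    (by rw [hcol]; exact hσ.labelling)
    (by rw [hcol, hσ.joined, hmark, hσ.merged_marked])
    (by
      intro e he
      rw [hmark] at he
      rw [SteinerForest.step_load, I.rate_eq_zero_of_joined, hσ.tight_marked e he]
      · simp
      · rw [← hσ.merged_marked]
        exact I.merged_ends he)
    (by
      intro F e hF _ hle f hf
      rcases Finset.mem_insert.1 hf with rfl | hf
      · rw [hload] at hle
        exact le_antisymm (hfeas f) hle
      · exact hF f hf) hτ
  -- The marked edges need not be all tight edges; they are tight, and the ends of every tight edge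
  -- carry equal labels, so both generate the same partition.
  have hmerged : I.merged ⊥ (marked m τ 8) = I.joined (I.step ε s) := by
    apply le_antisymm
    · rw [I.merged_le]
      exact ⟨bot_le, fun e he => I.connectivity_ends (k3 e he)⟩
    · rw [SteinerForest.joined, I.connectivity_le]
      intro e he
      rw [← k2]
      refine k4 e ?_
      rw [hload]
      exact (show I.load (I.step ε s).dual e = I.cost e from he).ge
  refine ⟨l3, k1, by rw [k2, hmerged], ?_, ?_, hmerged, k3⟩
  · intro e
    rw [r3, hload]
  · rw [r3]
    refine SteinerForest.step_budget_eq_sum hh (p := fun w => τ2.real 3 w 0) fun v => ?_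
    have hp : ∀ w : Fin n, τ2.real 3 w 0 = σ.real 3 w 0 +
        if σ.nat 5 w 0 = w then
          if σ.nat 10 w 0 = 1 then ε * I.delay s else
          if σ.real 4 w 0 ≤ 0 then 0 else - I.delay s
        else 0 := by
      intro w
      rw [hτ2, growBudgets_spec l1, r1 3 (by norm_num), r1 4 (by norm_num), r1 5 (by norm_num),
        n1 5 (by norm_num), n1 10 (by norm_num), hδ]
    have hlab := hσ.labelling v v.2
    -- The representative is the only vertex of the component that carries its own label, so it
    -- alone contributes to the change of the budget.
    set r : Fin n := ⟨σ.nat 5 v 0, hlab.1⟩ with hr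
    have hrr : σ.nat 5 r 0 = r := hlab.2
    have hrv : r ∈ I.component (I.tight s.dual) v := hσ.mem_component.2 hlab.2
    have hd := ha.demand v
    have hb := ha.budget v
    simp only [hp, Finset.sum_add_distrib]
    rw [hσ.budget, Finset.sum_eq_single_of_mem r hrv]
    · rw [if_pos hrr]
      have hmem : I.component (I.tight s.dual) v ∈ I.active s ↔ _ := awake_iff (I := I)
      change (_ : ℝ) + (if σ.nat 10 (σ.nat 5 v 0) 0 = 1 then _ else
        if σ.real 4 (σ.nat 5 v 0) 0 ≤ 0 then _ else _) = _
      simp only [SteinerForest.grow]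
      by_cases hda : I.DemandActive (I.component (I.tight s.dual) v)
      · rw [if_pos (hd.2 hda), if_pos (hmem.2 (Or.inl hda)), if_pos hda]
      · rw [if_neg (fun h' => hda (hd.1 h')), hb]
        by_cases hpos : 0 < s.budget (I.component (I.tight s.dual) v)
        · rw [if_neg hpos.not_ge, if_pos (hmem.2 (Or.inr hpos)), if_neg hda, sub_eq_add_neg]
        · rw [if_pos (not_lt.1 hpos), if_neg (fun h' => (hmem.1 h').elim hda hpos), add_zero]
    · intro w hw hne
      rw [if_neg]
      intro hww
      apply hne
      rw [hσ.mem_component, hww] at hw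
      exact Fin.ext hw

end Specs

end RAM

namespace RAM

open NatExpr (idx entry)
open SteinerForest (contractSetoid mergeFamily classCount Stage)

/-! ### The second process, kept ahead of the first. -/

namespace Code

/-- One event of the moat growing process on the contracted instance, within the time span left
in the real array `7`. -/
def inner : Code :=
  .seq projectFlags (.seq (setEntry 13 (.const 0) (.const 1))
    (.seq (setRealEntry 6 (.const 0) (.entry 7 (.const 0))) (.seq (minEdges 6 12 2 6)
      (.seq (growEdges 6 12 2 6)
        (.seq (setRealEntry 7 (.const 0) (.sub (.entry 7 (.const 0)) (.entry 6 (.const 0))))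
          (mergeTight 6 2 9))))))

/-- Simulate both processes up to the next event of the first one. -/
def phase : Code :=
  .seq measure (.cond (.natEq (idx 13) (.const 1))
    (.seq (setRealEntry 7 (.const 0) (.entry 5 (.const 0)))
      (.seq (.iter 27 1 inner) (.seq inner advance))) .skip)

end Code

section Specs

variable {n m h k : ℕ} (I : SteinerForest (Fin n) (Fin m) (Fin h)) (𝒮 : Fin k → Finset (Fin n))

/-- The memory represents a stage of the moat growing process on the contracted instance; `B`
bounds the integral of the number of active moats. -/
structure RepMoat (σ : Memory) (B : ℝ) : Prop where
  labelling : Labelling n (σ.col 6)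
  joined : labelSetoid n (σ.col 6) = I.merged (contractSetoid (Set.range 𝒮)) (marked m σ 9)
  reach : ∃ b ≤ B, Relation.ReflTransGen (I.Transition (contractSetoid (Set.range 𝒮)))
    ⟨fun _ => 0, ∅, 0⟩ ⟨fun e : Fin m => σ.real 2 e 0, marked m σ 9, b⟩
  below : ∀ e : Fin m, ¬ labelSetoid n (σ.col 6) (I.ends e).1 (I.ends e).2 →
    σ.real 2 e 0 < I.cost e

/-- The number of active components after contraction. -/
noncomputable def mergedCount (s : SteinerForest.State (Fin n)) : ℝ :=
  (mergeFamily (I.active s) (Set.range 𝒮)).card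

/-- The state of the inner loop: time `σ.real 7 0 0` is left until the next event of the first
process. -/
structure Inner (σ : Memory) (s : SteinerForest.State (Fin n)) (B : ℝ) (i : ℕ) : Prop where
  moat : RepMoat I 𝒮 σ (B + (I.delay s - σ.real 7 0 0) * mergedCount I 𝒮 s)
  nonneg : 0 ≤ σ.real 7 0 0
  le : I.joined s ≤ labelSetoid n (σ.col 6)
  ahead : ∀ e : Fin m, ¬ labelSetoid n (σ.col 6) (I.ends e).1 (I.ends e).2 →
    I.load s.dual e + (I.delay s - σ.real 7 0 0) * I.rate s e ≤ σ.real 2 e 0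
  progress : σ.real 7 0 0 = 0 ∨ i ≤ (marked m σ 9).card

/-- The memory represents corresponding states of both processes. -/
structure Sync (σ : Memory) (s : SteinerForest.State (Fin n)) (B : ℝ) : Prop where
  run : RepRun I 𝒮 σ s
  moat : RepMoat I 𝒮 σ B
  le : I.joined s ≤ labelSetoid n (σ.col 6)
  ahead : ∀ e : Fin m, ¬ labelSetoid n (σ.col 6) (I.ends e).1 (I.ends e).2 →
    I.load s.dual e ≤ σ.real 2 e 0

variable {I 𝒮} {σ τ : Memory} {ε : ℝ} {s : SteinerForest.State (Fin n)} {B : ℝ} {i : ℕ}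

theorem RepMoat.congr (hσ : RepMoat I 𝒮 σ B) (h6 : τ.nat 6 = σ.nat 6) (h9 : τ.nat 9 = σ.nat 9)
    (h2 : τ.real 2 = σ.real 2) : RepMoat I 𝒮 τ B := by
  have hc := col_congr h6
  have hm := marked_congr (m := m) h9
  exact ⟨by rw [hc]; exact hσ.labelling, by rw [hc, hm]; exact hσ.joined,
    by rw [hm, h2]; exact hσ.reach, by rw [hc, h2]; exact hσ.below⟩

theorem Inner.congr (hσ : Inner I 𝒮 σ s B i) (h6 : τ.nat 6 = σ.nat 6) (h9 : τ.nat 9 = σ.nat 9)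
    (h2 : τ.real 2 = σ.real 2) (h7 : τ.real 7 = σ.real 7) : Inner I 𝒮 τ s B i := by
  have hc := col_congr h6
  have hm := marked_congr (m := m) h9
  exact ⟨by rw [h7]; exact hσ.moat.congr h6 h9 h2, by rw [h7]; exact hσ.nonneg,
    by rw [hc]; exact hσ.le, by rw [hc, h7, h2]; exact hσ.ahead, by rw [hm, h7]; exact hσ.progress⟩

theorem Sync.congr (hσ : Sync I 𝒮 σ s B) (hr : RepRun I 𝒮 τ s) (h6 : τ.nat 6 = σ.nat 6)
    (h9 : τ.nat 9 = σ.nat 9) (h2 : τ.real 2 = σ.real 2) : Sync I 𝒮 τ s B := by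
  have hc := col_congr h6
  exact ⟨hr, hσ.moat.congr h6 h9 h2, by rw [hc]; exact hσ.le, by rw [hc, h2]; exact hσ.ahead⟩

/-- An active vertex in the class of an end stays in its class when the partition is coarsened. As
long as the ends remain in distinct classes, no active end is lost; this is why the second process
stays ahead. -/
theorem edgeRate_mono {R R' : Setoid (Fin n)} (hR : R ≤ R') (a : Fin n → Prop) {e : Fin m}
    (he : ¬ R' (I.ends e).1 (I.ends e).2) : I.edgeRate R a e ≤ I.edgeRate R' a e := by
  have key : ∀ v, (∃ w, a w ∧ R w v) → ∃ w, a w ∧ R' w v := fun v ⟨w, h1, h2⟩ => ⟨w, h1, hR h2⟩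
  rw [SteinerForest.edgeRate, SteinerForest.edgeRate, if_neg he, if_neg fun h' => he (hR h')]
  refine Nat.add_le_add ?_ ?_
  all_goals
    split_ifs with h1 h2
    · exact le_rfl
    · exact absurd (key _ h1) h2
    · exact Nat.zero_le _
    · exact le_rfl

/-- This provides the growth condition of the second process: a pair unjoined in its coarser
partition is also unjoined here. -/
theorem awake_of_not_joined {d : Fin h} (hd : ¬ I.joined s (I.demand d).1 (I.demand d).2) :
    I.Awake s (I.demand d).1 ∧ I.Awake s (I.demand d).2 := by
  rw [awake_iff, awake_iff]
  refine ⟨Or.inl ⟨d, Or.inl ⟨I.self_mem_component, fun h' => hd (I.mem_component.1 h')⟩⟩,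
    Or.inl ⟨d, Or.inr ⟨I.self_mem_component, fun h' => hd ?_⟩⟩⟩
  exact Setoid.symm' _ (I.mem_component.1 h')

theorem inner_natWrites {a : ℕ} (ha : a < 6 ∨ a = 8 ∨ a = 10 ∨ a = 11) :
    (Code.inner.run ε σ).nat a = σ.nat a := by
  refine Code.run_nat_of_notMem _ _ _ ?_
  simp [Code.inner, Code.projectFlags, Code.clear, Code.minEdges, Code.growEdges, Code.onEdge,
    Code.minUpdate, Code.mergeTight, Code.unite]
  omega

theorem inner_realWrites {a : ℕ} (ha : a < 6 ∧ a ≠ 2) :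
    (Code.inner.run ε σ).real a = σ.real a := by
  refine Code.run_real_of_notMem _ _ _ ?_
  simp [Code.inner, Code.projectFlags, Code.clear, Code.minEdges, Code.growEdges, Code.onEdge,
    Code.minUpdate, Code.mergeTight, Code.unite]
  omega

theorem RepRun.inner (hσ : RepRun I 𝒮 σ s) : RepRun I 𝒮 (Code.inner.run ε σ) s :=
  hσ.congr (hσ.loaded.congr (fun _ ha => inner_natWrites (by omega))
    (inner_realWrites (by norm_num))) (inner_natWrites (by norm_num)) (inner_natWrites (by norm_num))
    (inner_realWrites (by norm_num)) (inner_realWrites (by norm_num))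

theorem RepActive.inner (hσ : RepActive I σ s) : RepActive I (Code.inner.run ε σ) s :=
  hσ.congr (inner_natWrites (by norm_num)) (inner_natWrites (by norm_num))
    (inner_natWrites (by norm_num)) (inner_realWrites (by norm_num))

theorem projectFlags_flags (hσ : RepRun I 𝒮 σ s) (ha : RepActive I σ s)
    (hlab : Labelling n (σ.col 6)) :
    Flags n (Code.projectFlags.run ε σ) 6 12 (I.Awake s) := by
  have h6 : (Code.projectFlags.run ε σ).nat 6 = σ.nat 6 :=
    Code.run_nat_of_notMem _ _ _ (by simp [Code.projectFlags, Code.clear])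
  intro v
  have hlt : σ.nat 6 v 0 < n := (hlab v v.2).1
  rw [h6, projectFlags_spec hσ.loaded hlt, col_congr h6]
  refine exists_congr fun w => and_congr ?_ Iff.rfl
  rw [ha.flags w, hσ.joined, I.exists_awake_iff]

/-- The step lasts until an edge between two classes is paid for or the remaining time is used up,
whichever comes first. The activity of the first process is constant meanwhile, so one growth
transition followed by additions of paid edges describes it. -/
theorem inner_spec (hσ : RepRun I 𝒮 σ s) (ha : RepActive I σ s) (hi : Inner I 𝒮 σ s B i) :
    Inner I 𝒮 (Code.inner.run ε σ) s B (i + 1) := by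
  set S₀ := contractSetoid (Set.range 𝒮) with hS₀
  set r := σ.real 7 0 0 with hr
  set τ1 := Code.projectFlags.run ε σ with hτ1
  set τ2 := (τ1.setNat 13 0 0 1).setReal 6 0 0 r with hτ2
  set τ3 := (Code.minEdges 6 12 2 6).run ε τ2 with hτ3
  set τ4 := (Code.growEdges 6 12 2 6).run ε τ3 with hτ4
  set τ5 := τ4.setReal 7 0 0 (τ4.real 7 0 0 - τ4.real 6 0 0) with hτ5
  set τ := (Code.mergeTight 6 2 9).run ε τ5 with hτ
  have n1 : ∀ a, a ≠ 12 → a ≠ 22 → τ1.nat a = σ.nat a := fun a h1 h2 =>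
    Code.run_nat_of_notMem _ _ _ (by simp [Code.projectFlags, Code.clear, h1, h2])
  have r1 : τ1.real = σ.real := by
    funext a
    exact Code.run_real_of_notMem _ _ _ (by simp [Code.projectFlags, Code.clear])
  have e2 : (Code.setRealEntry 6 (.const 0) (.entry 7 (.const 0))).run ε
      ((Code.setEntry 13 (.const 0) (.const 1)).run ε τ1) = τ2 := by
    simp [hτ2, hr, r1]
  have hfin : Code.inner.run ε σ = τ := by
    simp only [Code.inner, Code.run_seq]
    rw [← hτ1, e2]
    rfl
  have n2 : ∀ a, a ≠ 13 → τ2.nat a = τ1.nat a := fun a h1 => setNat_nat_of_ne h1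
  have r2 : ∀ a, a ≠ 6 → τ2.real a = σ.real a := by
    intro a h1
    rw [hτ2, setReal_real_of_ne h1, Memory.setNat_real, r1]
  have n3 : ∀ a, a ≠ 13 → a ≠ 21 → τ3.nat a = τ2.nat a := fun a h1 h2 =>
    Code.run_nat_of_notMem _ _ _ (by simp [Code.minEdges, Code.onEdge, Code.minUpdate, h1, h2])
  have r3 : ∀ a, a ≠ 6 → τ3.real a = τ2.real a := fun a h1 =>
    Code.run_real_of_notMem _ _ _ (by simp [Code.minEdges, Code.onEdge, Code.minUpdate, h1])
  have n4 : ∀ a, a ≠ 21 → τ4.nat a = τ3.nat a := fun a h1 =>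
    Code.run_nat_of_notMem _ _ _ (by simp [Code.growEdges, Code.onEdge, h1])
  have r4 : ∀ a, a ≠ 2 → τ4.real a = τ3.real a := fun a h1 =>
    Code.run_real_of_notMem _ _ _ (by simp [Code.growEdges, Code.onEdge, h1])
  have n5 : τ5.nat = τ4.nat := rfl
  have l1 : Loaded I 𝒮 τ1 :=
    hσ.loaded.congr (fun a _ => n1 a (by omega) (by omega)) (by rw [r1])
  have l2 : Loaded I 𝒮 τ2 := l1.congr (fun a _ => n2 a (by omega)) (by
    rw [r2 0 (by norm_num), r1])
  have l3 : Loaded I 𝒮 τ3 :=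
    l2.congr (fun a _ => n3 a (by omega) (by omega)) (r3 0 (by norm_num))
  have l4 : Loaded I 𝒮 τ4 := l3.congr (fun a _ => n4 a (by omega)) (r4 0 (by norm_num))
  have l5 : Loaded I 𝒮 τ5 := l4.congr (fun a _ => rfl) (setReal_real_of_ne (by norm_num))
  have f6 : τ2.nat 6 = σ.nat 6 :=
    (n2 6 (by norm_num)).trans (n1 6 (by norm_num) (by norm_num))
  have f6' : τ3.nat 6 = τ2.nat 6 := n3 6 (by norm_num) (by norm_num)
  have f65 : τ5.nat 6 = σ.nat 6 := by
    rw [n5, n4 6 (by norm_num), f6', f6]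
  have f95 : τ5.nat 9 = σ.nat 9 := by
    rw [n5, n4 9 (by norm_num), n3 9 (by norm_num) (by norm_num), n2 9 (by norm_num),
      n1 9 (by norm_num) (by norm_num)]
  have hflags1 := projectFlags_flags (ε := ε) hσ ha hi.moat.labelling
  have hflags2 : Flags n τ2 6 12 (I.Awake s) := by
    intro v
    rw [col_congr (n2 6 (by norm_num)), n2 6 (by norm_num), n2 12 (by norm_num)]
    exact hflags1 v
  have hflags3 : Flags n τ3 6 12 (I.Awake s) := by
    intro v
    rw [col_congr f6', f6', n3 12 (by norm_num) (by norm_num)]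
    exact hflags2 v
  set R := labelSetoid n (σ.col 6) with hR
  have hR2 : labelSetoid n (τ2.col 6) = R := by rw [col_congr f6]
  have hR3 : labelSetoid n (τ3.col 6) = R := by rw [col_congr f6', hR2]
  -- the duration of the step
  have hleast := minEdges_spec (ε := ε) (by norm_num : (2 : ℕ) ≠ 6) (by norm_num) (by norm_num)
    (by norm_num) l2 hflags2 (P := fun y => y = r)
    (Or.inl ⟨by simp [hτ2], by simp [hτ2], fun y hy => by simp [hτ2, hy]⟩) hτ3
  set δ := τ3.real 6 0 0 with hδ
  rw [hR2] at hleast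
  obtain ⟨hδ1, hδ2⟩ : (δ = r ∨ ∃ e, I.edgeRate R (I.Awake s) e ≠ 0 ∧
      δ = (I.cost e - σ.real 2 e 0) / (I.edgeRate R (I.Awake s) e : ℝ)) ∧
      ∀ y, (y = r ∨ ∃ e, I.edgeRate R (I.Awake s) e ≠ 0 ∧
      y = (I.cost e - σ.real 2 e 0) / (I.edgeRate R (I.Awake s) e : ℝ)) → δ ≤ y := by
    rw [r2 2 (by norm_num)] at hleast
    rcases hleast with h' | h'
    · exact h'.2
    · exact absurd (Or.inl rfl) (h'.2 r)
  have hcutrate : ∀ e, I.edgeRate R (I.Awake s) e ≠ 0 →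
      ¬ R (I.ends e).1 (I.ends e).2 := by
    intro e he hc
    rw [SteinerForest.edgeRate, if_pos hc] at he
    exact he rfl
  have hδr : δ ≤ r := hδ2 r (Or.inl rfl)
  have hδ0 : 0 ≤ δ := by
    rcases hδ1 with h' | ⟨e, he, h'⟩
    · rw [h']; exact hi.nonneg
    · rw [h']
      have := hi.moat.below e (hcutrate e he)
      exact div_nonneg (by linarith) (Nat.cast_nonneg _)
  -- the new loads
  have hload : ∀ e : Fin m, τ5.real 2 e 0 =
      σ.real 2 e 0 + δ * I.edgeRate R (I.Awake s) e := by
    intro e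
    rw [hτ5, setReal_real_of_ne (by norm_num), hτ4, growEdges_spec (by norm_num) (by norm_num)
      (by norm_num) (by norm_num) l3 hflags3, hR3, r3 2 (by norm_num), r2 2 (by norm_num)]
  have hcost : ∀ e : Fin m, ¬ R (I.ends e).1 (I.ends e).2 → τ5.real 2 e 0 ≤ I.cost e := by
    intro e he
    rw [hload]
    by_cases h0 : I.edgeRate R (I.Awake s) e = 0
    · have := hi.moat.below e he
      simp only [h0, Nat.cast_zero, mul_zero, add_zero]
      exact this.le
    · have := hδ2 _ (Or.inr ⟨e, h0, rfl⟩)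
      have hpos : (0 : ℝ) < I.edgeRate R (I.Awake s) e := by exact_mod_cast Nat.pos_of_ne_zero h0
      rw [le_div_iff₀ hpos] at this
      linarith
  have hRm : R = I.merged S₀ (marked m σ 9) := hi.moat.joined
  have hm5 : marked m τ5 9 = marked m σ 9 := marked_congr f95
  have hc5 : τ5.col 6 = σ.col 6 := col_congr f65
  obtain ⟨b, hb, hreach⟩ := hi.moat.reach
  have hcount : (classCount R (I.Awake s) : ℝ) ≤ mergedCount I 𝒮 s := by
    have := I.classCount_le_mergeFamily hi.le (hRm ▸ I.le_merged : S₀ ≤ R)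
    rw [mergedCount]
    exact_mod_cast this
  have hgrow := SteinerForest.Transition.grow (I := I) (S₀ := S₀)
    ⟨fun e : Fin m => σ.real 2 e 0, marked m σ 9, b⟩ (I.Awake s) δ hδ0 (by
      intro d hd
      rw [← hRm] at hd ⊢
      have := awake_of_not_joined fun h' => hd (hi.le h')
      exact ⟨⟨_, this.1, Setoid.refl' _ _⟩, ⟨_, this.2, Setoid.refl' _ _⟩⟩)
  rw [← hRm] at hgrow
  have hreach' := hreach.tail hgrow
  -- The invariant records that the edge set only grows: a newly added edge then joins two classes
  -- of `R`, for which load at most cost is known, so its load equals its cost as a transition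
  -- requires.
  obtain ⟨k1, k2, ⟨k3, k3'⟩, k4⟩ := mergeTight_spec (ε := ε) (l := 2) (M := 9) (L := 6)
    (by norm_num [Free]) (by norm_num [Free]) (by norm_num) l5 (S₀ := S₀)
    (P := fun F => marked m σ 9 ⊆ F ∧ Relation.ReflTransGen (I.Transition S₀)
      ⟨fun _ => 0, ∅, 0⟩ ⟨fun e : Fin m => τ5.real 2 e 0, F, b + δ * classCount R (I.Awake s)⟩)
    (by rw [hc5]; exact hi.moat.labelling)
    (by rw [hc5, hm5]; exact hRm)
    (by
      rw [hm5]
      refine ⟨subset_rfl, ?_⟩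
      simp only [hload]
      exact hreach')
    (by
      rintro F e ⟨hF1, hF2⟩ hF hle
      refine ⟨hF1.trans (Finset.subset_insert _ _), ?_⟩
      have hnR : ¬ R (I.ends e).1 (I.ends e).2 := fun h' => hF (I.merged_mono hF1 (hRm ▸ h'))
      have hadd := SteinerForest.Transition.add (I := I) (S₀ := S₀)
        ⟨fun e : Fin m => τ5.real 2 e 0, F, b + δ * classCount R (I.Awake s)⟩ e hF
        (le_antisymm (hcost e hnR) hle)
      refine hF2.tail ?_
      convert hadd) hτ
  have rτ : τ.real = τ5.real := by
    funext a
    exact Code.run_real_of_notMem _ _ _ (by simp [Code.mergeTight, Code.unite])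
  have hr' : τ.real 7 0 0 = r - δ := by
    rw [rτ, hτ5]
    simp only [Memory.setReal_real, and_self, if_true]
    rw [r4 7 (by norm_num), r4 6 (by norm_num), r3 7 (by norm_num), r2 7 (by norm_num)]
  have hRR : R ≤ labelSetoid n (τ.col 6) := by
    rw [k2, hRm]
    exact I.merged_mono k3
  rw [hfin]
  refine ⟨⟨k1, k2, ⟨b + δ * classCount R (I.Awake s), ?_, ?_⟩, ?_⟩, ?_, hi.le.trans hRR, ?_, ?_⟩
  · rw [hr']
    have := mul_le_mul_of_nonneg_left hcount hδ0
    linarith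
  · rw [rτ]
    exact k3'
  · intro e he
    rw [rτ]
    by_contra hc
    exact he (k4 e (not_lt.1 hc))
  · rw [hr']
    linarith
  · intro e he
    have hnR : ¬ R (I.ends e).1 (I.ends e).2 := fun h' => he (hRR h')
    rw [hr', rτ, hload]
    have h1 := hi.ahead e hnR
    have h2 : (I.rate s e : ℝ) ≤ I.edgeRate R (I.Awake s) e := by
      rw [I.rate_eq]
      exact_mod_cast edgeRate_mono hi.le _ hnR
    have := mul_le_mul_of_nonneg_left h2 hδ0
    linarith
  · rcases hδ1 with h' | ⟨e, he, h'⟩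
    · left
      rw [hr', h', sub_self]
    · rcases hi.progress with h0 | h0
      · left
        rw [hr']
        have : r = 0 := h0
        linarith
      · right
        -- If no edge were added, the partition would still be `R`, which separates the ends of `e`
        -- although `e` has been paid for.
        refine h0.trans_lt (Finset.card_lt_card ⟨k3, fun hsub => ?_⟩)
        have heq : marked m τ 9 = marked m σ 9 := Finset.Subset.antisymm hsub k3
        have hnR := hcutrate e he
        have hjoin := k4 e (by
          rw [hload, h']
          have : (I.edgeRate R (I.Awake s) e : ℝ) ≠ 0 := by exact_mod_cast he
          field_simp
          linarith)
        rw [k2, heq, ← hRm] at hjoin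
        exact hnR hjoin

theorem measure_natWrites {a : ℕ} (ha : a < 10 ∨ a = 12) :
    (Code.measure.run ε σ).nat a = σ.nat a := by
  refine Code.run_nat_of_notMem _ _ _ ?_
  simp [Code.measure, Code.demandFlags, Code.budgetTotals, Code.activeFlags, Code.clear,
    Code.clearReal, Code.minEdges, Code.minBudgets, Code.onEdge, Code.minUpdate]
  omega

theorem measure_realWrites {a : ℕ} (ha : a < 4) :
    (Code.measure.run ε σ).real a = σ.real a := by
  refine Code.run_real_of_notMem _ _ _ ?_
  simp [Code.measure, Code.demandFlags, Code.budgetTotals, Code.activeFlags, Code.clear,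
    Code.clearReal, Code.minEdges, Code.minBudgets, Code.onEdge, Code.minUpdate]
  omega

theorem advance_natWrites {a : ℕ} (ha : a < 15) (h5 : a ≠ 5) (h8 : a ≠ 8) :
    (Code.advance.run ε σ).nat a = σ.nat a := by
  refine Code.run_nat_of_notMem _ _ _ ?_
  simp [Code.advance, Code.growEdges, Code.onEdge, Code.growBudgets, Code.mergeTight, Code.unite]
  omega

theorem advance_realWrites {a : ℕ} (h1 : a ≠ 1) (h3 : a ≠ 3) :
    (Code.advance.run ε σ).real a = σ.real a := by
  refine Code.run_real_of_notMem _ _ _ ?_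
  simp [Code.advance, Code.growEdges, Code.onEdge, Code.growBudgets, Code.mergeTight, Code.unite]
  omega

/-- One step beyond the `m` rounds of the loop makes the progress counter exceed the number of
edges. -/
theorem inner_loop_spec (hσ : RepRun I 𝒮 σ s) (ha : RepActive I σ s) (hi : Inner I 𝒮 σ s B 0)
    (hτ : τ = Code.inner.run ε ((Code.iter 27 1 Code.inner).run ε σ)) :
    RepRun I 𝒮 τ s ∧ RepActive I τ s ∧ τ.real 5 = σ.real 5 ∧ Inner I 𝒮 τ s B (m + 1) := by
  have key := Code.run_iter (ε := ε) (c := 27) (b := 1) (σ := σ) (p := Code.inner)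
    (fun i τ => RepRun I 𝒮 τ s ∧ RepActive I τ s ∧ τ.real 5 = σ.real 5 ∧ Inner I 𝒮 τ s B i)
    ?_ ?_
  · rw [hσ.loaded.edges] at key
    obtain ⟨k1, k2, k3, k4⟩ := key
    rw [hτ]
    exact ⟨k1.inner, k2.inner, (inner_realWrites (by norm_num)).trans k3, inner_spec k1 k2 k4⟩
  · have n27 : ∀ a, a ≠ 27 → (σ.setNat 27 0 0 0).nat a = σ.nat a := fun a => setNat_nat_of_ne
    exact ⟨hσ.congr (hσ.loaded.setNat (by norm_num)) (n27 _ (by norm_num)) (n27 _ (by norm_num))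
      rfl rfl, ha.congr (n27 _ (by norm_num)) (n27 _ (by norm_num)) (n27 _ (by norm_num)) rfl, rfl,
      hi.congr (n27 _ (by norm_num)) (n27 _ (by norm_num)) rfl rfl⟩
  · rintro i - τ - - - ⟨k1, k2, k3, k4⟩
    have n27 : ∀ a, a ≠ 27 → ((Code.inner.run ε τ).setNat 27 0 0 (i + 1)).nat a =
      (Code.inner.run ε τ).nat a := fun a => setNat_nat_of_ne
    have k1' : RepRun I 𝒮 (Code.inner.run ε τ) s := k1.inner
    have k2' : RepActive I (Code.inner.run ε τ) s := k2.inner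
    exact ⟨k1'.congr (k1'.loaded.setNat (by norm_num)) (n27 _ (by norm_num)) (n27 _ (by norm_num))
      rfl rfl, k2'.congr (n27 _ (by norm_num)) (n27 _ (by norm_num)) (n27 _ (by norm_num)) rfl,
      (inner_realWrites (by norm_num)).trans k3,
      (inner_spec k1 k2 k4).congr (n27 _ (by norm_num)) (n27 _ (by norm_num)) rfl rfl⟩

/-- The second process catches up with the next event time first, then the first process performs
its event. Once halted, the phase keeps the representation and the delay contributes `0`, so
superfluous phases are harmless. -/
theorem phase_spec (hσ : Sync I 𝒮 σ s B) (hs : I.Feasible s) :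
    Sync I 𝒮 (Code.phase.run ε σ) (I.step ε s) (B + I.delay s * mergedCount I 𝒮 s) := by
  obtain ⟨ha1, hleast⟩ := measure_spec (ε := ε) hσ.run rfl
  set τ1 := Code.measure.run ε σ with hτ1
  have hr1 : RepRun I 𝒮 τ1 s := hσ.run.congr
    (hσ.run.loaded.congr (fun _ _ => measure_natWrites (by omega))
      (measure_realWrites (by norm_num)))
    (measure_natWrites (by norm_num)) (measure_natWrites (by norm_num))
    (measure_realWrites (by norm_num)) (measure_realWrites (by norm_num))
  have hs1 : Sync I 𝒮 τ1 s B := hσ.congr hr1 (measure_natWrites (by norm_num))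
    (measure_natWrites (by norm_num)) (measure_realWrites (by norm_num))
  have hrun : Code.phase.run ε σ = if τ1.nat 13 0 0 = 1 then
      Code.advance.run ε (Code.inner.run ε ((Code.iter 27 1 Code.inner).run ε
        (τ1.setReal 7 0 0 (τ1.real 5 0 0)))) else τ1 := by
    simp only [Code.phase, Code.run_seq, Code.run_cond, Test.holds_natEq, NatExpr.eval_idx,
      NatExpr.eval_const, Code.run_setRealEntry, RealExpr.eval_entry, Code.run_skip, ← hτ1]
  rw [hrun]
  rcases hleast with ⟨hf, hmem, hmin⟩ | ⟨hf, hnone⟩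
  · rw [if_pos hf]
    have hh : ¬ I.Halted s := by
      intro h'
      rw [h'] at hmem
      exact Finset.notMem_empty _ hmem
    have hδ : τ1.real 5 0 0 = I.delay s :=
      le_antisymm (hmin _ (SteinerForest.delay_mem hh)) (SteinerForest.delay_le hmem)
    rw [hδ]
    set τ2 := τ1.setReal 7 0 0 (I.delay s) with hτ2
    have rr : ∀ a, a ≠ 7 → τ2.real a = τ1.real a := fun a h' => setReal_real_of_ne h'
    have hr2 : RepRun I 𝒮 τ2 s := hr1.congr (hr1.loaded.congr (fun _ _ => rfl)
      (rr 0 (by norm_num))) rfl rfl (rr 1 (by norm_num)) (rr 3 (by norm_num))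
    have ha2 : RepActive I τ2 s := ha1.congr rfl rfl rfl (rr 4 (by norm_num))
    have h7 : τ2.real 7 0 0 = I.delay s := by simp [hτ2]
    have hi2 : Inner I 𝒮 τ2 s B 0 := by
      refine ⟨?_, ?_, hs1.le, ?_, Or.inr (Nat.zero_le _)⟩
      · rw [h7, sub_self, zero_mul, add_zero]
        exact hs1.moat.congr rfl rfl (rr 2 (by norm_num))
      · rw [h7]
        exact SteinerForest.delay_nonneg hs
      · intro e he
        rw [h7, sub_self, zero_mul, add_zero, rr 2 (by norm_num)]
        exact hs1.ahead e he
    obtain ⟨hr3, ha3, h5, hi3⟩ := inner_loop_spec (ε := ε) hr2 ha2 hi2 rfl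
    set τ3 := Code.inner.run ε ((Code.iter 27 1 Code.inner).run ε τ2) with hτ3
    have h50 : τ3.real 5 0 0 = I.delay s := by
      rw [h5, rr 5 (by norm_num), hδ]
    -- Otherwise `m + 1` edges would have been selected.
    have h70 : τ3.real 7 0 0 = 0 := by
      refine hi3.progress.resolve_right fun h' => ?_
      have : (marked m τ3 9).card ≤ m := (Finset.card_le_univ _).trans (by simp)
      omega
    have hr4 := advance_spec (ε := ε) hr3 ha3 hs hh h50
    have hm := hi3.moat
    have hahead := hi3.ahead
    rw [h70, sub_zero] at hm hahead
    have n6 : (Code.advance.run ε τ3).nat 6 = τ3.nat 6 :=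
      advance_natWrites (by norm_num) (by norm_num) (by norm_num)
    have n9 : (Code.advance.run ε τ3).nat 9 = τ3.nat 9 :=
      advance_natWrites (by norm_num) (by norm_num) (by norm_num)
    have r2 : (Code.advance.run ε τ3).real 2 = τ3.real 2 :=
      advance_realWrites (by norm_num) (by norm_num)
    simp only [← SteinerForest.step_load (ε := ε)] at hahead
    refine ⟨hr4, hm.congr n6 n9 r2, ?_, ?_⟩
    · rw [col_congr n6, SteinerForest.joined, I.connectivity_le]
      intro e he
      -- An edge tight in the first process but between two classes of the second would have load at
      -- least its cost there, whereas such edges stay strictly below their cost.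
      by_contra hc
      have h1 := hahead e hc
      have h2 := hm.below e hc
      rw [show I.load (I.step ε s).dual e = I.cost e from he] at h1
      linarith
    · rw [col_congr n6, r2]
      exact hahead
  · rw [if_neg hf]
    have hh : I.Halted s := Finset.eq_empty_iff_forall_notMem.2 hnone
    rw [I.step_of_halted ε hh, SteinerForest.delay, dif_neg (by
      rw [show I.eventDelays s = ∅ from hh]
      exact Finset.not_nonempty_empty), zero_mul, add_zero]
    exact hs1

end Specs

end RAM

namespace RAM

open NatExpr (idx entry)
open SteinerForest (contractSetoid mergeFamily classCount Stage)

/-! ### Initialisation, pruning and correctness of the algorithm. -/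

namespace Code

/-- Give every vertex its own label. -/
def identity (a : ℕ) : Code := .iter 22 0 (setEntry a (idx 22) (idx 22))

/-- Merge the classes of two vertices if they lie in a common set of the collection. -/
def contractPair (a : ℕ) : Code :=
  .cond (.conj (.natEq (.get 3 (idx 23) (idx 24)) (.const 1))
    (.natEq (.get 3 (idx 23) (idx 25)) (.const 1))) (unite a (idx 24) (idx 25)) .skip

/-- Contract every set of the collection. -/
def contractSets (a : ℕ) : Code := .iter 23 3 (.iter 24 0 (.iter 25 0 (contractPair a)))

/-- Set up the initial states of both processes. -/
def init : Code :=
  .seq (identity 5) (.seq (identity 6) (.seq (contractSets 6)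
    (.seq (mergeTight 5 1 8) (mergeTight 6 2 9))))

/-- Label the vertices according to the contracted sets and the edges marked in the output. -/
def connect : Code :=
  .seq (identity 7) (.seq (contractSets 7)
    (.iter 21 1 (.cond (.natEq (entry 4 (idx 21)) (.const 1)) (unite 7 eFst eSnd) .skip)))

/-- Test whether all demand pairs are connected. -/
def checkDemands : Code :=
  .seq (setEntry 14 (.const 0) (.const 1)) (.iter 22 2 (.cond
    (.natEq (entry 7 (.get 2 (idx 22) (.const 0))) (entry 7 (.get 2 (idx 22) (.const 1)))) .skip
    (setEntry 14 (.const 0) (.const 0))))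

/-- Remove an edge from the output if it is not needed. -/
def pruneEdge : Code :=
  .cond (.natEq (entry 4 (idx 28)) (.const 1))
    (.seq (setEntry 4 (idx 28) (.const 0)) (.seq connect (.seq checkDemands
      (.cond (.natEq (idx 14) (.const 1)) .skip (setEntry 4 (idx 28) (.const 1)))))) .skip

/-- Compute a minimal solution within the selected edges. -/
def prune : Code :=
  .seq (.iter 21 1 (setEntry 4 (idx 21) (entry 9 (idx 21)))) (.iter 28 1 pruneEdge)

/-- The algorithm. -/
def steinerForest : Code := .seq init (.seq (.iter 26 0 (.seq phase phase)) prune)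

end Code

section Specs

variable {n m h k : ℕ} {I : SteinerForest (Fin n) (Fin m) (Fin h)} {𝒮 : Fin k → Finset (Fin n)}
  {σ τ : Memory} {ε : ℝ}

theorem identity_spec {a : ℕ} (ha : Free a) (hσ : Loaded I 𝒮 σ)
    (hτ : τ = (Code.identity a).run ε σ) :
    Labelling n (τ.col a) ∧ labelSetoid n (τ.col a) = ⊥ := by
  have ha22 : a ≠ 22 := by have := ha.2.2.2; omega
  have key := Code.run_iter (ε := ε) (c := 22) (b := 0) (σ := σ)
    (p := Code.setEntry a (idx 22) (idx 22)) (fun i τ => ∀ x < i, τ.nat a x 0 = x) ?_ ?_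
  · rw [hσ.vertices] at key
    have hid : ∀ x < n, τ.col a x = x := by
      rw [hτ]
      exact key
    refine ⟨fun v hv => ?_, ?_⟩
    · rw [hid v hv, hid v hv]
      exact ⟨hv, rfl⟩
    · rw [eq_bot_iff]
      intro u v huv
      rw [labelSetoid_iff, hid u u.2, hid v v.2] at huv
      exact Fin.ext huv
  · intro x hx
    omega
  · intro i hi τ hc hn hr hinv x hx
    rcases Nat.lt_succ_iff_lt_or_eq.1 hx with hx | rfl
    · simp [ha22, hinv x hx]
      omega
    · simp [ha22, hc]

/-- Uniting only vertices of a common set keeps the partition below the contraction, and classes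
never split; treating all pairs finally gives equality. -/
theorem contract_row_spec {a : ℕ} (ha : Free a) (hσ : Loaded I 𝒮 σ) {i : Fin k} {u : Fin n}
    (h23 : σ.nat 23 0 0 = i) (h24 : σ.nat 24 0 0 = u) (hlab : Labelling n (σ.col a))
    (hle : labelSetoid n (σ.col a) ≤ contractSetoid (Set.range 𝒮))
    (hτ : τ = (Code.iter 25 0 (Code.contractPair a)).run ε σ) :
    Labelling n (τ.col a) ∧ labelSetoid n (σ.col a) ≤ labelSetoid n (τ.col a) ∧
    labelSetoid n (τ.col a) ≤ contractSetoid (Set.range 𝒮) ∧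
    ∀ v, u ∈ 𝒮 i → v ∈ 𝒮 i → labelSetoid n (τ.col a) u v := by
  have ha' := ha
  obtain ⟨ha4, ha15, ha16, ha20⟩ := ha'
  have key := Code.run_iter (ε := ε) (c := 25) (b := 0) (σ := σ) (p := Code.contractPair a)
    (fun j τ => Labelling n (τ.col a) ∧ labelSetoid n (σ.col a) ≤ labelSetoid n (τ.col a) ∧
    labelSetoid n (τ.col a) ≤ contractSetoid (Set.range 𝒮) ∧
    ∀ v : Fin n, (v : ℕ) < j → u ∈ 𝒮 i → v ∈ 𝒮 i → labelSetoid n (τ.col a) u v) ?_ ?_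
  · rw [hσ.vertices] at key
    rw [hτ]
    exact ⟨key.1, key.2.1, key.2.2.1, fun v => key.2.2.2 v v.2⟩
  · rw [col_congr (setNat_nat_of_ne (by omega))]
    exact ⟨hlab, le_rfl, hle, fun v hv => absurd hv (Nat.not_lt_zero _)⟩
  · rintro j hj τ hc hn hr ⟨h1, h2, h3, h4⟩
    rw [hσ.vertices] at hj
    obtain ⟨w, rfl⟩ : ∃ w : Fin n, (w : ℕ) = j := ⟨⟨j, hj⟩, rfl⟩
    have hwr : ∀ b, b ≠ 25 → b ≠ 15 → b ≠ 16 → b ≠ 20 → b ≠ a → τ.nat b = σ.nat b :=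
      fun b h1 h2 h3 h4 h5 => hn b (by simp [Code.contractPair, Code.unite]; omega)
    have hload : Loaded I 𝒮 τ := hσ.congr
      (fun b hb => hwr b (by omega) (by omega) (by omega) (by omega) (by omega))
      (hr 0 (by simp [Code.contractPair, Code.unite]))
    have t23 : τ.nat 23 0 0 = i := by
      rw [hwr 23 (by omega) (by omega) (by omega) (by omega) (by omega), h23]
    have t24 : τ.nat 24 0 0 = u := by
      rw [hwr 24 (by omega) (by omega) (by omega) (by omega) (by omega), h24]
    rw [col_congr (setNat_nat_of_ne (by omega))]
    have hrun : (Code.contractPair a).run ε τ = if u ∈ 𝒮 i ∧ w ∈ 𝒮 i then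
        (Code.unite a (idx 24) (idx 25)).run ε τ else τ := by
      simp only [Code.contractPair, Code.run_cond, Test.holds_conj, Test.holds_natEq,
        NatExpr.eval_get, NatExpr.eval_idx, NatExpr.eval_const, t23, t24, hc, hload.mem,
        Code.run_skip]
    generalize (Code.contractPair a).run ε τ = τ' at hrun ⊢
    split_ifs at hrun with hcond
    · subst hrun
      obtain ⟨k1, k2⟩ := unite_spec (ε := ε) ha hload (x := idx 24) (y := idx 25) (u := u) (v := w)
        (by simpa using t24) (by intro s; simpa using hc) h1
      rw [k2]
      have hpair : contractSetoid (Set.range 𝒮) u w :=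
        Relation.EqvGen.rel _ _ ⟨𝒮 i, ⟨i, rfl⟩, hcond⟩
      refine ⟨k1, h2.trans le_sup_left, sup_le h3 (pairSetoid_le.2 hpair), ?_⟩
      intro v hv hu hv'
      rcases Nat.lt_succ_iff_lt_or_eq.1 hv with hv | hv
      · exact (le_sup_left : labelSetoid n (τ.col a) ≤ _) (h4 v hv hu hv')
      · obtain rfl : v = w := Fin.ext hv
        exact pairSetoid_le.1 le_sup_right
    · subst hrun
      refine ⟨h1, h2, h3, ?_⟩
      intro v hv hu hv'
      rcases Nat.lt_succ_iff_lt_or_eq.1 hv with hv | hv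
      · exact h4 v hv hu hv'
      · obtain rfl : v = w := Fin.ext hv
        exact absurd ⟨hu, hv'⟩ hcond

theorem contract_set_spec {a : ℕ} (ha : Free a) (hσ : Loaded I 𝒮 σ) {i : Fin k}
    (h23 : σ.nat 23 0 0 = i) (hlab : Labelling n (σ.col a))
    (hle : labelSetoid n (σ.col a) ≤ contractSetoid (Set.range 𝒮))
    (hτ : τ = (Code.iter 24 0 (.iter 25 0 (Code.contractPair a))).run ε σ) :
    Labelling n (τ.col a) ∧ labelSetoid n (σ.col a) ≤ labelSetoid n (τ.col a) ∧
    labelSetoid n (τ.col a) ≤ contractSetoid (Set.range 𝒮) ∧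
    ∀ u v, u ∈ 𝒮 i → v ∈ 𝒮 i → labelSetoid n (τ.col a) u v := by
  have ha' := ha
  obtain ⟨ha4, ha15, ha16, ha20⟩ := ha'
  have key := Code.run_iter (ε := ε) (c := 24) (b := 0) (σ := σ)
    (p := .iter 25 0 (Code.contractPair a))
    (fun j τ => Labelling n (τ.col a) ∧ labelSetoid n (σ.col a) ≤ labelSetoid n (τ.col a) ∧
    labelSetoid n (τ.col a) ≤ contractSetoid (Set.range 𝒮) ∧
    ∀ u v : Fin n, (u : ℕ) < j → u ∈ 𝒮 i → v ∈ 𝒮 i → labelSetoid n (τ.col a) u v) ?_ ?_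
  · rw [hσ.vertices] at key
    rw [hτ]
    exact ⟨key.1, key.2.1, key.2.2.1, fun u v => key.2.2.2 u v u.2⟩
  · rw [col_congr (setNat_nat_of_ne (by omega))]
    exact ⟨hlab, le_rfl, hle, fun u v hu => absurd hu (Nat.not_lt_zero _)⟩
  · rintro j hj τ hc hn hr ⟨h1, h2, h3, h4⟩
    rw [hσ.vertices] at hj
    obtain ⟨w, rfl⟩ : ∃ w : Fin n, (w : ℕ) = j := ⟨⟨j, hj⟩, rfl⟩
    have hwr : ∀ b, b ≠ 24 → b ≠ 25 → b ≠ 15 → b ≠ 16 → b ≠ 20 → b ≠ a → τ.nat b = σ.nat b :=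
      fun b h0 h1 h2 h3 h4 h5 => hn b (by simp [Code.contractPair, Code.unite]; omega)
    have hload : Loaded I 𝒮 τ := hσ.congr
      (fun b hb => hwr b (by omega) (by omega) (by omega) (by omega) (by omega) (by omega))
      (hr 0 (by simp [Code.contractPair, Code.unite]))
    have t23 : τ.nat 23 0 0 = i := by
      rw [hwr 23 (by omega) (by omega) (by omega) (by omega) (by omega) (by omega), h23]
    rw [col_congr (setNat_nat_of_ne (by omega))]
    obtain ⟨k1, k2, k3, k4⟩ := contract_row_spec (ε := ε) ha hload t23 hc h1 h3 rfl
    refine ⟨k1, h2.trans k2, k3, ?_⟩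
    intro u v hu hu' hv'
    rcases Nat.lt_succ_iff_lt_or_eq.1 hu with hu | hu
    · exact k2 (h4 u v hu hu' hv')
    · obtain rfl : u = w := Fin.ext hu
      exact k4 v hu' hv'

theorem contractSets_spec {a : ℕ} (ha : Free a) (hσ : Loaded I 𝒮 σ)
    (hlab : Labelling n (σ.col a)) (hbot : labelSetoid n (σ.col a) = ⊥)
    (hτ : τ = (Code.contractSets a).run ε σ) :
    Labelling n (τ.col a) ∧ labelSetoid n (τ.col a) = contractSetoid (Set.range 𝒮) := by
  have ha' := ha
  obtain ⟨ha4, ha15, ha16, ha20⟩ := ha'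
  have key := Code.run_iter (ε := ε) (c := 23) (b := 3) (σ := σ)
    (p := .iter 24 0 (.iter 25 0 (Code.contractPair a)))
    (fun j τ => Labelling n (τ.col a) ∧ labelSetoid n (τ.col a) ≤ contractSetoid (Set.range 𝒮) ∧
    ∀ (i : Fin k) (u v : Fin n), (i : ℕ) < j → u ∈ 𝒮 i → v ∈ 𝒮 i →
      labelSetoid n (τ.col a) u v) ?_ ?_
  · rw [hσ.sets] at key
    rw [hτ]
    refine ⟨key.1, le_antisymm key.2.1 (SteinerForest.contractSetoid_le.2 ?_)⟩
    rintro _ ⟨i, rfl⟩ u hu v hv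
    exact key.2.2 i u v i.2 hu hv
  · rw [col_congr (setNat_nat_of_ne (by omega))]
    exact ⟨hlab, hbot.le.trans bot_le, fun i u v hi => absurd hi (Nat.not_lt_zero _)⟩
  · rintro j hj τ hc hn hr ⟨h1, h3, h4⟩
    rw [hσ.sets] at hj
    obtain ⟨w, rfl⟩ : ∃ w : Fin k, (w : ℕ) = j := ⟨⟨j, hj⟩, rfl⟩
    have hload : Loaded I 𝒮 τ := hσ.congr
      (fun b hb => hn b (by simp [Code.contractPair, Code.unite]; omega))
      (hr 0 (by simp [Code.contractPair, Code.unite]))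
    rw [col_congr (setNat_nat_of_ne (by omega))]
    obtain ⟨k1, k2, k3, k4⟩ := contract_set_spec (ε := ε) ha hload hc h1 h3 rfl
    refine ⟨k1, k3, ?_⟩
    intro i u v hi hu hv
    rcases Nat.lt_succ_iff_lt_or_eq.1 hi with hi | hi
    · exact k2 (h4 i u v hi hu hv)
    · obtain rfl : i = w := Fin.ext hi
      exact k4 u v hu hv

theorem marked_encode {a : ℕ} (ha : 4 ≤ a) : marked m (encode I 𝒮) a = ∅ := by
  obtain ⟨b, rfl⟩ := Nat.exists_eq_add_of_le' ha
  simp [marked, encode]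

theorem encode_real {a i j : ℕ} (ha : a ≠ 0) : (encode I 𝒮).real a i j = 0 := by
  simp [encode, ha]

/-- Edges of cost zero are tight at time `0`. They are merged at once in both processes, so that
every edge left between classes of the second one has positive cost. -/
theorem init_spec (hτ : τ = Code.init.run ε (encode I 𝒮)) :
    Sync I 𝒮 τ (SteinerForest.initial (Fin n)) 0 := by
  set σ := encode I 𝒮 with hσ
  set τ1 := (Code.identity 5).run ε σ with hτ1
  set τ2 := (Code.identity 6).run ε τ1 with hτ2
  set τ3 := (Code.contractSets 6).run ε τ2 with hτ3
  set τ4 := (Code.mergeTight 5 1 8).run ε τ3 with hτ4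
  have hτ' : τ = (Code.mergeTight 6 2 9).run ε τ4 := hτ
  have l0 : Loaded I 𝒮 σ := loaded_encode
  have l1 : Loaded I 𝒮 τ1 := l0.run (fun a _ => by simp [Code.identity]; omega)
    (by simp [Code.identity])
  have l2 : Loaded I 𝒮 τ2 := l1.run (fun a _ => by simp [Code.identity]; omega)
    (by simp [Code.identity])
  have l3 : Loaded I 𝒮 τ3 :=
    l2.run (fun a _ => by simp [Code.contractSets, Code.contractPair, Code.unite]; omega)
      (by simp [Code.contractSets, Code.contractPair, Code.unite])
  have l4 : Loaded I 𝒮 τ4 := l3.run (fun a _ => by simp [Code.mergeTight, Code.unite]; omega)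
    (by simp [Code.mergeTight, Code.unite])
  have l5 : Loaded I 𝒮 τ := by
    rw [hτ']
    exact l4.run (fun a _ => by simp [Code.mergeTight, Code.unite]; omega)
      (by simp [Code.mergeTight, Code.unite])
  have hreal3 : τ3.real = σ.real := by
    funext a
    have e3 : τ3.real a = τ2.real a := Code.run_real_of_notMem _ _ _ (by
      simp [Code.contractSets, Code.contractPair, Code.unite])
    have e2 : τ2.real a = τ1.real a := Code.run_real_of_notMem _ _ _ (by simp [Code.identity])
    have e1 : τ1.real a = σ.real a := Code.run_real_of_notMem _ _ _ (by simp [Code.identity])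
    rw [e3, e2, e1]
  have hreal4 : τ4.real = σ.real := by
    rw [← hreal3]
    funext a
    exact Code.run_real_of_notMem _ _ _ (by simp [Code.mergeTight, Code.unite])
  have hreal5 : τ.real = σ.real := by
    rw [← hreal4, hτ']
    funext a
    exact Code.run_real_of_notMem _ _ _ (by simp [Code.mergeTight, Code.unite])
  have n3 : ∀ a, a = 8 ∨ a = 9 → τ3.nat a = σ.nat a := by
    intro a ha
    have e3 : τ3.nat a = τ2.nat a := Code.run_nat_of_notMem _ _ _ (by
      simp [Code.contractSets, Code.contractPair, Code.unite]; omega)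
    have e2 : τ2.nat a = τ1.nat a := Code.run_nat_of_notMem _ _ _ (by
      simp [Code.identity]; omega)
    have e1 : τ1.nat a = σ.nat a := Code.run_nat_of_notMem _ _ _ (by
      simp [Code.identity]; omega)
    rw [e3, e2, e1]
  have n3' : τ3.nat 5 = τ1.nat 5 := by
    have e3 : τ3.nat 5 = τ2.nat 5 := Code.run_nat_of_notMem _ _ _ (by
      simp [Code.contractSets, Code.contractPair, Code.unite])
    have e2 : τ2.nat 5 = τ1.nat 5 := Code.run_nat_of_notMem _ _ _ (by simp [Code.identity])
    rw [e3, e2]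
  have n4 : ∀ a, a = 6 ∨ a = 9 → τ4.nat a = τ3.nat a := fun a ha =>
    Code.run_nat_of_notMem _ _ _ (by simp [Code.mergeTight, Code.unite]; omega)
  have n5 : ∀ a, a = 5 ∨ a = 8 → τ.nat a = τ4.nat a := by
    intro a ha
    rw [hτ']
    exact Code.run_nat_of_notMem _ _ _ (by simp [Code.mergeTight, Code.unite]; omega)
  have hzero : ∀ e : Fin m, I.load (SteinerForest.initial (Fin n)).dual e = 0 := by
    intro e
    simp [SteinerForest.load, SteinerForest.initial]
  -- the first process
  obtain ⟨p1, p2⟩ := identity_spec (ε := ε) (a := 5) (by norm_num [Free]) l0 hτ1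
  have hm8 : marked m τ3 8 = ∅ := by
    rw [marked_congr (n3 8 (by norm_num)), marked_encode (by norm_num)]
  obtain ⟨k1, k2, k3, k4⟩ := mergeTight_spec (ε := ε) (l := 1) (M := 8) (L := 5)
    (by norm_num [Free]) (by norm_num [Free]) (by norm_num) l3 (S₀ := ⊥)
    (P := fun F => ∀ e ∈ F, I.load (SteinerForest.initial (Fin n)).dual e = I.cost e)
    (by rw [col_congr n3']; exact p1)
    (by
      rw [col_congr n3', p2, hm8, eq_comm, eq_bot_iff, I.merged_le]
      exact ⟨le_rfl, by simp⟩)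
    (by rw [hm8]; simp)
    (by
      intro F e hF _ hle f hf
      rcases Finset.mem_insert.1 hf with rfl | hf
      · rw [hreal3, encode_real (by norm_num)] at hle
        rw [hzero]
        exact le_antisymm (I.cost_nonneg f) hle
      · exact hF f hf) hτ4
  have hmerged : I.merged ⊥ (marked m τ4 8) = I.joined (SteinerForest.initial (Fin n)) := by
    apply le_antisymm
    · rw [I.merged_le]
      exact ⟨bot_le, fun e he => I.connectivity_ends (k3 e he)⟩
    · rw [SteinerForest.joined, I.connectivity_le]
      intro e he
      rw [← k2]
      refine k4 e ?_
      rw [hreal3, encode_real (by norm_num), ← hzero e]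
      exact (show I.load (SteinerForest.initial (Fin n)).dual e = I.cost e from he).ge
  -- the second process
  obtain ⟨q1, q2⟩ := identity_spec (ε := ε) (a := 6) (by norm_num [Free]) l1 hτ2
  obtain ⟨q3, q4⟩ := contractSets_spec (ε := ε) (a := 6) (by norm_num [Free]) l2 q1 q2 hτ3
  have hm9 : marked m τ4 9 = ∅ := by
    rw [marked_congr (n4 9 (by norm_num)), marked_congr (n3 9 (by norm_num)),
      marked_encode (by norm_num)]
  obtain ⟨j1, j2, j3, j4⟩ := mergeTight_spec (ε := ε) (l := 2) (M := 9) (L := 6)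
    (by norm_num [Free]) (by norm_num [Free]) (by norm_num) l4
    (S₀ := contractSetoid (Set.range 𝒮))
    (P := fun F => Relation.ReflTransGen (I.Transition (contractSetoid (Set.range 𝒮)))
      ⟨fun _ => 0, ∅, 0⟩ ⟨fun _ => 0, F, 0⟩)
    (by rw [col_congr (n4 6 (by norm_num))]; exact q3)
    (by
      rw [col_congr (n4 6 (by norm_num)), q4, hm9]
      exact le_antisymm I.le_merged (I.merged_le.2 ⟨le_rfl, by simp⟩))
    (by rw [hm9])
    (by
      intro F e hF hne hle
      rw [hreal4, encode_real (by norm_num)] at hle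
      have hadd := SteinerForest.Transition.add (I := I)
        (S₀ := contractSetoid (Set.range 𝒮)) ⟨fun _ => 0, F, 0⟩ e hne
        (le_antisymm (I.cost_nonneg e) hle)
      refine hF.tail ?_
      convert hadd) hτ'
  refine ⟨⟨l5, ?_, ?_, ?_, ?_, ?_, ?_⟩, ⟨j1, j2, ⟨0, le_rfl, ?_⟩, ?_⟩, ?_, ?_⟩
  · rw [col_congr (n5 5 (by norm_num))]
    exact k1
  · rw [col_congr (n5 5 (by norm_num)), k2, hmerged]
  · intro e
    rw [hreal5, encode_real (by norm_num), hzero]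
  · intro v
    rw [hreal5]
    simp [hσ, encode_real, SteinerForest.initial]
  · rw [marked_congr (n5 8 (by norm_num)), hmerged]
  · rw [marked_congr (n5 8 (by norm_num))]
    exact k3
  · have : (fun e : Fin m => τ.real 2 e 0) = fun _ => 0 := by
      funext e
      rw [hreal5, encode_real (by norm_num)]
    rw [this]
    exact j3
  · intro e he
    rw [hreal5, ← hreal4]
    by_contra hc
    exact he (j4 e (not_lt.1 hc))
  · rw [SteinerForest.joined, I.connectivity_le]
    intro e he
    refine j4 e ?_
    rw [hreal4, encode_real (by norm_num), ← hzero e]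
    exact (show I.load (SteinerForest.initial (Fin n)).dual e = I.cost e from he).ge
  · intro e _
    rw [hreal5, encode_real (by norm_num), hzero]

/-- Two phases for each of the `n` rounds reach event index `2n`, at which the run has halted. -/
theorem phases_spec (hσ : Sync I 𝒮 σ (SteinerForest.initial (Fin n)) 0)
    (hτ : τ = (Code.iter 26 0 (.seq Code.phase Code.phase)).run ε σ) :
    Sync I 𝒮 τ (I.run ε (2 * n))
      (∑ j ∈ Finset.range (2 * n), I.delay (I.run ε j) * mergedCount I 𝒮 (I.run ε j)) := by
  have hcounter : ∀ {τ : Memory} {s B x}, Sync I 𝒮 τ s B → Sync I 𝒮 (τ.setNat 26 0 0 x) s B := by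
    intro τ s B x hτ
    have n26 : ∀ a, a ≠ 26 → (τ.setNat 26 0 0 x).nat a = τ.nat a := fun a => setNat_nat_of_ne
    exact hτ.congr (hτ.run.congr (hτ.run.loaded.setNat (by norm_num)) (n26 _ (by norm_num))
      (n26 _ (by norm_num)) rfl rfl) (n26 _ (by norm_num)) (n26 _ (by norm_num)) rfl
  have key := Code.run_iter (ε := ε) (c := 26) (b := 0) (σ := σ)
    (p := .seq Code.phase Code.phase)
    (fun i τ => Sync I 𝒮 τ (I.run ε (2 * i))
      (∑ j ∈ Finset.range (2 * i), I.delay (I.run ε j) * mergedCount I 𝒮 (I.run ε j))) ?_ ?_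
  · rw [hσ.run.loaded.vertices] at key
    rw [hτ]
    exact key
  · exact hcounter hσ
  · rintro i - τ - - - hinv
    refine hcounter ?_
    have h1 := phase_spec (ε := ε) hinv (SteinerForest.run_feasible _)
    rw [← SteinerForest.run_succ, ← Finset.sum_range_succ] at h1
    have h2 := phase_spec (ε := ε) h1 (SteinerForest.run_feasible _)
    rw [← SteinerForest.run_succ, ← Finset.sum_range_succ] at h2
    exact h2

theorem connect_spec (hσ : Loaded I 𝒮 σ) (hτ : τ = Code.connect.run ε σ) :
    labelSetoid n (τ.col 7) = I.merged (contractSetoid (Set.range 𝒮)) (marked m σ 4) := by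
  set τ1 := (Code.identity 7).run ε σ with hτ1
  set τ2 := (Code.contractSets 7).run ε τ1 with hτ2
  have l1 : Loaded I 𝒮 τ1 := hσ.run (fun a _ => by simp [Code.identity]; omega)
    (by simp [Code.identity])
  have l2 : Loaded I 𝒮 τ2 :=
    l1.run (fun a _ => by simp [Code.contractSets, Code.contractPair, Code.unite]; omega)
      (by simp [Code.contractSets, Code.contractPair, Code.unite])
  have n4 : τ2.nat 4 = σ.nat 4 := by
    have e2 : τ2.nat 4 = τ1.nat 4 := Code.run_nat_of_notMem _ _ _ (by
      simp [Code.contractSets, Code.contractPair, Code.unite])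
    have e1 : τ1.nat 4 = σ.nat 4 := Code.run_nat_of_notMem _ _ _ (by simp [Code.identity])
    rw [e2, e1]
  obtain ⟨q1, q2⟩ := identity_spec (ε := ε) (a := 7) (by norm_num [Free]) hσ hτ1
  obtain ⟨q3, q4⟩ := contractSets_spec (ε := ε) (a := 7) (by norm_num [Free]) l1 q1 q2 hτ2
  have key := Code.run_iter (ε := ε) (c := 21) (b := 1) (σ := τ2)
    (p := .cond (.natEq (entry 4 (idx 21)) (.const 1)) (Code.unite 7 Code.eFst Code.eSnd) .skip)
    (fun i τ => Labelling n (τ.col 7) ∧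
      labelSetoid n (τ.col 7) = I.merged (contractSetoid (Set.range 𝒮))
        ((marked m σ 4).filter fun e : Fin m => (e : ℕ) < i)) ?_ ?_
  · rw [l2.edges] at key
    rw [hτ]
    refine key.2.trans ?_
    congr 1
    exact Finset.filter_true_of_mem fun e _ => e.2
  · rw [col_congr (setNat_nat_of_ne (by norm_num))]
    refine ⟨q3, q4.trans ?_⟩
    exact le_antisymm I.le_merged (I.merged_le.2 ⟨le_rfl, by simp⟩)
  · rintro i hi τ hc hn hr ⟨h1, h2⟩
    rw [l2.edges] at hi
    obtain ⟨e, rfl⟩ : ∃ e : Fin m, (e : ℕ) = i := ⟨⟨i, hi⟩, rfl⟩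
    have hload : Loaded I 𝒮 τ := l2.congr
      (fun b hb => hn b (by simp [Code.unite]; omega)) (hr 0 (by simp [Code.unite]))
    have h4 : τ.nat 4 = σ.nat 4 := (hn 4 (by simp [Code.unite])).trans n4
    rw [col_congr (setNat_nat_of_ne (by norm_num))]
    have hrun : (Code.cond (.natEq (entry 4 (idx 21)) (.const 1))
        (Code.unite 7 Code.eFst Code.eSnd) .skip).run ε τ =
        if e ∈ marked m σ 4 then (Code.unite 7 Code.eFst Code.eSnd).run ε τ else τ := by
      simp only [Code.run_cond, Test.holds_natEq, NatExpr.eval_entry, NatExpr.eval_idx,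
        NatExpr.eval_const, hc, h4, mem_marked, Code.run_skip]
    have hfilter : (marked m σ 4).filter (fun f : Fin m => (f : ℕ) < e + 1) =
        if e ∈ marked m σ 4 then insert e ((marked m σ 4).filter fun f : Fin m => (f : ℕ) < e)
        else (marked m σ 4).filter fun f : Fin m => (f : ℕ) < e := by
      ext f
      have hiff : (f : ℕ) < e + 1 ↔ (f = e ∨ (f : ℕ) < e) := by
        rw [Fin.ext_iff]; omega
      split_ifs with he
      · simp only [Finset.mem_filter, Finset.mem_insert, hiff]
        constructor
        · tauto
        · rintro (rfl | h')
          · exact ⟨he, Or.inl rfl⟩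
          · tauto
      · simp only [Finset.mem_filter, hiff]
        constructor
        · rintro ⟨h1, rfl | h2⟩
          · exact absurd h1 he
          · exact ⟨h1, h2⟩
        · tauto
    rw [hrun, hfilter]
    split_ifs with he
    · obtain ⟨k1, k2⟩ := unite_spec (ε := ε) (L := 7) (by norm_num [Free]) hload
        (x := Code.eFst) (y := Code.eSnd) (u := (I.ends e).1) (v := (I.ends e).2)
        (by simp [Code.eFst, hc, hload.fst])
        (by
          intro s
          simp [Code.eSnd, hc, hload.snd]) h1
      exact ⟨k1, by rw [k2, h2, merged_insert]⟩
    · exact ⟨h1, h2⟩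

theorem checkDemands_spec (hσ : Loaded I 𝒮 σ) :
    (Code.checkDemands.run ε σ).nat 14 0 0 = 1 ↔
      ∀ d : Fin h, σ.nat 7 (I.demand d).1 0 = σ.nat 7 (I.demand d).2 0 := by
  have l1 : Loaded I 𝒮 (σ.setNat 14 0 0 1) := hσ.setNat (by norm_num)
  have n7 : (σ.setNat 14 0 0 1).nat 7 = σ.nat 7 := setNat_nat_of_ne (by norm_num)
  have key := Code.run_iter (ε := ε) (c := 22) (b := 2) (σ := σ.setNat 14 0 0 1)
    (p := .cond
    (.natEq (entry 7 (.get 2 (idx 22) (.const 0))) (entry 7 (.get 2 (idx 22) (.const 1)))) .skip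
    (Code.setEntry 14 (.const 0) (.const 0)))
    (fun i τ => τ.nat 14 0 0 = 1 ↔ ∀ d : Fin h, (d : ℕ) < i →
      σ.nat 7 (I.demand d).1 0 = σ.nat 7 (I.demand d).2 0) ?_ ?_
  · rw [l1.demands] at key
    refine Iff.trans key ?_
    exact forall_congr' fun d => ⟨fun h' => h' d.2, fun h' _ => h'⟩
  · simp
  · rintro i hi τ hc hn hr hinv
    rw [l1.demands] at hi
    obtain ⟨d, rfl⟩ : ∃ d : Fin h, (d : ℕ) = i := ⟨⟨i, hi⟩, rfl⟩
    have hload : Loaded I 𝒮 τ := l1.congr (fun b hb => hn b (by simp; omega)) (hr 0 (by simp))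
    have h7 : τ.nat 7 = σ.nat 7 := (hn 7 (by simp)).trans n7
    rw [setNat_nat_of_ne (by norm_num)]
    have hsplit : (∀ f : Fin h, (f : ℕ) < d + 1 →
        σ.nat 7 (I.demand f).1 0 = σ.nat 7 (I.demand f).2 0) ↔
        (τ.nat 14 0 0 = 1 ∧ σ.nat 7 (I.demand d).1 0 = σ.nat 7 (I.demand d).2 0) := by
      rw [hinv]
      constructor
      · intro h'
        exact ⟨fun f hf => h' f (by omega), h' d (by omega)⟩
      · rintro ⟨h1, h2⟩ f hf
        rcases Nat.lt_succ_iff_lt_or_eq.1 hf with hf | hf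
        · exact h1 f hf
        · obtain rfl : f = d := Fin.ext hf
          exact h2
    rw [hsplit]
    simp only [Code.run_cond, Test.holds_natEq, NatExpr.eval_entry, NatExpr.eval_get,
      NatExpr.eval_idx, NatExpr.eval_const, hc, hload.demand_fst, hload.demand_snd, h7,
      Code.run_skip]
    split_ifs with hcond
    · simp [hcond]
    · simp [hcond]

variable (I 𝒮) in
/-- The edge set connects all demand pairs of the contracted instance. -/
def Connects (F : Finset (Fin m)) : Prop :=
  ∀ d, I.merged (contractSetoid (Set.range 𝒮)) F (I.demand d).1 (I.demand d).2

open Classical in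
theorem pruneEdge_spec (hσ : Loaded I 𝒮 σ) {e : Fin m} (he : σ.nat 28 0 0 = e) :
    marked m (Code.pruneEdge.run ε σ) 4 =
      if e ∈ marked m σ 4 ∧ Connects I 𝒮 ((marked m σ 4).erase e) then (marked m σ 4).erase e
      else marked m σ 4 := by
  set τ1 := σ.setNat 4 e 0 0 with hτ1
  set τ2 := Code.connect.run ε τ1 with hτ2
  set τ3 := Code.checkDemands.run ε τ2 with hτ3
  have hrun : Code.pruneEdge.run ε σ = if e ∈ marked m σ 4 then
      if τ3.nat 14 0 0 = 1 then τ3 else τ3.setNat 4 (τ3.nat 28 0 0) 0 1 else σ := by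
    simp only [Code.pruneEdge, Code.run_cond, Code.run_seq, Test.holds_natEq, NatExpr.eval_entry,
      NatExpr.eval_idx, NatExpr.eval_const, Code.run_setEntry, Code.run_skip, he, mem_marked,
      ← hτ1, ← hτ2, ← hτ3]
  have l1 : Loaded I 𝒮 τ1 := hσ.setNat le_rfl
  have l2 : Loaded I 𝒮 τ2 := l1.run
    (fun a _ => by
      simp [Code.connect, Code.identity, Code.contractSets, Code.contractPair, Code.unite]; omega)
    (by simp [Code.connect, Code.identity, Code.contractSets, Code.contractPair, Code.unite])
  have n3 : ∀ a, a = 4 ∨ a = 28 → τ3.nat a = τ1.nat a := by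
    intro a ha
    have e3 : τ3.nat a = τ2.nat a := Code.run_nat_of_notMem _ _ _ (by
      simp [Code.checkDemands]; omega)
    have e2 : τ2.nat a = τ1.nat a := Code.run_nat_of_notMem _ _ _ (by
      simp [Code.connect, Code.identity, Code.contractSets, Code.contractPair, Code.unite]; omega)
    rw [e3, e2]
  have h28 : τ3.nat 28 0 0 = e := by
    rw [n3 28 (Or.inr rfl), hτ1, setNat_nat_of_ne (by norm_num), he]
  have hm1 : marked m τ1 4 = (marked m σ 4).erase e := by
    ext f
    rw [Finset.mem_erase, mem_marked, mem_marked, hτ1]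
    by_cases hfe : f = e
    · simp [hfe]
    · have : (f : ℕ) ≠ e := fun h' => hfe (Fin.ext h')
      simp [hfe, this]
  have hm3 : marked m τ3 4 = (marked m σ 4).erase e := by
    rw [marked_congr (n3 4 (Or.inl rfl)), hm1]
  have hcheck : τ3.nat 14 0 0 = 1 ↔ Connects I 𝒮 ((marked m σ 4).erase e) := by
    rw [hτ3, checkDemands_spec l2, Connects, ← hm1, ← connect_spec (ε := ε) l1 hτ2]
    rfl
  rw [hrun]
  by_cases he4 : e ∈ marked m σ 4
  · rw [if_pos he4]
    by_cases hc : Connects I 𝒮 ((marked m σ 4).erase e)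
    · rw [if_pos (hcheck.2 hc), if_pos ⟨he4, hc⟩, hm3]
    · rw [if_neg (fun h' => hc (hcheck.1 h')), if_neg (fun h' => hc h'.2), h28]
      ext f
      have hf3 : f ∈ marked m τ3 4 ↔ f ∈ (marked m σ 4).erase e := by rw [hm3]
      rw [mem_marked, Finset.mem_erase] at hf3
      by_cases hfe : f = e
      · subst hfe
        rw [mem_marked]
        simp [he4]
      · have : (f : ℕ) ≠ e := fun h' => hfe (Fin.ext h')
        rw [mem_marked]
        simp only [Memory.setNat_nat, this, true_and, false_and, if_false, hf3]
        exact and_iff_right hfe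
  · rw [if_neg he4, if_neg (fun h' => he4 h'.1)]

/-- One pass in any order gives a minimal solution: connecting all demands is a monotone property,
so an edge found necessary stays necessary when further edges are removed. -/
theorem prune_spec (hσ : Loaded I 𝒮 σ) (hsol : Connects I 𝒮 (marked m σ 9))
    (hτ : τ = Code.prune.run ε σ) :
    marked m τ 4 ⊆ marked m σ 9 ∧ Connects I 𝒮 (marked m τ 4) ∧
      ∀ e ∈ marked m τ 4, ¬ Connects I 𝒮 ((marked m τ 4).erase e) := by
  classical
  set τ1 := (Code.iter 21 1 (Code.setEntry 4 (idx 21) (entry 9 (idx 21)))).run ε σ with hτ1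
  have l1 : Loaded I 𝒮 τ1 := hσ.run (fun a _ => by simp; omega) (by simp)
  have hcopy : marked m τ1 4 = marked m σ 9 := by
    have key := Code.run_iter (ε := ε) (c := 21) (b := 1) (σ := σ)
      (p := Code.setEntry 4 (idx 21) (entry 9 (idx 21)))
      (fun i τ => ∀ x < i, τ.nat 4 x 0 = σ.nat 9 x 0) ?_ ?_
    · rw [hσ.edges] at key
      ext e
      rw [mem_marked, mem_marked, key e e.2]
    · intro x hx
      omega
    · intro i hi τ hc hn hr hinv x hx
      have h9 : τ.nat 9 = σ.nat 9 := hn 9 (by simp)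
      rcases Nat.lt_succ_iff_lt_or_eq.1 hx with hx | rfl
      · have : x ≠ i := by omega
        simp [hc, hinv x hx, this]
      · simp [hc, h9]
  have key := Code.run_iter (ε := ε) (c := 28) (b := 1) (σ := τ1) (p := Code.pruneEdge)
    (fun i τ => marked m τ 4 ⊆ marked m σ 9 ∧ Connects I 𝒮 (marked m τ 4) ∧
      ∀ e ∈ marked m τ 4, (e : ℕ) < i → ¬ Connects I 𝒮 ((marked m τ 4).erase e)) ?_ ?_
  · rw [l1.edges] at key
    rw [hτ]
    exact ⟨key.1, key.2.1, fun e he => key.2.2 e he e.2⟩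
  · rw [marked_congr (setNat_nat_of_ne (by norm_num)), hcopy]
    exact ⟨subset_rfl, hsol, fun e _ he => absurd he (Nat.not_lt_zero _)⟩
  · rintro i hi τ hc hn hr ⟨h1, h2, h3⟩
    rw [l1.edges] at hi
    obtain ⟨e, rfl⟩ : ∃ e : Fin m, (e : ℕ) = i := ⟨⟨i, hi⟩, rfl⟩
    have hload : Loaded I 𝒮 τ := l1.congr
      (fun b hb => hn b (by
        simp [Code.pruneEdge, Code.checkDemands, Code.connect, Code.identity, Code.contractSets,
          Code.contractPair, Code.unite]
        omega))
      (hr 0 (by simp [Code.pruneEdge, Code.checkDemands, Code.connect, Code.identity,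
        Code.contractSets, Code.contractPair, Code.unite]))
    rw [marked_congr (setNat_nat_of_ne (by norm_num)), pruneEdge_spec hload hc]
    split_ifs with hcond
    · refine ⟨(Finset.erase_subset _ _).trans h1, hcond.2, ?_⟩
      intro f hf hfe hcon
      rw [Finset.mem_erase] at hf
      have hne : (f : ℕ) ≠ e := fun h' => hf.1 (Fin.ext h')
      refine h3 f hf.2 (by omega) fun d => ?_
      exact I.merged_mono (Finset.erase_subset_erase f (Finset.erase_subset e _)) (hcon d)
    · refine ⟨h1, h2, ?_⟩
      intro f hf hfe hcon
      rcases Nat.lt_succ_iff_lt_or_eq.1 hfe with hfe | hfe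
      · exact h3 f hf hfe hcon
      · obtain rfl : f = e := Fin.ext hfe
        exact hcond ⟨hf, hcon⟩

/-- At the halted state the first process joins all demands, and the second partition is coarser, so
pruning starts from a solution. Its result is charged to the second process from the empty stage on.
-/
theorem steinerForest_spec (hsol : ∃ F, I.IsSolution F)
    (hτ : τ = Code.steinerForest.run ε (encode I 𝒮)) :
    (I.contract (Set.range 𝒮)).IsSolution (decode m τ) ∧
    (I.contract (Set.range 𝒮)).totalCost (decode m τ) ≤
      2 * I.dualTotal ε - I.gain ε (Set.range 𝒮) := by
  classical
  set σ1 := Code.init.run ε (encode I 𝒮) with hσ1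
  set σ2 := (Code.iter 26 0 (.seq Code.phase Code.phase)).run ε σ1 with hσ2
  have hτ' : τ = Code.prune.run ε σ2 := hτ
  have hsync := phases_spec (ε := ε) (init_spec (ε := ε) hσ1) hσ2
  have hhalt : I.Halted (I.run ε (2 * n)) := by
    have := SteinerForest.halted_run (I := I) (ε := ε)
    rwa [Fintype.card_fin] at this
  have hcon : Connects I 𝒮 (marked m σ2 9) := by
    intro d
    rw [← hsync.moat.joined]
    exact hsync.le (SteinerForest.joined_demand_of_halted hhalt hsol d)
  obtain ⟨h1, h2, h3⟩ := prune_spec (ε := ε) hsync.run.loaded hcon hτ'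
  have hdecode : decode m τ = marked m τ 4 := rfl
  rw [hdecode]
  constructor
  · intro d
    exact I.contract_connectivity (h2 d)
  · obtain ⟨b, hb, hreach⟩ := hsync.moat.reach
    have hcost := SteinerForest.cost_le_of_transitions hreach (F := marked m τ 4) h1 h2 (by
      intro e he
      have := h3 e he
      rw [Connects] at this
      push Not at this
      obtain ⟨d, hd⟩ := this
      refine ⟨d, ?_⟩
      convert hd)
    rw [SteinerForest.dualTotal_sub_gain hhalt hsol]
    change ∑ e ∈ marked m τ 4, I.cost e ≤ _
    simp only [Finset.sdiff_empty, sub_zero] at hcost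
    refine hcost.trans ?_
    exact mul_le_mul_of_nonneg_left hb zero_le_two

end Specs

end RAM

/-! ### The theorem. -/

set_option maxRecDepth 20000 in
theorem mainTheorem7 :
    ∃ (P : RAM.Program) (p : Polynomial ℕ),
      ∀ (n m h k : ℕ) (I : SteinerForest (Fin n) (Fin m) (Fin h)) (ε : ℝ)
        (𝒮 : Fin k → Finset (Fin n)),
        0 ≤ ε → (∃ F, I.IsSolution F) → (∀ i, I.ActivelyConnectedSet ε (𝒮 i)) →
        ∃ (T : ℕ) (σ : RAM.Memory),
          RAM.Exec ε P (RAM.encode I 𝒮) T σ ∧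
          T ≤ p.eval (n + m + h + k) ∧
          (I.contract (Set.range 𝒮)).IsSolution (RAM.decode m σ) ∧
          (I.contract (Set.range 𝒮)).totalCost (RAM.decode m σ) ≤
            2 * I.dualTotal ε - I.gain ε (Set.range 𝒮) := by
  refine ⟨RAM.Code.steinerForest.compile, RAM.Code.steinerForest.time, ?_⟩
  intro n m h k I ε 𝒮 _ hsol _
  have hwf : RAM.Code.steinerForest.WellFormed := by
    simp [RAM.Code.steinerForest, RAM.Code.init, RAM.Code.identity, RAM.Code.contractSets,
      RAM.Code.contractPair, RAM.Code.unite, RAM.Code.mergeTight, RAM.Code.phase, RAM.Code.measure,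
      RAM.Code.demandFlags, RAM.Code.clear, RAM.Code.budgetTotals, RAM.Code.clearReal,
      RAM.Code.activeFlags, RAM.Code.minEdges, RAM.Code.onEdge, RAM.Code.minUpdate,
      RAM.Code.minBudgets, RAM.Code.inner, RAM.Code.projectFlags, RAM.Code.growEdges,
      RAM.Code.advance, RAM.Code.growBudgets, RAM.Code.prune, RAM.Code.pruneEdge,
      RAM.Code.connect, RAM.Code.checkDemands]
  have hzero : 0 ∉ RAM.Code.steinerForest.natWrites := by
    simp [RAM.Code.steinerForest, RAM.Code.init, RAM.Code.identity, RAM.Code.contractSets,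
      RAM.Code.contractPair, RAM.Code.unite, RAM.Code.mergeTight, RAM.Code.phase, RAM.Code.measure,
      RAM.Code.demandFlags, RAM.Code.clear, RAM.Code.budgetTotals, RAM.Code.clearReal,
      RAM.Code.activeFlags, RAM.Code.minEdges, RAM.Code.onEdge, RAM.Code.minUpdate,
      RAM.Code.minBudgets, RAM.Code.inner, RAM.Code.projectFlags, RAM.Code.growEdges,
      RAM.Code.advance, RAM.Code.growBudgets, RAM.Code.prune, RAM.Code.pruneEdge,
      RAM.Code.connect, RAM.Code.checkDemands]
  -- Array `0` holds the four sizes and zeros, so the sum of the sizes bounds every loop.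
  have hsize : ∀ i, (RAM.encode I 𝒮).nat 0 i 0 ≤ n + m + h + k := by
    intro i
    simp only [RAM.encode, if_true]
    split_ifs <;> omega
  obtain ⟨T, hT, hexec⟩ := RAM.Code.exec_compile ε hwf hsize hzero
  exact ⟨T, _, hexec, hT, RAM.steinerForest_spec hsol rfl⟩
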